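/- Let $\Bbbk$ be a field and let $H$ be a Hopf algebra over $\Bbbk$ with bijective antipode $\mathcal S$. Let $W$ be a finite-dimensional left-left Yetter–Drinfeld module over $H$, i.e. $W\in{}^H_H\mathcal{YD}$; coactions are written $w\mapsto w_{(-1)}\otimes w_{(0)}$. **Notation.** * The dual $W^*$ is the Yetter–Drinfeld module with $\langle h\cdot f,v\rangle=\langle f,\mathcal S(h)\cdot v\rangle$ and $f_{(-1)}\langle f_{(0)},v\rangle=\mathcal S^{-1}(v_{(-1)})\langle f,v_{(0)}\rangle$ for $h\in H$, $f\in W^*$, $v\in W$. For $w\in W$ put $\phi_W(w)=\mathcal S((\varphi_w)_{(-1)})\cdot(\varphi_w)_{(0)}\in W^{**}$, where $\varphi_w\in W^{**}$ is the evaluation at $w$. * The braiding is $c(v\otimes w)=v_{(-1)}\cdot w\otimes v_{(0)}$, with inverse $c^{-1}(w\otimes v)=v_{(0)}\otimes\mathcal S^{-1}(v_{(-1)})\cdot w$. * For $V\in{}^H_H\mathcal{YD}$ the Nichols algebra is $\mathcal B(V)=T(V)/\mathfrak J(V)$. Here $T(V)$ is the braided Hopf algebra in which all elements of $V$ are primitive,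 and $\mathfrak J(V)$ is the largest homogeneous two-sided ideal of $T(V)$ contained in $\bigoplus_{n\ge2}V^{\otimes n}$ that is a Yetter–Drinfeld submodule and a coideal. Its comultiplication is written $\Delta(x)=x^{(1)}\otimes x^{(2)}$, and $\mathrm{pr}_1:\mathcal B(V)\to V$ is the projection to degree one. * For a linear form $\xi$ on $\mathcal B(W)$ let $\partial_\xi(b)=\langle\xi,b^{(1)}\rangle b^{(2)}$, and extend $f\in W^*$ to $\mathcal B(W)$ by $f\circ\mathrm{pr}_1$. The pairing of $\mathcal B(W^*)$ and $\mathcal B(W)$ is induced by $\langle f_1f_2\cdots f_n,b\rangle=\varepsilon(\partial_{f_1}\partial_{f_2}\cdots\partial_{f_n}(b))$ for $f_1,\dots,f_n\in W^*$, $b\in\mathcal B(W)$. Through it $\partial_\xi$ is defined for $\xi\in\mathcal B(W^*)$. * The algebra $\mathcal B(W)\#\mathcal B(W^*)$ is the vector space $\mathcal B(W)\otimes\mathcal B(W^*)$ with the multiplication $$(x\#\xi)(b\#\zeta)=\langle\xi^{(2)},b^{(1)}\rangle\; x\,(b^{(2)})_{(0)}\#\big(\mathcal S^{-1}((b^{(2)})_{(-1)})\cdot\xi^{(1)}\big)\zeta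 ,$$ which is the one transported from $\operatorname{End}\mathcal B(W)$ along the map $b\#\xi\mapsto L_b\circ\partial_\xi$, where $L_b$ is left multiplication by $b$. The Hopf algebra $H$ acts on it diagonally. * For $w\in W$ and $x\in\mathcal B(W)$ let $\operatorname{ad}_c w(x)=wx-(w_{(-1)}\cdot x)w_{(0)}$. * Let $M$ be an $H$-comodule and $T$ an $H$-module algebra. A linear map $d:M\to\operatorname{End}T$, $f\mapsto d_f$, is a *family of braided derivations of $T$* if $$d_f(xy)=(f_{(-1)}\cdot x)\,d_{f_{(0)}}(y)+d_f(x)\,y\qquad(f\in M,\ x,y\in T).$$ * The canonical family $d^{W^*}:W^{**}\to\operatorname{End}\mathcal B(W^*)$ is $d^{W^*}_f(g)=\langle f,\mathrm{pr}_1(g^{[1]})\rangle g^{[2]}$, where $g^{[1]}\otimes g^{[2]}=c^{-1}(\Delta(g))$. **Theorem.** 1. The map $\Psi:\mathcal B(W)\#\mathcal B(W^*)\to\operatorname{End}\mathcal B(W)$, $\Psi(b\#\xi)=L_b\circ\partial_\xi$, satisfies $\Psi(ab)=\Psi(a)\Psi(b)$ for all $a,b$. 2. The canonical family $d^{W^*}$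 is the unique family of braided derivations of $\mathcal B(W^*)$ indexed by $W^{**}$ with $d^{W^*}_f(\xi)=\langle f,\xi\rangle 1$ for all $f\in W^{**}$, $\xi\in W^*$. 3. There is exactly one linear map $d:W^{**}\to\operatorname{End}(\mathcal B(W)\#\mathcal B(W^*))$ such that for all $w\in W$, $f=\phi_W(w)$, $x\in\mathcal B(W)$ and $g\in\mathcal B(W^*)$ $$d_f(x\#g)=-\operatorname{ad}_c w(x)\#g+(f_{(-1)}\cdot x)\#d^{W^*}_{f_{(0)}}(g),$$ and this $d$ is a family of braided derivations of $\mathcal B(W)\#\mathcal B(W^*)$. -/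

import Mathlib

open TensorProduct Coalgebra HopfAlgebra

section Antipode
variable {k H : Type*} [Field k] [Ring H] [HopfAlgebra k H]

/-- The inverse `S⁻¹` of a bijective antipode. -/
noncomputable def antipodeInv (hS : Function.Bijective (antipode k : H →ₗ[k] H)) : H →ₗ[k] H :=
  (LinearEquiv.ofBijective _ hS).symm

variable (hS : Function.Bijective (antipode k : H →ₗ[k] H))

theorem antipode_antipodeInv (h : H) : antipode k (antipodeInv hS h) = h :=
  (LinearEquiv.ofBijective _ hS).apply_symm_apply h

theorem antipodeInv_antipode (h : H) : antipodeInv hS (antipode k h) = h :=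
  (LinearEquiv.ofBijective _ hS).symm_apply_apply h

theorem antipodeInv_one : antipodeInv hS (1 : H) = 1 :=
  hS.1 (by rw [antipode_antipodeInv, antipode_one])

theorem antipodeInv_mul (a b : H) :
    antipodeInv hS (a * b) = antipodeInv hS b * antipodeInv hS a :=
  hS.1 (by simp only [antipode_mul_antidistrib, antipode_antipodeInv])

theorem counit_antipodeInv (a : H) :
    counit (R := k) (antipodeInv hS a) = counit (R := k) a := by
  conv_rhs => rw [← antipode_antipodeInv hS a, counit_antipode]

open WithConv in
/-- `Δ(S(h)) = S(h₂) ⊗ S(h₁)`. -/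
theorem comul_antipode' (h : H) :
    comul (R := k) (antipode k h) =
      TensorProduct.map (antipode k) (antipode k) (TensorProduct.comm k H H (comul (R := k) h)) := by
  let i1 : H →ₐ[k] H ⊗[k] H := Algebra.TensorProduct.includeLeft
  let i2 : H →ₐ[k] H ⊗[k] H := Algebra.TensorProduct.includeRight
  let S : H →ₗ[k] H := antipode k
  have conv : ∀ i : H →ₐ[k] H ⊗[k] H,
      toConv (i.toLinearMap ∘ₗ S) * toConv i.toLinearMap = 1 := by
    intro i
    ext c
    have := congrArg i (sum_antipode_mul_eq_algebraMap_counit (ℛ k c))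
    simp only [map_sum, map_mul] at this
    rw [(ℛ k c).convMul_apply]
    simpa using this
  have e1 : toConv (comul (R := k) (A := H)) = toConv i1.toLinearMap * toConv i2.toLinearMap := by
    ext c
    rw [(ℛ k c).convMul_apply]
    simp [i1, i2, (ℛ k c).eq]
  have e2 : toConv (i2.toLinearMap ∘ₗ S) * toConv (i1.toLinearMap ∘ₗ S) *
      toConv (comul (R := k) (A := H)) = 1 := by
    rw [e1, mul_assoc, ← mul_assoc _ (toConv i1.toLinearMap), conv, one_mul, conv]
  have e3 := left_inv_eq_right_inv e2 LinearMap.comul_right_inv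
  have e4 := congrArg (fun f => f.ofConv h) e3
  simp only at e4
  refine Eq.trans e4.symm ?_
  refine ((ℛ k h).convMul_apply _ _).trans ?_
  conv_rhs => rw [← (ℛ k h).eq]
  simp [i1, i2, S]

/-- `Δ(S⁻¹(h)) = S⁻¹(h₂) ⊗ S⁻¹(h₁)`. -/
theorem comul_antipodeInv (h : H) :
    comul (R := k) (antipodeInv hS h) =
      TensorProduct.map (antipodeInv hS) (antipodeInv hS)
        (TensorProduct.comm k H H (comul (R := k) h)) := by
  have h1 := comul_antipode' (k := k) (antipodeInv hS h)
  rw [antipode_antipodeInv] at h1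
  rw [h1]
  generalize comul (R := k) (antipodeInv hS h) = t
  induction t with
  | zero => simp
  | add x y hx hy => simp only [map_add, ← hx, ← hy]
  | tmul x y => simp [antipodeInv_antipode]

end Antipode
/-- A left-left Yetter-Drinfeld module structure over the Hopf algebra `H` on the vector space `W`:
an action `act`, a coaction `coact`, written `w ↦ w₋₁ ⊗ w₀`, which is counital and coassociative,
and the compatibility
`h₁ w₋₁ ⊗ h₂ · w₀ = (h₁ · w)₋₁ h₂ ⊗ (h₁ · w)₀`
(equivalent, by means of the antipode, to `δ(h · w) = h₁ w₋₁ S(h₃) ⊗ h₂ · w₀`). -/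
structure YetterDrinfeld (k H W : Type*) [Field k] [Ring H] [HopfAlgebra k H]
    [AddCommGroup W] [Module k W] where
  act : H →ₐ[k] Module.End k W
  coact : W →ₗ[k] H ⊗[k] W
  counit_coact : ∀ w, TensorProduct.lid k W ((counit (R := k)).rTensor W (coact w)) = w
  coassoc : ∀ w, TensorProduct.assoc k H H W ((comul (R := k)).rTensor W (coact w)) =
    coact.lTensor H (coact w)
  compat : ∀ h w,
    TensorProduct.lift ((TensorProduct.mapBilinear (RingHom.id k) H W H W).compl₁₂
        (LinearMap.mul k H) act.toLinearMap) (comul (R := k) h) (coact w) =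
      TensorProduct.lift (LinearMap.mk₂ k
        (fun a b => ((LinearMap.mul k H).flip b).rTensor W (coact (act a w)))
        (by intros; simp) (by intros; simp) (by intros; simp [LinearMap.rTensor_add])
        (by intros; simp [LinearMap.rTensor_smul])) (comul (R := k) h)

section Contract
variable {k W : Type*} [Field k] [AddCommGroup W] [Module k W]

/-- `x ⊗ w ↦ ⟨f, w⟩ x`. -/
noncomputable def contract (X : Type*) [AddCommGroup X] [Module k X] (f : Module.Dual k W) :
    X ⊗[k] W →ₗ[k] X :=
  (TensorProduct.rid k X).toLinearMap ∘ₗ f.lTensor X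

@[simp] theorem contract_tmul (X : Type*) [AddCommGroup X] [Module k X] (f : Module.Dual k W)
    (x : X) (w : W) : contract X f (x ⊗ₜ w) = f w • x := by
  simp [contract]

theorem contract_add (X : Type*) [AddCommGroup X] [Module k X] (f g : Module.Dual k W)
    (t : X ⊗[k] W) : contract X (f + g) t = contract X f t + contract X g t := by
  simp [contract, LinearMap.lTensor_add]

theorem contract_smul (X : Type*) [AddCommGroup X] [Module k X] (c : k) (f : Module.Dual k W)
    (t : X ⊗[k] W) : contract X (c • f) t = c • contract X f t := by
  simp [contract, LinearMap.lTensor_smul]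

theorem dual_tensor_ext [FiniteDimensional k W] {X : Type*} [AddCommGroup X] [Module k X]
    {s t : X ⊗[k] Module.Dual k W}
    (h : ∀ v, contract X (Module.Dual.eval k W v) s = contract X (Module.Dual.eval k W v) t) :
    s = t := by
  apply (TensorProduct.comm k X (Module.Dual k W)).injective
  apply (dualTensorHomEquiv k W X).injective
  ext v
  have key : ∀ u : X ⊗[k] Module.Dual k W,
      dualTensorHomEquiv k W X (TensorProduct.comm k X (Module.Dual k W) u) v =
        contract X (Module.Dual.eval k W v) u := by
    intro u
    induction u with
    | zero => simp
    | add x y hx hy => simp only [map_add, LinearMap.add_apply, hx, hy]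
    | tmul x y => simp
  rw [key, key, h]

end Contract

namespace YetterDrinfeld
section Dual
variable {k H W : Type*} [Field k] [Ring H] [HopfAlgebra k H] [AddCommGroup W] [Module k W]
  (Y : YetterDrinfeld k H W) (hS : Function.Bijective (antipode k : H →ₗ[k] H))

/-- The action of `H` on `W^*`: `⟨h · f, v⟩ = ⟨f, S(h) · v⟩`. -/
noncomputable def dualAct : H →ₐ[k] Module.End k (Module.Dual k W) :=
  AlgHom.ofLinearMap
    (LinearMap.mk₂ k (fun h f => f ∘ₗ Y.act (antipode k h))
      (by intros; ext; simp) (by intros; ext; simp) (by intros; ext; simp) (by intros; ext; simp))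
    (by ext; simp) (by intros; ext; simp [antipode_mul_antidistrib])

@[simp] theorem dualAct_apply (h : H) (f : Module.Dual k W) (v : W) :
    Y.dualAct h f v = f (Y.act (antipode k h) v) := rfl

variable [FiniteDimensional k W]

/-- The coaction of `H` on `W^*`, for finite-dimensional `W`: it is determined by
`f₋₁ ⟨f₀, v⟩ = S⁻¹(v₋₁) ⟨f, v₀⟩`, see `dualCoact_eval`. -/
noncomputable def dualCoact : Module.Dual k W →ₗ[k] H ⊗[k] Module.Dual k W :=
  (TensorProduct.comm k (Module.Dual k W) H).toLinearMap ∘ₗ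
    (dualTensorHomEquiv k W H).symm.toLinearMap ∘ₗ
    LinearMap.mk₂ k (fun f v => antipodeInv hS (contract H f (Y.coact v)))
      (by intros; simp [contract_add]) (by intros; simp [contract_smul])
      (by intros; simp) (by intros; simp)

theorem dualCoact_eval (f : Module.Dual k W) (v : W) :
    contract H (Module.Dual.eval k W v) (Y.dualCoact hS f) =
      antipodeInv hS (contract H f (Y.coact v)) := by
  have key : ∀ u : Module.Dual k W ⊗[k] H,
      contract H (Module.Dual.eval k W v) (TensorProduct.comm k (Module.Dual k W) H u) =
      dualTensorHomEquiv k W H u v := by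
    intro u
    induction u with
    | zero => simp
    | add x y hx hy => simp only [map_add, LinearMap.add_apply, hx, hy]
    | tmul x y => simp
  simp only [dualCoact, LinearMap.comp_apply, LinearEquiv.coe_coe]
  rw [key, LinearEquiv.apply_symm_apply, LinearMap.mk₂_apply]

/-- The left dual `W^*` of a finite-dimensional Yetter-Drinfeld module `W`. -/
noncomputable def dual : YetterDrinfeld k H (Module.Dual k W) where
  act := Y.dualAct
  coact := Y.dualCoact hS
  counit_coact f := by
    ext v
    have h1 : ∀ u : H ⊗[k] Module.Dual k W,
        TensorProduct.lid k _ ((counit (R := k)).rTensor _ u) v =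
          counit (R := k) (contract H (Module.Dual.eval k W v) u) := by
      intro u
      induction u with
      | zero => simp
      | add x y hx hy => simp only [map_add, LinearMap.add_apply, hx, hy]
      | tmul x y => simp [mul_comm]
    have h2 : ∀ u : H ⊗[k] W,
        counit (R := k) (contract H f u) = f (TensorProduct.lid k _ ((counit (R := k)).rTensor _ u)) := by
      intro u
      induction u with
      | zero => simp
      | add x y hx hy => simp only [map_add, hx, hy]
      | tmul x y => simp [mul_comm]
    rw [h1, dualCoact_eval, counit_antipodeInv, h2, Y.counit_coact]
  coassoc f := by
    apply (TensorProduct.assoc k H H _).symm.injective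
    rw [LinearEquiv.symm_apply_apply]
    apply dual_tensor_ext
    intro v
    have h1 : ∀ u : H ⊗[k] Module.Dual k W,
        contract (H ⊗[k] H) (Module.Dual.eval k W v) ((comul (R := k)).rTensor _ u) =
          comul (R := k) (contract H (Module.Dual.eval k W v) u) := by
      intro u
      induction u with
      | zero => simp
      | add x y hx hy => simp only [map_add, hx, hy]
      | tmul x y => simp
    obtain ⟨s, hs⟩ := TensorProduct.exists_finset (Y.coact v)
    have h2 : ∀ u : H ⊗[k] Module.Dual k W,
        contract (H ⊗[k] H) (Module.Dual.eval k W v) ((TensorProduct.assoc k H H _).symm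
          ((Y.dualCoact hS).lTensor H u)) =
        ∑ i ∈ s, contract H (Module.Dual.eval k W i.2) u ⊗ₜ[k] antipodeInv hS i.1 := by
      have h3 : ∀ (x : H) (t : H ⊗[k] Module.Dual k W),
          contract (H ⊗[k] H) (Module.Dual.eval k W v)
            ((TensorProduct.assoc k H H _).symm (x ⊗ₜ[k] t)) =
          x ⊗ₜ[k] contract H (Module.Dual.eval k W v) t := by
        intro x t
        induction t with
        | zero => simp
        | add a b ha hb => simp only [TensorProduct.tmul_add, map_add, ha, hb]
        | tmul a b => simp
      intro u
      induction u with
      | zero => simp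
      | add x y hx hy => simp only [map_add, hx, hy, TensorProduct.add_tmul, Finset.sum_add_distrib]
      | tmul x g =>
        rw [LinearMap.lTensor_tmul, h3, dualCoact_eval, hs]
        simp [TensorProduct.tmul_sum, TensorProduct.smul_tmul']
    have h4 : ∀ u : H ⊗[k] W, comul (R := k) (contract H f u) =
        contract (H ⊗[k] H) f ((comul (R := k)).rTensor _ u) := by
      intro u
      induction u with
      | zero => simp
      | add x y hx hy => simp only [map_add, hx, hy]
      | tmul x y => simp
    have h5 : ∀ (x : H) (t : H ⊗[k] W), contract (H ⊗[k] H) f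
        ((TensorProduct.assoc k H H _).symm (x ⊗ₜ[k] t)) = x ⊗ₜ[k] contract H f t := by
      intro x t
      induction t with
      | zero => simp
      | add a b ha hb => simp only [TensorProduct.tmul_add, map_add, ha, hb]
      | tmul a b => simp
    rw [h1, h2, dualCoact_eval, comul_antipodeInv, h4,
      ← (TensorProduct.assoc k H H W).symm_apply_apply ((comul (R := k)).rTensor _ _),
      Y.coassoc]
    conv_lhs => rw [hs]
    simp [h5, dualCoact_eval]
  compat h f := by
    apply dual_tensor_ext
    intro v
    obtain ⟨s, hs⟩ := TensorProduct.exists_finset (comul (R := k) h)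
    have hSh : comul (R := k) (antipode k h) =
        ∑ i ∈ s, antipode k i.2 ⊗ₜ[k] antipode k i.1 := by
      rw [comul_antipode', hs]; simp
    have h1 : ∀ (a b : H) (u : H ⊗[k] Module.Dual k W), contract H (Module.Dual.eval k W v)
        (TensorProduct.map (LinearMap.mul k H a) (Y.dualAct b) u) =
          a * contract H (Module.Dual.eval k W (Y.act (antipode k b) v)) u := by
      intro a b u
      induction u with
      | zero => simp
      | add x y hx hy => simp only [map_add, hx, hy, mul_add]
      | tmul x y => simp
    have h2 : ∀ (b : H) (u : H ⊗[k] Module.Dual k W), contract H (Module.Dual.eval k W v)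
        (((LinearMap.mul k H).flip b).rTensor _ u) =
          contract H (Module.Dual.eval k W v) u * b := by
      intro b u
      induction u with
      | zero => simp
      | add x y hx hy => simp only [map_add, hx, hy, add_mul]
      | tmul x y => simp
    have h3 : ∀ (a b : H) (u : H ⊗[k] W), contract H f
        (TensorProduct.map (LinearMap.mul k H a) (Y.act b) u) =
          a * contract H (f ∘ₗ Y.act b) u := by
      intro a b u
      induction u with
      | zero => simp
      | add x y hx hy => simp only [map_add, hx, hy, mul_add]
      | tmul x y => simp
    have h4 : ∀ (b : H) (u : H ⊗[k] W), contract H f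
        (((LinearMap.mul k H).flip b).rTensor _ u) = contract H f u * b := by
      intro b u
      induction u with
      | zero => simp
      | add x y hx hy => simp only [map_add, hx, hy, add_mul]
      | tmul x y => simp
    have key := congrArg (contract H f) (Y.compat (antipode k h) v)
    rw [hSh] at key
    simp only [map_sum, LinearMap.sum_apply, TensorProduct.lift.tmul, LinearMap.compl₁₂_apply,
      TensorProduct.mapBilinear_apply, AlgHom.toLinearMap_apply, LinearMap.mk₂_apply, h3, h4] at key
    rw [hs]
    simp only [map_sum, LinearMap.sum_apply, TensorProduct.lift.tmul, LinearMap.compl₁₂_apply,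
      TensorProduct.mapBilinear_apply, AlgHom.toLinearMap_apply, LinearMap.mk₂_apply, h1, h2,
      dualCoact_eval]
    apply hS.1
    simp only [map_sum, antipode_mul_antidistrib, antipode_antipodeInv]
    exact key.symm
end Dual
end YetterDrinfeld
section BraidedAlgebra
variable {k H A : Type*} [Field k] [Ring H] [HopfAlgebra k H] [Ring A] [Algebra k A]

/-- The multiplication of the braided tensor product `A ⊗ A`:
`(p ⊗ q)(r ⊗ s) = p (q₋₁ · r) ⊗ q₀ s`. -/
noncomputable def braidedMul (ρ : H →ₐ[k] Module.End k A) (δ : A →ₐ[k] H ⊗[k] A) :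
    A ⊗[k] A →ₗ[k] Module.End k (A ⊗[k] A) :=
  TensorProduct.lift ((LinearMap.mul k (Module.End k (A ⊗[k] A))).compl₁₂
    (LinearMap.rTensorHom A ∘ₗ LinearMap.mul k A)
    ((TensorProduct.homTensorHomMap (RingHom.id k) A A A A) ∘ₗ
      TensorProduct.map ρ.toLinearMap (LinearMap.mul k A) ∘ₗ δ.toLinearMap))

/-- `A` is a module algebra for the action `ρ` and a comodule for the (multiplicative) coaction
`δ`. -/
structure IsBraidedAlgebra (ρ : H →ₐ[k] Module.End k A) (δ : A →ₐ[k] H ⊗[k] A) : Prop where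
  act_one : ∀ h, ρ h 1 = counit (R := k) h • (1 : A)
  act_mul : ∀ h x y, ρ h (x * y) = LinearMap.mul' k A
    (TensorProduct.map (ρ.toLinearMap.flip x) (ρ.toLinearMap.flip y) (comul (R := k) h))
  counit_coact : ∀ x, TensorProduct.lid k A ((counit (R := k)).rTensor A (δ x)) = x
  coassoc : ∀ x, TensorProduct.assoc k H H A ((comul (R := k)).rTensor A (δ x)) =
    δ.toLinearMap.lTensor H (δ x)

variable {ρ : H →ₐ[k] Module.End k A} {δ : A →ₐ[k] H ⊗[k] A}

theorem braidedMul_tmul (p q r s : A) (t : Finset (H × A)) (ht : δ q = ∑ i ∈ t, i.1 ⊗ₜ[k] i.2) :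
    braidedMul ρ δ (p ⊗ₜ q) (r ⊗ₜ s) = ∑ i ∈ t, (p * ρ i.1 r) ⊗ₜ[k] (i.2 * s) := by
  simp [braidedMul, ht]

theorem braidedMul_tmul_sum {ι : Type*} (p q r s : A) (t : Finset ι) (h : ι → H) (x : ι → A)
    (ht : δ q = ∑ i ∈ t, h i ⊗ₜ[k] x i) :
    braidedMul ρ δ (p ⊗ₜ q) (r ⊗ₜ s) = ∑ i ∈ t, (p * ρ (h i) r) ⊗ₜ[k] (x i * s) := by
  simp [braidedMul, ht]

/-- The operator `r ⊗ s ↦ q₋₁ · r ⊗ q₀ s`. -/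
noncomputable def braidedMulRight (ρ : H →ₐ[k] Module.End k A) (δ : A →ₐ[k] H ⊗[k] A) :
    A →ₐ[k] Module.End k (A ⊗[k] A) :=
  (Module.endTensorEndAlgHom.comp (Algebra.TensorProduct.map ρ (Algebra.lmul k A))).comp δ

theorem braidedMul_tmul' (p q : A) :
    braidedMul ρ δ (p ⊗ₜ q) = (LinearMap.mulLeft k p).rTensor A * braidedMulRight ρ δ q := by
  rfl

theorem braidedMulRight_comm (hA : IsBraidedAlgebra ρ δ) (q r : A) (t : Finset (H × A))
    (ht : δ q = ∑ i ∈ t, i.1 ⊗ₜ[k] i.2) :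
    braidedMulRight ρ δ q * (LinearMap.mulLeft k r).rTensor A =
      ∑ i ∈ t, (LinearMap.mulLeft k (ρ i.1 r)).rTensor A * braidedMulRight ρ δ i.2 := by
  let E : H ⊗[k] A →ₐ[k] Module.End k (A ⊗[k] A) :=
    Module.endTensorEndAlgHom.comp (Algebra.TensorProduct.map ρ (Algebra.lmul k A))
  let G : H ⊗[k] (H ⊗[k] A) →ₗ[k] Module.End k (A ⊗[k] A) :=
    TensorProduct.lift ((LinearMap.mul k (Module.End k (A ⊗[k] A))).compl₁₂
      (LinearMap.rTensorHom A ∘ₗ LinearMap.mul k A ∘ₗ ρ.toLinearMap.flip r) E.toLinearMap)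
  have h1 : ∀ (d : H ⊗[k] H) (x y z : A),
      G (TensorProduct.assoc k H H A (d ⊗ₜ x)) (y ⊗ₜ z) =
        LinearMap.mul' k A (TensorProduct.map (ρ.toLinearMap.flip r) (ρ.toLinearMap.flip y) d)
          ⊗ₜ (x * z) := by
    intro d x y z
    induction d with
    | zero => simp
    | add a b ha hb => simp only [TensorProduct.add_tmul, map_add, LinearMap.add_apply, ha, hb]
    | tmul a b => simp [G, E, Module.endTensorEndAlgHom_apply]
  have h2 := congrArg G (hA.coassoc q)
  rw [ht] at h2
  simp only [map_sum, LinearMap.rTensor_tmul, LinearMap.lTensor_tmul] at h2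
  have h3 : ∀ i : H × A, G (i.1 ⊗ₜ[k] δ.toLinearMap i.2) =
      (LinearMap.mulLeft k (ρ i.1 r)).rTensor A * braidedMulRight ρ δ i.2 := by
    intro i; rfl
  simp only [h3] at h2
  rw [← h2]
  ext y z
  simp only [TensorProduct.AlgebraTensorModule.curry_apply, LinearMap.restrictScalars_self,
    TensorProduct.curry_apply, LinearMap.sum_apply, h1]
  simp [braidedMulRight, ht, Module.endTensorEndAlgHom_apply, hA.act_mul]

theorem braidedMul_assoc (hA : IsBraidedAlgebra ρ δ) (u v : A ⊗[k] A) :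
    braidedMul ρ δ (braidedMul ρ δ u v) = braidedMul ρ δ u * braidedMul ρ δ v := by
  induction u with
  | zero => simp
  | add x y hx hy => simp only [map_add, LinearMap.add_apply, hx, hy, add_mul]
  | tmul p q =>
    induction v with
    | zero => simp
    | add x y hx hy => simp only [map_add, hx, hy, mul_add]
    | tmul r s =>
      obtain ⟨t, ht⟩ := TensorProduct.exists_finset (δ q)
      rw [braidedMul_tmul p q r s t ht, braidedMul_tmul', braidedMul_tmul', mul_assoc,
        ← mul_assoc _ _ (braidedMulRight ρ δ s), braidedMulRight_comm hA q r t ht, map_sum,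
        Finset.sum_mul, Finset.mul_sum]
      refine Finset.sum_congr rfl fun i _ => ?_
      rw [braidedMul_tmul', map_mul, LinearMap.mulLeft_mul, LinearMap.rTensor_comp]
      rfl

theorem braidedMul_one_left : braidedMul ρ δ ((1 : A) ⊗ₜ[k] (1 : A)) = 1 := by
  rw [braidedMul_tmul', map_one]; simp; rfl

theorem braidedMul_one_right (hA : IsBraidedAlgebra ρ δ) (u : A ⊗[k] A) :
    braidedMul ρ δ u ((1 : A) ⊗ₜ[k] (1 : A)) = u := by
  induction u with
  | zero => simp
  | add x y hx hy => simp only [map_add, LinearMap.add_apply, hx, hy]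
  | tmul p q =>
    obtain ⟨t, ht⟩ := TensorProduct.exists_finset (δ q)
    rw [braidedMul_tmul p q 1 1 t ht]
    have := hA.counit_coact q
    rw [ht] at this
    simp only [map_sum, LinearMap.rTensor_tmul, TensorProduct.lid_tmul] at this
    conv_rhs => rw [← this]
    simp [hA.act_one, TensorProduct.tmul_sum, TensorProduct.smul_tmul']

end BraidedAlgebra
namespace YetterDrinfeld
section TensorAlg
variable {k H W : Type*} [Field k] [Ring H] [HopfAlgebra k H] [AddCommGroup W] [Module k W]
  (Y : YetterDrinfeld k H W)

open WithConv in
/-- The action of `H` on `T(W)`, read as the algebra map from `T(W)` to the convolution algebra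
`Hom(H, T(W))` that sends `w` to `h ↦ h · w`. -/
noncomputable def tensorActConv : TensorAlgebra k W →ₐ[k] WithConv (H →ₗ[k] TensorAlgebra k W) :=
  TensorAlgebra.lift k ((WithConv.linearEquiv k (H →ₗ[k] TensorAlgebra k W)).symm.toLinearMap ∘ₗ
    (LinearMap.llcomp k H W (TensorAlgebra k W) (TensorAlgebra.ι k)) ∘ₗ Y.act.toLinearMap.flip)

/-- The linear map underlying the action of `H` on `T(W)`. -/
noncomputable def tensorActLin : H →ₗ[k] TensorAlgebra k W →ₗ[k] TensorAlgebra k W :=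
  ((WithConv.linearEquiv k (H →ₗ[k] TensorAlgebra k W)).toLinearMap ∘ₗ
    Y.tensorActConv.toLinearMap).flip

theorem tensorActLin_ι (h : H) (w : W) :
    Y.tensorActLin h (TensorAlgebra.ι k w) = TensorAlgebra.ι k (Y.act h w) := by
  simp [tensorActLin, tensorActConv]

theorem tensorActLin_algebraMap (h : H) (c : k) :
    Y.tensorActLin h (algebraMap k _ c) = counit (R := k) h • algebraMap k _ c := by
  simp [tensorActLin, Algebra.smul_def, ← map_mul, mul_comm]

theorem tensorActLin_mul (h : H) (x y : TensorAlgebra k W) :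
    Y.tensorActLin h (x * y) = LinearMap.mul' k _
      (TensorProduct.map (Y.tensorActLin.flip x) (Y.tensorActLin.flip y) (comul (R := k) h)) := by
  simp [tensorActLin]

/-- The action of `H` on the tensor algebra: the one extending the action on `W` and making `T(W)`
a module algebra. -/
noncomputable def tensorAct : H →ₐ[k] Module.End k (TensorAlgebra k W) :=
  AlgHom.ofLinearMap Y.tensorActLin
    (by
      ext x
      induction x using TensorAlgebra.induction with
      | algebraMap c => simp [tensorActLin_algebraMap]
      | ι w => simp [tensorActLin_ι]
      | mul a b ha hb =>
        simp only [Module.End.one_apply] at ha hb ⊢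
        simp [tensorActLin_mul, ha, hb, Algebra.TensorProduct.one_def]
      | add a b ha hb => simp only [map_add, ha, hb])
    (by
      intro h h'
      ext x
      induction x using TensorAlgebra.induction generalizing h h' with
      | algebraMap c =>
        rw [Module.End.mul_apply, tensorActLin_algebraMap, tensorActLin_algebraMap, map_smul,
          tensorActLin_algebraMap, smul_smul, Bialgebra.counit_mul, mul_comm]
      | ι w => simp [tensorActLin_ι]
      | mul a b ha hb =>
        simp only [Module.End.mul_apply] at ha hb ⊢
        obtain ⟨s, hs⟩ := TensorProduct.exists_finset (comul (R := k) h)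
        obtain ⟨s', hs'⟩ := TensorProduct.exists_finset (comul (R := k) h')
        simp only [tensorActLin_mul, Bialgebra.comul_mul, hs, hs', Finset.sum_mul_sum, map_sum,
          Algebra.TensorProduct.tmul_mul_tmul, TensorProduct.map_tmul, LinearMap.mul'_apply,
          LinearMap.flip_apply, ha, hb]
        rw [Finset.sum_comm]
      | add a b ha hb => simp only [map_add, ha, hb])

@[simp] theorem tensorAct_ι (h : H) (w : W) :
    Y.tensorAct h (TensorAlgebra.ι k w) = TensorAlgebra.ι k (Y.act h w) :=
  Y.tensorActLin_ι h w

/-- The coaction of `H` on the tensor algebra: the algebra map extending the coaction on `W`. -/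
noncomputable def tensorCoact : TensorAlgebra k W →ₐ[k] H ⊗[k] TensorAlgebra k W :=
  TensorAlgebra.lift k ((TensorAlgebra.ι k).lTensor H ∘ₗ Y.coact)

@[simp] theorem tensorCoact_ι (w : W) :
    Y.tensorCoact (TensorAlgebra.ι k w) = (TensorAlgebra.ι k).lTensor H (Y.coact w) := by
  simp [tensorCoact]

theorem tensor_isBraidedAlgebra : IsBraidedAlgebra Y.tensorAct Y.tensorCoact where
  act_one h := by
    have := Y.tensorActLin_algebraMap h 1
    rw [map_one] at this
    exact this
  act_mul := Y.tensorActLin_mul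
  counit_coact x := by
    have : ((Algebra.TensorProduct.lid k (TensorAlgebra k W)).toAlgHom.comp
        (Algebra.TensorProduct.map (Bialgebra.counitAlgHom k H) (AlgHom.id k _))).comp
          Y.tensorCoact = AlgHom.id k _ := by
      ext w
      obtain ⟨s, hs⟩ := TensorProduct.exists_finset (Y.coact w)
      have h2 := congrArg (TensorAlgebra.ι k) (Y.counit_coact w)
      rw [hs] at h2
      simpa [hs] using h2
    exact congrArg (fun f => f x) this
  coassoc x := by
    have : ((Algebra.TensorProduct.assoc k k k H H (TensorAlgebra k W)).toAlgHom.comp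
        (Algebra.TensorProduct.map (Bialgebra.comulAlgHom k H) (AlgHom.id k _))).comp
          Y.tensorCoact =
        (Algebra.TensorProduct.map (AlgHom.id k H) Y.tensorCoact).comp Y.tensorCoact := by
      ext w
      obtain ⟨s, hs⟩ := TensorProduct.exists_finset (Y.coact w)
      have h2 := congrArg (((TensorAlgebra.ι k).lTensor H).lTensor H) (Y.coassoc w)
      have h3 : ∀ (d : H ⊗[k] H) (w : W),
          ((TensorAlgebra.ι k).lTensor H).lTensor H (TensorProduct.assoc k H H W (d ⊗ₜ w)) =
            TensorProduct.assoc k H H _ (d ⊗ₜ TensorAlgebra.ι k w) := by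
        intro d w
        induction d with
        | zero => simp
        | add a b ha hb => simp only [TensorProduct.add_tmul, map_add, ha, hb]
        | tmul a b => simp
      rw [hs] at h2
      simp only [map_sum, LinearMap.rTensor_tmul, LinearMap.lTensor_tmul, h3] at h2
      simpa [hs, TensorProduct.AlgebraTensorModule.assoc_eq] using h2
    exact congrArg (fun f => f x) this

/-- Left multiplication by `Δ(x)` on the braided tensor product `T(W) ⊗ T(W)`: the algebra map in
`x` determined by `Δ(w) = w ⊗ 1 + 1 ⊗ w` for `w ∈ W`. -/
noncomputable def tensorComulLeft : TensorAlgebra k W →ₐ[k]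
    Module.End k (TensorAlgebra k W ⊗[k] TensorAlgebra k W) :=
  TensorAlgebra.lift k (braidedMul Y.tensorAct Y.tensorCoact ∘ₗ
    ((TensorProduct.mk k _ _).flip 1 + TensorProduct.mk k _ _ 1) ∘ₗ TensorAlgebra.ι k)

/-- The comultiplication `Δ` of the braided Hopf algebra `T(W)`: the algebra map to the braided
tensor product `T(W) ⊗ T(W)` with `Δ(w) = w ⊗ 1 + 1 ⊗ w` for `w ∈ W`. -/
noncomputable def tensorComul : TensorAlgebra k W →ₗ[k] TensorAlgebra k W ⊗[k] TensorAlgebra k W :=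
  Y.tensorComulLeft.toLinearMap.flip (1 ⊗ₜ 1)

theorem tensorComul_one : Y.tensorComul 1 = 1 ⊗ₜ 1 := by simp [tensorComul]

theorem tensorComul_ι (w : W) : Y.tensorComul (TensorAlgebra.ι k w) =
    TensorAlgebra.ι k w ⊗ₜ 1 + 1 ⊗ₜ TensorAlgebra.ι k w := by
  have := braidedMul_one_right Y.tensor_isBraidedAlgebra
    (TensorAlgebra.ι k w ⊗ₜ 1 + 1 ⊗ₜ TensorAlgebra.ι k w)
  simpa [tensorComul, tensorComulLeft] using this

theorem tensorComulLeft_eq (x : TensorAlgebra k W) :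
    Y.tensorComulLeft x = braidedMul Y.tensorAct Y.tensorCoact (Y.tensorComul x) := by
  induction x using TensorAlgebra.induction with
  | algebraMap c =>
    simp only [Algebra.algebraMap_eq_smul_one, map_smul, tensorComul_one,
      braidedMul_one_left, map_one]
  | ι w => rw [tensorComul_ι]; simp [tensorComulLeft]
  | mul a b ha hb =>
    have : Y.tensorComul (a * b) = Y.tensorComulLeft a (Y.tensorComul b) := by
      simp [tensorComul]
    rw [map_mul, this, ha, braidedMul_assoc Y.tensor_isBraidedAlgebra, hb]
  | add a b ha hb => simp only [map_add, ha, hb]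

/-- `Δ` is multiplicative. -/
theorem tensorComul_mul (x y : TensorAlgebra k W) : Y.tensorComul (x * y) =
    braidedMul Y.tensorAct Y.tensorCoact (Y.tensorComul x) (Y.tensorComul y) := by
  rw [← tensorComulLeft_eq]; simp [tensorComul]

end TensorAlg
end YetterDrinfeld
section QuotientLift
variable {k A M : Type*} [Field k] [Ring A] [Algebra k A] [AddCommGroup M] [Module k M]

/-- The linear map induced on the quotient algebra `A ⧸ I` by a linear map vanishing on `I`. -/
noncomputable def idealQuotientLift (I : Ideal A) [I.IsTwoSided] (f : A →ₗ[k] M)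
    (h : ∀ x ∈ I, f x = 0) : (A ⧸ I) →ₗ[k] M where
  toFun := QuotientAddGroup.lift I.toAddSubgroup f.toAddMonoidHom h
  map_add' := map_add _
  map_smul' c x := by
    obtain ⟨x, rfl⟩ := Ideal.Quotient.mk_surjective x
    exact f.map_smul c x

@[simp] theorem idealQuotientLift_mk (I : Ideal A) [I.IsTwoSided] (f : A →ₗ[k] M)
    (h : ∀ x ∈ I, f x = 0) (x : A) :
    idealQuotientLift I f h (Ideal.Quotient.mk I x) = f x := rfl

end QuotientLift

namespace YetterDrinfeld
section Nichols
variable {k H W : Type*} [Field k] [Ring H] [HopfAlgebra k H] [AddCommGroup W] [Module k W]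
  (Y : YetterDrinfeld k H W)

/-- The ideals whose sum is the defining ideal of the Nichols algebra: two-sided homogeneous ideals of
`T(W)` contained in degrees at least two (zero components in degrees `0` and `1`), which are
Yetter-Drinfeld submodules and coideals. -/
structure IsNicholsAdmissible (I : Ideal (TensorAlgebra k W)) : Prop where
  twoSided : I.IsTwoSided
  homogeneous : I.IsHomogeneous (fun n : ℕ => (TensorAlgebra.ι k : W →ₗ[k] _).range ^ n)
  degree_zero : ∀ x ∈ I, TensorAlgebra.algebraMapInv (R := k) (M := W) x = 0
  degree_one : ∀ x ∈ I, TensorAlgebra.ιInv (R := k) (M := W) x = 0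
  act_mem : ∀ h, ∀ x ∈ I, Y.tensorAct h x ∈ I
  coact_mem : ∀ x ∈ I, Y.tensorCoact x ∈ ((I.restrictScalars k).subtype.lTensor H).range
  comul_mem : ∀ x ∈ I, Y.tensorComul x ∈
    ((I.restrictScalars k).subtype.rTensor (TensorAlgebra k W)).range ⊔
      ((I.restrictScalars k).subtype.lTensor (TensorAlgebra k W)).range

/-- The defining ideal `J(W)` of the Nichols algebra: the largest admissible ideal. -/
def nicholsIdeal : Ideal (TensorAlgebra k W) := sSup {I | Y.IsNicholsAdmissible I}

theorem nicholsIdeal_induction {p : TensorAlgebra k W → Prop}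
    (mem : ∀ I, Y.IsNicholsAdmissible I → ∀ x ∈ I, p x) (zero : p 0)
    (add : ∀ x y, p x → p y → p (x + y)) {x : TensorAlgebra k W} (hx : x ∈ Y.nicholsIdeal) :
    p x := by
  rw [nicholsIdeal, sSup_eq_iSup'] at hx
  exact Submodule.iSup_induction _ (motive := p) hx (fun I => mem I.1 I.2) zero add

theorem le_nicholsIdeal {I : Ideal (TensorAlgebra k W)} (hI : Y.IsNicholsAdmissible I) :
    I ≤ Y.nicholsIdeal := le_sSup hI

instance nicholsIdeal_isTwoSided : Y.nicholsIdeal.IsTwoSided where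
  mul_mem_of_left b ha := by
    refine Y.nicholsIdeal_induction (p := fun a => a * b ∈ Y.nicholsIdeal) ?_ ?_ ?_ ha
    · intro I hI x hx
      have := hI.twoSided
      exact Y.le_nicholsIdeal hI (I.mul_mem_right b hx)
    · simp
    · intro x y hx hy
      rw [add_mul]; exact add_mem hx hy

theorem range_lTensor_mono {k A X : Type*} [Field k] [AddCommGroup A] [Module k A]
    [AddCommGroup X] [Module k X] {I J : Submodule k A} (h : I ≤ J) :
    (I.subtype.lTensor X).range ≤ (J.subtype.lTensor X).range := by
  have : I.subtype = J.subtype ∘ₗ Submodule.inclusion h := rfl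
  rw [this, LinearMap.lTensor_comp]
  exact LinearMap.range_comp_le_range _ _

theorem range_rTensor_mono {k A X : Type*} [Field k] [AddCommGroup A] [Module k A]
    [AddCommGroup X] [Module k X] {I J : Submodule k A} (h : I ≤ J) :
    (I.subtype.rTensor X).range ≤ (J.subtype.rTensor X).range := by
  have : I.subtype = J.subtype ∘ₗ Submodule.inclusion h := rfl
  rw [this, LinearMap.rTensor_comp]
  exact LinearMap.range_comp_le_range _ _

/-- The sum of all admissible ideals is admissible. -/
theorem nicholsIdeal_isNicholsAdmissible : Y.IsNicholsAdmissible Y.nicholsIdeal where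
  twoSided := inferInstance
  homogeneous := by
    intro n x hx
    refine Y.nicholsIdeal_induction (p := fun x => ((DirectSum.decompose (fun n : ℕ =>
      (TensorAlgebra.ι k : W →ₗ[k] _).range ^ n) x n : _) : TensorAlgebra k W) ∈ Y.nicholsIdeal)
      ?_ ?_ ?_ hx
    · intro I hI x hx
      exact Y.le_nicholsIdeal hI (hI.homogeneous n hx)
    · simp
    · intro x y hx hy
      rw [DirectSum.decompose_add, DirectSum.add_apply, Submodule.coe_add]
      exact add_mem hx hy
  degree_zero x hx := Y.nicholsIdeal_induction (fun I hI => hI.degree_zero) (map_zero _)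
    (fun x y hx hy => by rw [map_add, hx, hy, add_zero]) hx
  degree_one x hx := Y.nicholsIdeal_induction (fun I hI => hI.degree_one) (map_zero _)
    (fun x y hx hy => by rw [map_add, hx, hy, add_zero]) hx
  act_mem h x hx := Y.nicholsIdeal_induction (p := fun x => Y.tensorAct h x ∈ Y.nicholsIdeal)
    (fun I hI x hx => Y.le_nicholsIdeal hI (hI.act_mem h x hx))
    (by simp) (fun x y hx hy => by rw [map_add]; exact add_mem hx hy) hx
  coact_mem x hx := Y.nicholsIdeal_induction (p := fun x => Y.tensorCoact x ∈
      ((Y.nicholsIdeal.restrictScalars k).subtype.lTensor H).range)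
    (fun I hI x hx => range_lTensor_mono (fun _ hz => Y.le_nicholsIdeal hI hz)
      (hI.coact_mem x hx))
    (by simp) (fun x y hx hy => by rw [map_add]; exact add_mem hx hy) hx
  comul_mem x hx := Y.nicholsIdeal_induction (p := fun x => Y.tensorComul x ∈
      ((Y.nicholsIdeal.restrictScalars k).subtype.rTensor (TensorAlgebra k W)).range ⊔
        ((Y.nicholsIdeal.restrictScalars k).subtype.lTensor (TensorAlgebra k W)).range)
    (fun I hI x hx => (sup_le_sup
      (range_rTensor_mono (fun _ hz => Y.le_nicholsIdeal hI hz))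
      (range_lTensor_mono (fun _ hz => Y.le_nicholsIdeal hI hz)) :
        ((I.restrictScalars k).subtype.rTensor (TensorAlgebra k W)).range ⊔
          ((I.restrictScalars k).subtype.lTensor (TensorAlgebra k W)).range ≤ _)
      (hI.comul_mem x hx))
    (by simp) (fun x y hx hy => by rw [map_add]; exact add_mem hx hy) hx

/-- The Nichols algebra `B(W) = T(W)/J(W)`. -/
def Nichols : Type _ := TensorAlgebra k W ⧸ Y.nicholsIdeal

noncomputable instance : Ring Y.Nichols := inferInstanceAs (Ring (_ ⧸ Y.nicholsIdeal))

noncomputable instance : Algebra k Y.Nichols := inferInstanceAs (Algebra k (_ ⧸ Y.nicholsIdeal))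

/-- The canonical projection `T(W) → B(W)`. -/
noncomputable def nicholsMk : TensorAlgebra k W →ₐ[k] Y.Nichols := Ideal.Quotient.mkₐ k _

theorem nicholsMk_surjective : Function.Surjective Y.nicholsMk := Ideal.Quotient.mk_surjective

theorem nicholsMk_eq_zero {x : TensorAlgebra k W} (hx : x ∈ Y.nicholsIdeal) : Y.nicholsMk x = 0 :=
  Ideal.Quotient.eq_zero_iff_mem.2 hx

/-- The inclusion `W → B(W)`. -/
noncomputable def nicholsι : W →ₗ[k] Y.Nichols := Y.nicholsMk.toLinearMap ∘ₗ TensorAlgebra.ι k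

/-- The linear map on `B(W)` induced by a linear map on `T(W)` vanishing on `J(W)`. -/
noncomputable def nicholsLift {M : Type*} [AddCommGroup M] [Module k M]
    (f : TensorAlgebra k W →ₗ[k] M) (h : ∀ x ∈ Y.nicholsIdeal, f x = 0) : Y.Nichols →ₗ[k] M :=
  idealQuotientLift _ f h

@[simp] theorem nicholsLift_mk {M : Type*} [AddCommGroup M] [Module k M]
    (f : TensorAlgebra k W →ₗ[k] M) (h : ∀ x ∈ Y.nicholsIdeal, f x = 0) (x : TensorAlgebra k W) :
    Y.nicholsLift f h (Y.nicholsMk x) = f x := rfl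

/-- The counit of `B(W)`. -/
noncomputable def nicholsCounit : Y.Nichols →ₐ[k] k :=
  Ideal.Quotient.liftₐ _ TensorAlgebra.algebraMapInv Y.nicholsIdeal_isNicholsAdmissible.degree_zero

@[simp] theorem nicholsCounit_mk (x : TensorAlgebra k W) :
    Y.nicholsCounit (Y.nicholsMk x) = TensorAlgebra.algebraMapInv x := rfl

/-- The projection `pr₁ : B(W) → W` to degree one. -/
noncomputable def nicholsProjOne : Y.Nichols →ₗ[k] W :=
  Y.nicholsLift TensorAlgebra.ιInv Y.nicholsIdeal_isNicholsAdmissible.degree_one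

@[simp] theorem nicholsProjOne_mk (x : TensorAlgebra k W) :
    Y.nicholsProjOne (Y.nicholsMk x) = TensorAlgebra.ιInv x := rfl

/-- The action of `H` on `B(W)`. -/
noncomputable def nicholsAct : H →ₐ[k] Module.End k Y.Nichols :=
  AlgHom.ofLinearMap
    { toFun := fun h => Y.nicholsLift (Y.nicholsMk.toLinearMap ∘ₗ Y.tensorAct h)
        (fun x hx => Y.nicholsMk_eq_zero (Y.nicholsIdeal_isNicholsAdmissible.act_mem h x hx))
      map_add' := fun a b => by
        ext x; obtain ⟨x, rfl⟩ := Y.nicholsMk_surjective x; simp; rfl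
      map_smul' := fun a b => by
        ext x; obtain ⟨x, rfl⟩ := Y.nicholsMk_surjective x; simp; rfl }
    (by ext x; obtain ⟨x, rfl⟩ := Y.nicholsMk_surjective x; simp)
    (by intro a b; ext x; obtain ⟨x, rfl⟩ := Y.nicholsMk_surjective x; simp; rfl)

@[simp] theorem nicholsAct_mk (h : H) (x : TensorAlgebra k W) :
    Y.nicholsAct h (Y.nicholsMk x) = Y.nicholsMk (Y.tensorAct h x) := rfl

theorem nichols_lTensor_eq_zero {X : Type*} [AddCommGroup X] [Module k X]
    {u : X ⊗[k] TensorAlgebra k W}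
    (hu : u ∈ ((Y.nicholsIdeal.restrictScalars k).subtype.lTensor X).range) :
    Y.nicholsMk.toLinearMap.lTensor X u = 0 := by
  obtain ⟨v, rfl⟩ := hu
  rw [← LinearMap.comp_apply, ← LinearMap.lTensor_comp]
  have : Y.nicholsMk.toLinearMap ∘ₗ (Y.nicholsIdeal.restrictScalars k).subtype = 0 := by
    ext x; exact Y.nicholsMk_eq_zero x.2
  rw [this, LinearMap.lTensor_zero, LinearMap.zero_apply]

theorem nichols_rTensor_eq_zero {X : Type*} [AddCommGroup X] [Module k X]
    {u : TensorAlgebra k W ⊗[k] X}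
    (hu : u ∈ ((Y.nicholsIdeal.restrictScalars k).subtype.rTensor X).range) :
    Y.nicholsMk.toLinearMap.rTensor X u = 0 := by
  obtain ⟨v, rfl⟩ := hu
  rw [← LinearMap.comp_apply, ← LinearMap.rTensor_comp]
  have : Y.nicholsMk.toLinearMap ∘ₗ (Y.nicholsIdeal.restrictScalars k).subtype = 0 := by
    ext x; exact Y.nicholsMk_eq_zero x.2
  rw [this, LinearMap.rTensor_zero, LinearMap.zero_apply]

/-- The coaction of `H` on `B(W)`. -/
noncomputable def nicholsCoact : Y.Nichols →ₐ[k] H ⊗[k] Y.Nichols :=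
  Ideal.Quotient.liftₐ _
    ((Algebra.TensorProduct.map (AlgHom.id k H) Y.nicholsMk).comp Y.tensorCoact)
    (fun x hx => Y.nichols_lTensor_eq_zero (Y.nicholsIdeal_isNicholsAdmissible.coact_mem x hx))

theorem nicholsCoact_mk (x : TensorAlgebra k W) :
    Y.nicholsCoact (Y.nicholsMk x) = Y.nicholsMk.toLinearMap.lTensor H (Y.tensorCoact x) := rfl

/-- The comultiplication of `B(W)`. -/
noncomputable def nicholsComul : Y.Nichols →ₗ[k] Y.Nichols ⊗[k] Y.Nichols :=
  Y.nicholsLift (TensorProduct.map Y.nicholsMk.toLinearMap Y.nicholsMk.toLinearMap ∘ₗ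
    Y.tensorComul) (by
      intro x hx
      obtain ⟨a, ha, b, hb, hab⟩ :=
        Submodule.mem_sup.1 (Y.nicholsIdeal_isNicholsAdmissible.comul_mem x hx)
      rw [LinearMap.comp_apply, ← hab, map_add, ← LinearMap.lTensor_comp_rTensor,
        LinearMap.comp_apply, Y.nichols_rTensor_eq_zero ha, LinearMap.lTensor_comp_rTensor,
        ← LinearMap.rTensor_comp_lTensor, LinearMap.comp_apply, Y.nichols_lTensor_eq_zero hb]
      simp)

theorem nicholsComul_mk (x : TensorAlgebra k W) : Y.nicholsComul (Y.nicholsMk x) =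
    TensorProduct.map Y.nicholsMk.toLinearMap Y.nicholsMk.toLinearMap (Y.tensorComul x) := rfl

theorem nichols_isBraidedAlgebra : IsBraidedAlgebra Y.nicholsAct Y.nicholsCoact where
  act_one h := by
    rw [← map_one Y.nicholsMk, nicholsAct_mk, Y.tensor_isBraidedAlgebra.act_one, map_smul]
  act_mul h x y := by
    obtain ⟨x, rfl⟩ := Y.nicholsMk_surjective x
    obtain ⟨y, rfl⟩ := Y.nicholsMk_surjective y
    obtain ⟨s, hs⟩ := TensorProduct.exists_finset (comul (R := k) h)
    rw [← map_mul, nicholsAct_mk, Y.tensor_isBraidedAlgebra.act_mul, hs]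
    simp
  counit_coact x := by
    obtain ⟨x, rfl⟩ := Y.nicholsMk_surjective x
    obtain ⟨s, hs⟩ := TensorProduct.exists_finset (Y.tensorCoact x)
    have h := congrArg Y.nicholsMk (Y.tensor_isBraidedAlgebra.counit_coact x)
    rw [nicholsCoact_mk]
    rw [hs] at h ⊢
    simpa using h
  coassoc x := by
    obtain ⟨x, rfl⟩ := Y.nicholsMk_surjective x
    obtain ⟨s, hs⟩ := TensorProduct.exists_finset (Y.tensorCoact x)
    have h := congrArg ((Y.nicholsMk.toLinearMap.lTensor H).lTensor H)
      (Y.tensor_isBraidedAlgebra.coassoc x)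
    have h3 : ∀ (d : H ⊗[k] H) (w : TensorAlgebra k W),
        (Y.nicholsMk.toLinearMap.lTensor H).lTensor H (TensorProduct.assoc k H H _ (d ⊗ₜ w)) =
          TensorProduct.assoc k H H _ (d ⊗ₜ Y.nicholsMk w) := by
      intro d w
      induction d with
      | zero => simp
      | add a b ha hb => simp only [TensorProduct.add_tmul, map_add, ha, hb]
      | tmul a b => simp
    rw [nicholsCoact_mk]
    rw [hs] at h ⊢
    simp only [map_sum, LinearMap.rTensor_tmul, LinearMap.lTensor_tmul, h3] at h
    simpa [nicholsCoact_mk] using h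

theorem nicholsComul_mul (x y : Y.Nichols) : Y.nicholsComul (x * y) =
    braidedMul Y.nicholsAct Y.nicholsCoact (Y.nicholsComul x) (Y.nicholsComul y) := by
  obtain ⟨x, rfl⟩ := Y.nicholsMk_surjective x
  obtain ⟨y, rfl⟩ := Y.nicholsMk_surjective y
  rw [← map_mul, nicholsComul_mk, nicholsComul_mk, nicholsComul_mk, tensorComul_mul]
  generalize Y.tensorComul x = u
  generalize Y.tensorComul y = v
  induction u with
  | zero => simp
  | add a b ha hb => simp only [map_add, LinearMap.add_apply, ha, hb]
  | tmul p q =>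
    induction v with
    | zero => simp
    | add a b ha hb => simp only [map_add, ha, hb]
    | tmul r s =>
      classical
      obtain ⟨t, ht⟩ := TensorProduct.exists_finset (Y.tensorCoact q)
      rw [braidedMul_tmul p q r s t ht]
      simp only [TensorProduct.map_tmul, AlgHom.toLinearMap_apply, map_sum, map_mul]
      simp [braidedMul, nicholsCoact_mk, ht]

theorem nicholsComul_one : Y.nicholsComul 1 = 1 ⊗ₜ 1 := by
  rw [← map_one Y.nicholsMk, nicholsComul_mk, tensorComul_one]; simp

theorem nicholsComul_ι (w : W) : Y.nicholsComul (Y.nicholsι w) =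
    Y.nicholsι w ⊗ₜ 1 + 1 ⊗ₜ Y.nicholsι w := by
  simp [nicholsι, nicholsComul_mk, tensorComul_ι]

end Nichols
end YetterDrinfeld
section TensorAlgebraDegree
variable {k W : Type*} [Field k] [AddCommGroup W] [Module k W]

theorem tensorAlgebra_algebraMapInv_ι (w : W) :
    TensorAlgebra.algebraMapInv (R := k) (TensorAlgebra.ι k w) = 0 := by
  simp [TensorAlgebra.algebraMapInv]

theorem tensorAlgebra_ιInv_ι (w : W) :
    TensorAlgebra.ιInv (R := k) (TensorAlgebra.ι k w) = w := TensorAlgebra.ι_leftInverse w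

theorem tensorAlgebra_ιInv_mul (x y : TensorAlgebra k W) :
    TensorAlgebra.ιInv (R := k) (x * y) = TensorAlgebra.algebraMapInv (R := k) x •
      TensorAlgebra.ιInv (R := k) y +
        TensorAlgebra.algebraMapInv (R := k) y • TensorAlgebra.ιInv (R := k) x := by
  let _ : Module kᵐᵒᵖ W := Module.compHom _ ((RingHom.id k).fromOpposite mul_comm)
  have _ : IsCentralScalar k W := ⟨fun r m => rfl⟩
  have h : (TrivSqZeroExt.fstHom k k W).comp TensorAlgebra.toTrivSqZeroExt =
      TensorAlgebra.algebraMapInv (R := k) (M := W) := by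
    ext w; simp [TensorAlgebra.algebraMapInv]
  have h' : ∀ z : TensorAlgebra k W, (TensorAlgebra.toTrivSqZeroExt z).fst =
      TensorAlgebra.algebraMapInv (R := k) z := fun z => congrArg (fun f => f z) h
  have h2 := TrivSqZeroExt.snd_mul (TensorAlgebra.toTrivSqZeroExt (R := k) x)
    (TensorAlgebra.toTrivSqZeroExt y)
  rw [h', h', ← map_mul] at h2
  exact h2

theorem tensorAlgebra_ιInv_algebraMap (c : k) :
    TensorAlgebra.ιInv (R := k) (algebraMap k (TensorAlgebra k W) c) = 0 := by
  have h := tensorAlgebra_ιInv_mul (k := k) (1 : TensorAlgebra k W) 1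
  rw [mul_one, map_one TensorAlgebra.algebraMapInv, one_smul] at h
  rw [Algebra.algebraMap_eq_smul_one, map_smul, left_eq_add.1 h, smul_zero]

/-- Induction on the tensor algebra by left multiplication with generators. -/
theorem tensorAlgebra_left_induction {p : TensorAlgebra k W → Prop} (one : p 1)
    (ι_mul : ∀ w x, p x → p (TensorAlgebra.ι k w * x)) (smul : ∀ (c : k) x, p x → p (c • x))
    (add : ∀ x y, p x → p y → p (x + y)) (x : TensorAlgebra k W) : p x := by
  suffices h : ∀ y, p y → p (x * y) by simpa using h 1 one
  induction x using TensorAlgebra.induction with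
  | algebraMap c => intro y hy; rw [← Algebra.smul_def]; exact smul c y hy
  | ι w => exact ι_mul w
  | mul a b ha hb => intro y hy; rw [mul_assoc]; exact ha _ (hb _ hy)
  | add a b ha hb => intro y hy; rw [add_mul]; exact add _ _ (ha _ hy) (hb _ hy)

theorem tensorAlgebra_right_induction {p : TensorAlgebra k W → Prop} (one : p 1)
    (mul_ι : ∀ w x, p x → p (x * TensorAlgebra.ι k w)) (smul : ∀ (c : k) x, p x → p (c • x))
    (add : ∀ x y, p x → p y → p (x + y)) (x : TensorAlgebra k W) : p x := by
  suffices h : ∀ y, p y → p (y * x) by simpa using h 1 one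
  induction x using TensorAlgebra.induction with
  | algebraMap c =>
    intro y hy; rw [← Algebra.commutes, ← Algebra.smul_def]; exact smul c y hy
  | ι w => exact mul_ι w
  | mul a b ha hb => intro y hy; rw [← mul_assoc]; exact hb _ (ha _ hy)
  | add a b ha hb => intro y hy; rw [mul_add]; exact add _ _ (ha _ hy) (hb _ hy)

end TensorAlgebraDegree

namespace YetterDrinfeld
section Degree
variable {k H W : Type*} [Field k] [Ring H] [HopfAlgebra k H] [AddCommGroup W] [Module k W]
  (Y : YetterDrinfeld k H W)

theorem algebraMapInv_tensorAct (h : H) (x : TensorAlgebra k W) :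
    TensorAlgebra.algebraMapInv (R := k) (Y.tensorAct h x) =
      counit (R := k) h * TensorAlgebra.algebraMapInv (R := k) x := by
  induction x using tensorAlgebra_left_induction (k := k) generalizing h with
  | one => simp [Y.tensor_isBraidedAlgebra.act_one]
  | ι_mul w x hx =>
    obtain ⟨s, hs⟩ := TensorProduct.exists_finset (comul (R := k) h)
    simp [Y.tensor_isBraidedAlgebra.act_mul, hs, tensorAlgebra_algebraMapInv_ι]
  | smul c x hx => rw [map_smul, map_smul, map_smul, hx, smul_eq_mul, smul_eq_mul]; ring
  | add x y hx hy => rw [map_add, map_add, map_add, hx, hy]; ring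

theorem ιInv_tensorAct (h : H) (x : TensorAlgebra k W) :
    TensorAlgebra.ιInv (R := k) (Y.tensorAct h x) = Y.act h (TensorAlgebra.ιInv (R := k) x) := by
  induction x using tensorAlgebra_left_induction (k := k) generalizing h with
  | one =>
    have := tensorAlgebra_ιInv_algebraMap (k := k) (W := W) 1
    rw [map_one] at this
    simp [Y.tensor_isBraidedAlgebra.act_one, this]
  | ι_mul w x hx =>
    obtain ⟨s, hs⟩ := TensorProduct.exists_finset (comul (R := k) h)
    have h2 := congrArg (TensorProduct.rid k H) (Coalgebra.lTensor_counit_comul (R := k) h)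
    rw [hs] at h2
    simp only [map_sum, LinearMap.lTensor_tmul, TensorProduct.rid_tmul, one_smul] at h2
    rw [Y.tensor_isBraidedAlgebra.act_mul, hs]
    simp only [map_sum, TensorProduct.map_tmul, LinearMap.mul'_apply, LinearMap.flip_apply,
      tensorAlgebra_ιInv_mul, AlgHom.toLinearMap_apply, tensorAct_ι, tensorAlgebra_ιInv_ι,
      tensorAlgebra_algebraMapInv_ι, zero_smul, zero_add, algebraMapInv_tensorAct]
    conv_rhs => rw [← h2]
    simp only [map_sum, LinearMap.sum_apply, map_smul, LinearMap.smul_apply, Finset.smul_sum,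
      smul_smul, mul_comm]
  | smul c x hx => rw [map_smul, map_smul, map_smul, hx, map_smul]
  | add x y hx hy => rw [map_add, map_add, map_add, hx, hy, map_add]

theorem algebraMapInv_tensorCoact (x : TensorAlgebra k W) :
    contract H (TensorAlgebra.algebraMapInv (R := k) (M := W)).toLinearMap (Y.tensorCoact x) =
      TensorAlgebra.algebraMapInv (R := k) x • (1 : H) := by
  have : ((Algebra.TensorProduct.rid k k H).toAlgHom.comp
      (Algebra.TensorProduct.map (AlgHom.id k H) TensorAlgebra.algebraMapInv)).comp Y.tensorCoact =
      (Algebra.ofId k H).comp TensorAlgebra.algebraMapInv := by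
    ext w
    obtain ⟨s, hs⟩ := TensorProduct.exists_finset (Y.coact w)
    simp [hs, tensorAlgebra_algebraMapInv_ι]
  have h := congrArg (fun f => f x) this
  simp only [AlgHom.comp_apply, Algebra.ofId_apply, Algebra.algebraMap_eq_smul_one] at h
  exact h

theorem ιInv_tensorCoact (x : TensorAlgebra k W) :
    (TensorAlgebra.ιInv (R := k) (M := W)).lTensor H (Y.tensorCoact x) =
      Y.coact (TensorAlgebra.ιInv (R := k) x) := by
  induction x using tensorAlgebra_left_induction (k := k) with
  | one =>
    have := tensorAlgebra_ιInv_algebraMap (k := k) (W := W) 1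
    rw [map_one] at this
    simp [Algebra.TensorProduct.one_def, this]
  | ι_mul w x hx =>
    have h2 := Y.algebraMapInv_tensorCoact x
    obtain ⟨t, ht⟩ := TensorProduct.exists_finset (Y.tensorCoact x)
    obtain ⟨s, hs⟩ := TensorProduct.exists_finset (Y.coact w)
    rw [map_mul, tensorCoact_ι, tensorAlgebra_ιInv_mul, tensorAlgebra_ιInv_ι,
      tensorAlgebra_algebraMapInv_ι, zero_smul, zero_add, map_smul]
    rw [ht] at h2 ⊢
    simp only [map_sum, contract_tmul, AlgHom.toLinearMap_apply] at h2
    rw [hs]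
    simp only [map_sum, LinearMap.lTensor_tmul, Finset.sum_mul_sum,
      Algebra.TensorProduct.tmul_mul_tmul, tensorAlgebra_ιInv_mul, tensorAlgebra_ιInv_ι,
      tensorAlgebra_algebraMapInv_ι, zero_smul, zero_add, Finset.smul_sum]
    refine Finset.sum_congr rfl fun i _ => ?_
    have h3 := congrArg (fun z => (i.1 * z) ⊗ₜ[k] i.2) h2
    simp only [Finset.mul_sum, TensorProduct.sum_tmul, mul_smul_comm, mul_one] at h3
    rw [TensorProduct.smul_tmul', ← h3]
    simp [TensorProduct.smul_tmul']
  | smul c x hx => rw [map_smul, map_smul, map_smul, hx, map_smul]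
  | add x y hx hy => rw [map_add, map_add, map_add, hx, hy, map_add]

theorem tensorComul_ι_mul (w : W) (x : TensorAlgebra k W) :
    Y.tensorComul (TensorAlgebra.ι k w * x) = braidedMul Y.tensorAct Y.tensorCoact
      (TensorAlgebra.ι k w ⊗ₜ 1 + 1 ⊗ₜ TensorAlgebra.ι k w) (Y.tensorComul x) := by
  rw [tensorComul_mul, tensorComul_ι]

theorem braidedMul_ι_left {k H A : Type*} [Field k] [Ring H] [HopfAlgebra k H] [Ring A]
    [Algebra k A] (ρ : H →ₐ[k] Module.End k A) (δ : A →ₐ[k] H ⊗[k] A) (p r s : A) :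
    braidedMul ρ δ (p ⊗ₜ 1) (r ⊗ₜ s) = (p * r) ⊗ₜ s := by
  rw [braidedMul_tmul', map_one]; simp

theorem tensorComul_counit_left (x : TensorAlgebra k W) :
    TensorProduct.lid k _ ((TensorAlgebra.algebraMapInv (R := k) (M := W)).toLinearMap.rTensor _
      (Y.tensorComul x)) = x := by
  induction x using tensorAlgebra_left_induction (k := k) with
  | one => simp [tensorComul_one]
  | ι_mul w x hx =>
    rw [tensorComul_ι_mul]
    conv_rhs => rw [← hx]
    generalize Y.tensorComul x = u
    obtain ⟨op, hop⟩ : ∃ op, op = braidedMul Y.tensorAct Y.tensorCoact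
      (TensorAlgebra.ι k w ⊗ₜ 1 + 1 ⊗ₜ TensorAlgebra.ι k w) := ⟨_, rfl⟩
    rw [← hop]
    induction u with
    | zero => simp
    | add a b ha hb => simp only [map_add, ha, hb, mul_add]
    | tmul r s =>
      obtain ⟨t, ht⟩ := TensorProduct.exists_finset (Y.coact w)
      have h1 := congrArg (TensorAlgebra.ι k) (Y.counit_coact w)
      have h2 : Y.tensorCoact (TensorAlgebra.ι k w) =
          ∑ i ∈ t, i.1 ⊗ₜ[k] TensorAlgebra.ι k i.2 := by
        simp [ht]
      rw [ht] at h1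
      simp only [map_sum, LinearMap.rTensor_tmul, TensorProduct.lid_tmul, map_smul] at h1
      rw [hop, map_add, LinearMap.add_apply, braidedMul_ι_left, braidedMul_tmul_sum _ _ _ _ t _ _ h2]
      simp only [map_add, map_sum, LinearMap.rTensor_tmul, TensorProduct.lid_tmul, one_mul,
        AlgHom.toLinearMap_apply, map_mul, tensorAlgebra_algebraMapInv_ι, zero_mul, zero_smul,
        zero_add, algebraMapInv_tensorAct]
      conv_rhs => rw [← h1]
      simp only [Finset.sum_mul, smul_mul_assoc, mul_smul_comm, Finset.smul_sum, smul_smul,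
        mul_comm (counit (R := k) _)]
  | smul c x hx => rw [map_smul, map_smul, map_smul, hx]
  | add x y hx hy => rw [map_add, map_add, map_add, hx, hy]

theorem tensorComul_counit_right (x : TensorAlgebra k W) :
    contract _ (TensorAlgebra.algebraMapInv (R := k) (M := W)).toLinearMap
      (Y.tensorComul x) = x := by
  induction x using tensorAlgebra_left_induction (k := k) with
  | one => simp [tensorComul_one]
  | ι_mul w x hx =>
    rw [tensorComul_ι_mul]
    conv_rhs => rw [← hx]
    generalize Y.tensorComul x = u
    obtain ⟨op, hop⟩ : ∃ op, op = braidedMul Y.tensorAct Y.tensorCoact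
      (TensorAlgebra.ι k w ⊗ₜ 1 + 1 ⊗ₜ TensorAlgebra.ι k w) := ⟨_, rfl⟩
    rw [← hop]
    induction u with
    | zero => simp
    | add a b ha hb => simp only [map_add, ha, hb, mul_add]
    | tmul r s =>
      obtain ⟨t, ht⟩ := TensorProduct.exists_finset (Y.coact w)
      have h2 : Y.tensorCoact (TensorAlgebra.ι k w) =
          ∑ i ∈ t, i.1 ⊗ₜ[k] TensorAlgebra.ι k i.2 := by
        simp [ht]
      rw [hop, map_add, LinearMap.add_apply, braidedMul_ι_left, braidedMul_tmul_sum _ _ _ _ t _ _ h2]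
      simp [tensorAlgebra_algebraMapInv_ι]
  | smul c x hx => rw [map_smul, map_smul, hx]
  | add x y hx hy => rw [map_add, map_add, hx, hy]

end Degree
end YetterDrinfeld
namespace YetterDrinfeld
section Pairing
variable {k H W : Type*} [Field k] [Ring H] [HopfAlgebra k H] [AddCommGroup W] [Module k W]
  (Y : YetterDrinfeld k H W)

/-- The operators `∂_ξ(b) = ⟨ξ, b⁽¹⁾⟩ b⁽²⁾` on `B(W)`, for linear forms `ξ` on `B(W)`. -/
noncomputable def leftQDO : Module.Dual k Y.Nichols →ₗ[k] Module.End k Y.Nichols :=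
  LinearMap.mk₂ k (fun ξ b => TensorProduct.lid k _ (ξ.rTensor Y.Nichols (Y.nicholsComul b)))
    (by intros; simp [LinearMap.rTensor_add]) (by intros; simp [LinearMap.rTensor_smul])
    (by intros; simp) (by intros; simp)

theorem leftQDO_apply (ξ : Module.Dual k Y.Nichols) (b : Y.Nichols) :
    Y.leftQDO ξ b = TensorProduct.lid k _ (ξ.rTensor Y.Nichols (Y.nicholsComul b)) := rfl

/-- The algebra map `T(W^*) → End(B(W))` sending a linear form `f` to `∂_f`. -/
noncomputable def tensorQDO : TensorAlgebra k (Module.Dual k W) →ₐ[k] Module.End k Y.Nichols :=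
  TensorAlgebra.lift k (Y.leftQDO ∘ₗ Y.nicholsProjOne.dualMap)

/-- The pairing `⟨ξ, b⟩ = ε(∂_ξ(b))` of `T(W^*)` and `B(W)`. -/
noncomputable def tensorPairing :
    TensorAlgebra k (Module.Dual k W) →ₗ[k] Module.Dual k Y.Nichols :=
  LinearMap.mk₂ k (fun ξ b => Y.nicholsCounit (Y.tensorQDO ξ b))
    (by intros; simp) (by intros; simp) (by intros; simp) (by intros; simp)

theorem tensorPairing_apply (ξ : TensorAlgebra k (Module.Dual k W)) (b : Y.Nichols) :
    Y.tensorPairing ξ b = Y.nicholsCounit (Y.tensorQDO ξ b) := rfl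

theorem nicholsCounit_comul_left (b : Y.Nichols) :
    Y.leftQDO Y.nicholsCounit.toLinearMap b = b := by
  obtain ⟨x, rfl⟩ := Y.nicholsMk_surjective b
  have h := congrArg Y.nicholsMk (Y.tensorComul_counit_left x)
  rw [leftQDO_apply, nicholsComul_mk]
  refine Eq.trans ?_ h
  generalize Y.tensorComul x = u
  induction u with
  | zero => simp
  | add a b ha hb => simp only [map_add, ha, hb]
  | tmul a b => simp

theorem nicholsProjOne_mul (x y : Y.Nichols) : Y.nicholsProjOne (x * y) =
    Y.nicholsCounit x • Y.nicholsProjOne y + Y.nicholsCounit y • Y.nicholsProjOne x := by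
  obtain ⟨x, rfl⟩ := Y.nicholsMk_surjective x
  obtain ⟨y, rfl⟩ := Y.nicholsMk_surjective y
  rw [← map_mul]
  exact tensorAlgebra_ιInv_mul x y

theorem nicholsProjOne_act (h : H) (x : Y.Nichols) :
    Y.nicholsProjOne (Y.nicholsAct h x) = Y.act h (Y.nicholsProjOne x) := by
  obtain ⟨x, rfl⟩ := Y.nicholsMk_surjective x
  exact Y.ιInv_tensorAct h x

@[simp] theorem nicholsProjOne_ι (w : W) : Y.nicholsProjOne (Y.nicholsι w) = w :=
  tensorAlgebra_ιInv_ι w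

@[simp] theorem nicholsCounit_ι (w : W) : Y.nicholsCounit (Y.nicholsι w) = 0 :=
  tensorAlgebra_algebraMapInv_ι w

theorem nicholsProjOne_one : Y.nicholsProjOne 1 = 0 := by
  have := tensorAlgebra_ιInv_algebraMap (k := k) (W := W) 1
  rw [map_one (algebraMap _ _)] at this
  exact this

theorem nicholsCoact_ι (w : W) :
    Y.nicholsCoact (Y.nicholsι w) = Y.nicholsι.lTensor H (Y.coact w) := by
  simp only [nicholsι, LinearMap.comp_apply, AlgHom.toLinearMap_apply, nicholsCoact_mk,
    tensorCoact_ι, LinearMap.lTensor_comp]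

theorem leftQDO_projOne_one (f : Module.Dual k W) :
    Y.leftQDO (f ∘ₗ Y.nicholsProjOne) 1 = 0 := by
  rw [leftQDO_apply, nicholsComul_one]
  simp [nicholsProjOne_one]

theorem leftQDO_projOne_ι (f : Module.Dual k W) (w : W) :
    Y.leftQDO (f ∘ₗ Y.nicholsProjOne) (Y.nicholsι w) = f w • 1 := by
  rw [leftQDO_apply, nicholsComul_ι]
  simp [nicholsProjOne_one]

theorem tensorQDO_ι (f : Module.Dual k W) :
    Y.tensorQDO (TensorAlgebra.ι k f) = Y.leftQDO (f ∘ₗ Y.nicholsProjOne) := by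
  simp only [tensorQDO, TensorAlgebra.lift_ι_apply]
  rfl

theorem tensorQDO_one_right (ξ : TensorAlgebra k (Module.Dual k W)) :
    Y.tensorQDO ξ 1 = TensorAlgebra.algebraMapInv (R := k) ξ • 1 := by
  induction ξ using tensorAlgebra_left_induction (k := k) (W := Module.Dual k W) with
  | one => simp
  | ι_mul f x hx =>
    simp [hx, tensorQDO_ι, leftQDO_projOne_one, tensorAlgebra_algebraMapInv_ι]
  | smul c x hx => simp [hx, mul_smul]
  | add x y hx hy => simp [hx, hy, add_smul]

theorem tensorQDO_ι_right (ξ : TensorAlgebra k (Module.Dual k W)) (w : W) :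
    Y.tensorQDO ξ (Y.nicholsι w) = TensorAlgebra.algebraMapInv (R := k) ξ • Y.nicholsι w +
      (TensorAlgebra.ιInv (R := k) ξ) w • (1 : Y.Nichols) := by
  induction ξ using tensorAlgebra_left_induction (k := k) (W := Module.Dual k W) with
  | one =>
    have := tensorAlgebra_ιInv_algebraMap (k := k) (W := Module.Dual k W) 1
    rw [map_one (algebraMap _ _)] at this
    simp [this]
  | ι_mul f x hx =>
    simp [hx, tensorQDO_ι, leftQDO_projOne_one, leftQDO_projOne_ι,
      tensorAlgebra_algebraMapInv_ι, tensorAlgebra_ιInv_mul, tensorAlgebra_ιInv_ι, smul_smul]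
  | smul c x hx => simp [hx, mul_smul]
  | add x y hx hy => simp only [map_add, LinearMap.add_apply, hx, hy, add_smul]; abel

theorem tensorPairing_one (ξ : TensorAlgebra k (Module.Dual k W)) :
    Y.tensorPairing ξ 1 = TensorAlgebra.algebraMapInv (R := k) ξ := by
  rw [tensorPairing_apply, tensorQDO_one_right]; simp

theorem tensorPairing_ι (ξ : TensorAlgebra k (Module.Dual k W)) (w : W) :
    Y.tensorPairing ξ (Y.nicholsι w) = TensorAlgebra.ιInv (R := k) ξ w := by
  rw [tensorPairing_apply, tensorQDO_ι_right]; simp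

theorem tensorPairing_mul_ι (ξ : TensorAlgebra k (Module.Dual k W)) (f : Module.Dual k W)
    (b : Y.Nichols) : Y.tensorPairing (ξ * TensorAlgebra.ι k f) b =
      Y.tensorPairing ξ (Y.leftQDO (f ∘ₗ Y.nicholsProjOne) b) := by
  rw [tensorPairing_apply, tensorPairing_apply, map_mul, tensorQDO_ι]; rfl

variable (hS : Function.Bijective (antipode k : H →ₗ[k] H))

/-- The Leibniz rule `∂_f(w b) = ⟨f, w⟩ b + w₀ ∂_{S⁻¹(w₋₁) · f}(b)`. -/
theorem leftQDO_ι_mul (f : Module.Dual k W) (w : W) (b : Y.Nichols)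
    (t : Finset (H × W)) (ht : Y.coact w = ∑ i ∈ t, i.1 ⊗ₜ[k] i.2) :
    Y.leftQDO (f ∘ₗ Y.nicholsProjOne) (Y.nicholsι w * b) = f w • b +
      ∑ i ∈ t, Y.nicholsι i.2 *
        Y.leftQDO (Y.dualAct (antipodeInv hS i.1) f ∘ₗ Y.nicholsProjOne) b := by
  have h0 := Y.nicholsCounit_comul_left b
  have h2 : Y.nicholsCoact (Y.nicholsι w) = ∑ i ∈ t, i.1 ⊗ₜ[k] Y.nicholsι i.2 := by
    rw [nicholsCoact_ι, ht]; simp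
  have h1 : f w • b = f w • Y.leftQDO Y.nicholsCounit.toLinearMap b := by rw [h0]
  rw [h1]
  simp only [leftQDO_apply]
  rw [nicholsComul_mul, nicholsComul_ι]
  have key : ∀ u : Y.Nichols ⊗[k] Y.Nichols,
      TensorProduct.lid k _ ((f ∘ₗ Y.nicholsProjOne).rTensor _
        (braidedMul Y.nicholsAct Y.nicholsCoact
          (Y.nicholsι w ⊗ₜ[k] 1 + 1 ⊗ₜ[k] Y.nicholsι w) u)) =
      f w • TensorProduct.lid k _ (Y.nicholsCounit.toLinearMap.rTensor _ u) +
      ∑ i ∈ t, Y.nicholsι i.2 * TensorProduct.lid k _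
        ((Y.dualAct (antipodeInv hS i.1) f ∘ₗ Y.nicholsProjOne).rTensor _ u) := by
    obtain ⟨op, hop⟩ : ∃ op, op = braidedMul Y.nicholsAct Y.nicholsCoact
      (Y.nicholsι w ⊗ₜ[k] 1 + 1 ⊗ₜ[k] Y.nicholsι w) := ⟨_, rfl⟩
    rw [← hop]
    intro u
    induction u with
    | zero => simp
    | add a b ha hb =>
      simp only [map_add, ha, hb, mul_add, Finset.sum_add_distrib, smul_add]; abel
    | tmul r s =>
      rw [hop, map_add, LinearMap.add_apply, braidedMul_ι_left,
        braidedMul_tmul_sum _ _ _ _ t _ _ h2]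
      simp only [map_add, map_sum, LinearMap.rTensor_tmul, TensorProduct.lid_tmul, one_mul,
        LinearMap.comp_apply, nicholsProjOne_mul, nicholsCounit_ι, nicholsProjOne_ι, zero_smul,
        zero_add, nicholsProjOne_act, dualAct_apply, antipode_antipodeInv, mul_smul_comm,
        AlgHom.toLinearMap_apply, map_smul, smul_eq_mul, smul_smul]
      congr 2
      exact mul_comm _ _
  rw [key]

variable [FiniteDimensional k W]

/-- `⟨ξ, w b⟩ = ⟨ξ⁽²⁾, w⟩ ⟨ξ⁽¹⁾, b⟩`. -/
theorem tensorPairing_ι_mul (ξ : TensorAlgebra k (Module.Dual k W)) (w : W) (b : Y.Nichols) :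
    Y.tensorPairing ξ (Y.nicholsι w * b) = TensorProduct.lid k k
      (TensorProduct.map (Y.tensorPairing.flip b) (Y.tensorPairing.flip (Y.nicholsι w))
        ((Y.dual hS).tensorComul ξ)) := by
  induction ξ using tensorAlgebra_right_induction (k := k) (W := Module.Dual k W)
    generalizing w b with
  | one => simp [tensorComul_one, tensorPairing_apply]
  | mul_ι f ξ hξ =>
    obtain ⟨t, ht⟩ := TensorProduct.exists_finset (Y.coact w)
    rw [tensorPairing_mul_ι, Y.leftQDO_ι_mul hS f w b t ht, map_add, map_smul, map_sum]
    simp only [hξ]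
    rw [tensorComul_mul, tensorComul_ι]
    have h0 : f w • Y.tensorPairing ξ b = f w • Y.tensorPairing (contract _
        (TensorAlgebra.algebraMapInv (R := k)).toLinearMap ((Y.dual hS).tensorComul ξ)) b := by
      rw [tensorComul_counit_right]
    rw [h0]
    generalize (Y.dual hS).tensorComul ξ = u
    induction u with
    | zero => simp
    | add x y hx hy =>
      rw [map_add (braidedMul _ _), LinearMap.add_apply, map_add (TensorProduct.map _ _),
        map_add (TensorProduct.lid k k), ← hx, ← hy]
      simp only [map_add, LinearMap.add_apply, smul_add, Finset.sum_add_distrib]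
      abel
    | tmul p q =>
      obtain ⟨s, hs⟩ := TensorProduct.exists_finset ((Y.dual hS).tensorCoact q)
      have h1 : ∑ i ∈ s, (TensorAlgebra.ιInv (R := k) i.2) w • i.1 =
          ∑ i ∈ t, (TensorAlgebra.ιInv (R := k) q) i.2 • antipodeInv hS i.1 := by
        have h2 := congrArg (contract H (Module.Dual.eval k W w)) ((Y.dual hS).ιInv_tensorCoact q)
        have h3 := Y.dualCoact_eval hS (TensorAlgebra.ιInv (R := k) q) w
        rw [ht] at h3
        rw [hs] at h2
        have h4 := h2.trans h3
        simpa using h4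
      obtain ⟨Φ, hΦ⟩ : ∃ Φ : H →ₗ[k] k, ∀ h : H, Y.tensorPairing p
          (Y.leftQDO (Y.dualAct h f ∘ₗ Y.nicholsProjOne) b) = Φ h :=
        ⟨Y.tensorPairing p ∘ₗ Y.leftQDO.flip b ∘ₗ
            Y.nicholsProjOne.dualMap ∘ₗ Y.dualAct.toLinearMap.flip f, fun h => rfl⟩
      have h5 := congrArg Φ h1
      simp only [map_sum, map_smul] at h5
      have hq : (Y.dual hS).act = Y.dualAct := rfl
      rw [map_add (braidedMul _ _ _), map_add (TensorProduct.map _ _),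
        map_add (TensorProduct.lid k k),
        braidedMul_tmul _ _ _ _ s hs, braidedMul_tmul _ _ _ _ s hs]
      simp only [map_sum, TensorProduct.map_tmul, TensorProduct.lid_tmul, LinearMap.flip_apply,
        tensorPairing_ι, hΦ, contract_tmul, map_smul, LinearMap.smul_apply, tensorAct_ι,
        tensorPairing_mul_ι, hq, tensorAlgebra_ιInv_mul, tensorAlgebra_ιInv_ι,
        tensorAlgebra_algebraMapInv_ι, zero_smul, add_zero, mul_one, AlgHom.toLinearMap_apply, smul_eq_mul] at h5 ⊢
      have h7 := congrArg (TensorAlgebra.algebraMapInv (R := k) (M := Module.Dual k W))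
        ((Y.dual hS).tensor_isBraidedAlgebra.counit_coact q)
      rw [hs] at h7
      simp only [map_sum, LinearMap.rTensor_tmul, TensorProduct.lid_tmul, map_smul,
        smul_eq_mul] at h7
      simp only [(Y.dual hS).tensor_isBraidedAlgebra.act_one, mul_smul_comm, mul_one, map_smul,
        LinearMap.smul_apply, smul_eq_mul]
      rw [← h7, add_comm]
      congr 1
      · simp only [mul_comm (Φ _), h5]
      · simp only [Finset.sum_mul, Finset.mul_sum]
        exact Finset.sum_congr rfl fun i _ => by ring
  | smul c x hx => simp only [map_smul, LinearMap.smul_apply, hx]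
  | add x y hx hy => simp only [map_add, LinearMap.add_apply, hx, hy]

theorem tensorPairing_eq_zero (ξ : TensorAlgebra k (Module.Dual k W))
    (hξ : ξ ∈ (Y.dual hS).nicholsIdeal) : Y.tensorPairing ξ = 0 := by
  have hJ := (Y.dual hS).nicholsIdeal_isNicholsAdmissible
  ext b
  obtain ⟨x, rfl⟩ := Y.nicholsMk_surjective b
  rw [LinearMap.zero_apply]
  induction x using tensorAlgebra_left_induction (k := k) generalizing ξ with
  | one => rw [map_one, tensorPairing_one, hJ.degree_zero ξ hξ]
  | ι_mul w x hx =>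
    have h1 := Y.tensorPairing_ι_mul hS ξ w (Y.nicholsMk x)
    rw [map_mul]
    refine h1.trans ?_
    have h2 := hJ.comul_mem ξ hξ
    obtain ⟨_, ⟨u, rfl⟩, _, ⟨v, rfl⟩, h3⟩ := Submodule.mem_sup.1 h2
    rw [← h3, map_add, map_add]
    clear h3 h1 h2
    have hu : TensorProduct.lid k k (TensorProduct.map (Y.tensorPairing.flip (Y.nicholsMk x))
        (Y.tensorPairing.flip (Y.nicholsι w)) ((((Y.dual hS).nicholsIdeal.restrictScalars
          k).subtype.rTensor (TensorAlgebra k (Module.Dual k W))) u)) = 0 := by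
      induction u with
      | zero => simp
      | add a b ha hb => simp only [map_add, ha, hb, add_zero]
      | tmul a b => simp [hx a.1 a.2]
    have hv : TensorProduct.lid k k (TensorProduct.map (Y.tensorPairing.flip (Y.nicholsMk x))
        (Y.tensorPairing.flip (Y.nicholsι w)) ((((Y.dual hS).nicholsIdeal.restrictScalars
          k).subtype.lTensor (TensorAlgebra k (Module.Dual k W))) v)) = 0 := by
      induction v with
      | zero => simp
      | add a b ha hb => simp only [map_add, ha, hb, add_zero]
      | tmul a b => simp [tensorPairing_ι, hJ.degree_one b.1 b.2]
    rw [hu, hv, add_zero]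
  | smul c x hx => rw [map_smul, map_smul, hx ξ hξ, smul_zero]
  | add x y hx hy => rw [map_add, map_add, hx ξ hξ, hy ξ hξ, add_zero]

/-- The pairing of `B(W^*)` and `B(W)`, induced by the pairing of `T(W^*)` and `B(W)`. It satisfies
`⟨ξ f, b⟩ = ⟨ξ, ∂_f(b)⟩` for `f ∈ W^*`. -/
noncomputable def nicholsPairing : (Y.dual hS).Nichols →ₗ[k] Module.Dual k Y.Nichols :=
  (Y.dual hS).nicholsLift Y.tensorPairing (Y.tensorPairing_eq_zero hS)

end Pairing
end YetterDrinfeld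
section Braiding
variable {k H V W : Type*} [Field k] [Ring H] [HopfAlgebra k H] [AddCommGroup V] [Module k V]
  [AddCommGroup W] [Module k W]

/-- The braiding `c : V ⊗ W → W ⊗ V`, `c(v ⊗ w) = v₋₁ · w ⊗ v₀`, for a coaction `δ` of `H` on `V`
and an action `ρ` of `H` on `W`. -/
noncomputable def braiding (δ : V →ₗ[k] H ⊗[k] V) (ρ : H →ₐ[k] Module.End k W) :
    V ⊗[k] W →ₗ[k] W ⊗[k] V :=
  TensorProduct.lift (LinearMap.mk₂ k
    (fun v w => (ρ.toLinearMap.flip w).rTensor V (δ v))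
    (by intros; simp) (by intros; simp) (by intros; simp [LinearMap.rTensor_add])
    (by intros; simp [LinearMap.rTensor_smul]))

/-- The inverse braiding `c⁻¹ : W ⊗ V → V ⊗ W`, `c⁻¹(w ⊗ v) = v₀ ⊗ S⁻¹(v₋₁) · w`. -/
noncomputable def invBraiding (hS : Function.Bijective (antipode k : H →ₗ[k] H))
    (δ : V →ₗ[k] H ⊗[k] V) (ρ : H →ₐ[k] Module.End k W) : W ⊗[k] V →ₗ[k] V ⊗[k] W :=
  TensorProduct.lift (LinearMap.mk₂ k
    (fun w v => TensorProduct.comm k W V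
      ((ρ.toLinearMap.flip w ∘ₗ antipodeInv hS).rTensor V (δ v)))
    (by intros; simp [LinearMap.add_comp, LinearMap.rTensor_add])
    (by intros; simp [LinearMap.smul_comp, LinearMap.rTensor_smul])
    (by intros; simp) (by intros; simp))

theorem invBraiding_tmul (hS : Function.Bijective (antipode k : H →ₗ[k] H))
    (δ : V →ₗ[k] H ⊗[k] V) (ρ : H →ₐ[k] Module.End k W) (v : V) (w : W)
    (s : Finset (H × V)) (hs : δ v = ∑ i ∈ s, i.1 ⊗ₜ[k] i.2) :
    invBraiding hS δ ρ (w ⊗ₜ v) = ∑ i ∈ s, i.2 ⊗ₜ[k] ρ (antipodeInv hS i.1) w := by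
  simp [invBraiding, hs]

theorem braiding_tmul (δ : V →ₗ[k] H ⊗[k] V) (ρ : H →ₐ[k] Module.End k W) (v : V) (w : W)
    (s : Finset (H × V)) (hs : δ v = ∑ i ∈ s, i.1 ⊗ₜ[k] i.2) :
    braiding δ ρ (v ⊗ₜ w) = ∑ i ∈ s, ρ i.1 w ⊗ₜ[k] i.2 := by
  simp [braiding, hs]

/-- A family of braided derivations `d : M → End T` of an algebra `T` on which `H` acts by `ρ`,
indexed by an `H`-comodule `M` with coaction `δ`; the multiplication of `T` is the bilinear map
`μ`. The condition is `d_f(xy) = (f₋₁ · x) d_{f₀}(y) + d_f(x) y`. -/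
def IsBraidedDerivationFamily {M T : Type*} [AddCommGroup M] [Module k M] [AddCommGroup T]
    [Module k T] (μ : T →ₗ[k] T →ₗ[k] T) (ρ : H →ₐ[k] Module.End k T) (δ : M →ₗ[k] H ⊗[k] M)
    (d : M →ₗ[k] Module.End k T) : Prop :=
  ∀ f x y, d f (μ x y) =
    TensorProduct.lift (μ.compl₁₂ (ρ.toLinearMap.flip x) (d.flip y)) (δ f) + μ (d f x) y

end Braiding

namespace YetterDrinfeld
section Canonical
variable {k H V : Type*} [Field k] [Ring H] [HopfAlgebra k H] [AddCommGroup V] [Module k V]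
  (Y : YetterDrinfeld k H V) (hS : Function.Bijective (antipode k : H →ₗ[k] H))

/-- The canonical family `d : V^* → End(B(V))`, defined by
`d_f(x) = ⟨f, pr₁(x⁽¹⁾)⟩ x⁽²⁾` with `x⁽¹⁾ ⊗ x⁽²⁾ = c⁻¹(Δ(x))` and `pr₁ : B(V) → V` the projection. -/
noncomputable def canonicalFamily : Module.Dual k V →ₗ[k] Module.End k Y.Nichols :=
  LinearMap.mk₂ k (fun f x => TensorProduct.lid k Y.Nichols
      ((f ∘ₗ Y.nicholsProjOne).rTensor Y.Nichols
        (invBraiding hS Y.nicholsCoact.toLinearMap Y.nicholsAct (Y.nicholsComul x))))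
    (by intros; simp [LinearMap.add_comp, LinearMap.rTensor_add])
    (by intros; simp [LinearMap.smul_comp, LinearMap.rTensor_smul])
    (by intros; simp) (by intros; simp)

/-- The braided adjoint action of a primitive `w ∈ V`: `ad_c w (x) = w x - (w₋₁ · x) w₀`. -/
noncomputable def braidedAd : V →ₗ[k] Module.End k Y.Nichols :=
  LinearMap.mk₂ k (fun w x => Y.nicholsι w * x -
      LinearMap.mul' k Y.Nichols (braiding Y.nicholsCoact.toLinearMap Y.nicholsAct
        (Y.nicholsι w ⊗ₜ[k] x)))
    (by intros; simp [add_mul, TensorProduct.add_tmul]; abel)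
    (by intros; simp only [map_smul, smul_mul_assoc, ← TensorProduct.smul_tmul', smul_sub])
    (by intros; simp [mul_add, TensorProduct.tmul_add]; abel)
    (by intros; simp [smul_sub])

end Canonical

section Smash
variable {k H W : Type*} [Field k] [Ring H] [HopfAlgebra k H] [AddCommGroup W] [Module k W]
  [FiniteDimensional k W]
  (Y : YetterDrinfeld k H W) (hS : Function.Bijective (antipode k : H →ₗ[k] H))

/-- The quantum differential operators `∂ : B(W^*) → End(B(W))`, `∂_ξ(b) = ⟨ξ, b⁽¹⁾⟩ b⁽²⁾`. -/
noncomputable def nicholsQDO : (Y.dual hS).Nichols →ₗ[k] Module.End k Y.Nichols :=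
  Y.leftQDO ∘ₗ Y.nicholsPairing hS

/-- The vector space `B(W) ⊗ B(W^*)` underlying `B(W) # B(W^*)`. -/
abbrev Smash : Type _ := Y.Nichols ⊗[k] (Y.dual hS).Nichols

/-- The map `B(W) # B(W^*) → End(B(W))`, `b # ξ ↦ L_b ∘ ∂_ξ`. -/
noncomputable def smashRep : Y.Smash hS →ₗ[k] Module.End k Y.Nichols :=
  TensorProduct.lift ((LinearMap.mul k (Module.End k Y.Nichols)).compl₁₂
    (LinearMap.mul k Y.Nichols) (Y.nicholsQDO hS))

/-- The product `ξ b = ⟨ξ⁽²⁾, b⁽¹⁾⟩ (b⁽²⁾)₀ # S⁻¹((b⁽²⁾)₋₁) · ξ⁽¹⁾` of `ξ ∈ B(W^*)` and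
`b ∈ B(W)` in `B(W) # B(W^*)`, that is, `c⁻¹(ξ⁽¹⁾ ⊗ ∂_{ξ⁽²⁾}(b))`. -/
noncomputable def smashExchange : (Y.dual hS).Nichols ⊗[k] Y.Nichols →ₗ[k] Y.Smash hS :=
  invBraiding hS Y.nicholsCoact.toLinearMap (Y.dual hS).nicholsAct ∘ₗ
    (TensorProduct.lift (Y.nicholsQDO hS)).lTensor (Y.dual hS).Nichols ∘ₗ
    (TensorProduct.assoc k _ _ _).toLinearMap ∘ₗ
    ((Y.dual hS).nicholsComul).rTensor Y.Nichols

/-- The multiplication of `B(W) # B(W^*)`: `(x # ξ)(b # ζ) = x (ξ b) ζ`. -/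
noncomputable def smashMul : Y.Smash hS →ₗ[k] Y.Smash hS →ₗ[k] Y.Smash hS :=
  TensorProduct.curry
    (TensorProduct.map (LinearMap.mul' k Y.Nichols) (LinearMap.mul' k (Y.dual hS).Nichols) ∘ₗ
      (TensorProduct.assoc k _ _ _).symm.toLinearMap ∘ₗ
      ((TensorProduct.assoc k _ _ _).toLinearMap ∘ₗ
        (Y.smashExchange hS).rTensor _ ∘ₗ
        (TensorProduct.assoc k _ _ _).symm.toLinearMap).lTensor _ ∘ₗ
      (TensorProduct.assoc k _ _ _).toLinearMap)

theorem smashMul_tmul (x b : Y.Nichols) (ξ ζ : (Y.dual hS).Nichols) :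
    Y.smashMul hS (x ⊗ₜ ξ) (b ⊗ₜ ζ) =
      TensorProduct.map (LinearMap.mulLeft k x) (LinearMap.mulRight k ζ)
        (Y.smashExchange hS (ξ ⊗ₜ b)) := by
  simp only [smashMul, TensorProduct.curry_apply, LinearMap.comp_apply, LinearEquiv.coe_coe,
    TensorProduct.assoc_tmul, TensorProduct.assoc_symm_tmul, LinearMap.lTensor_tmul,
    LinearMap.rTensor_tmul]
  generalize Y.smashExchange hS (ξ ⊗ₜ b) = u
  induction u using TensorProduct.induction_on with
  | zero => simp
  | add p q hp hq => simp only [map_add, TensorProduct.add_tmul, TensorProduct.tmul_add, hp, hq]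
  | tmul p q => simp

/-- The diagonal action of `H` on `B(W) # B(W^*)`, `h · (b # ξ) = h₁ · b # h₂ · ξ`. -/
noncomputable def smashAct : H →ₐ[k] Module.End k (Y.Smash hS) :=
  (Module.endTensorEndAlgHom.comp
    (Algebra.TensorProduct.map Y.nicholsAct (Y.dual hS).nicholsAct)).comp
      (Bialgebra.comulAlgHom k H)

/-- `φ_W : W → W^**`, `φ_W(w) = S(φ₋₁) · φ₀`, where `φ ∈ W^**` is the evaluation at `w`. -/
noncomputable def doubleDualMap : W →ₗ[k] Module.Dual k (Module.Dual k W) :=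
  TensorProduct.lift (((Y.dual hS).dual hS).act.toLinearMap ∘ₗ antipode k) ∘ₗ
    ((Y.dual hS).dual hS).coact ∘ₗ Module.Dual.eval k W

end Smash
end YetterDrinfeld

/-! The three parts rest on the fact that $\mathcal B(W)$ is an algebra in ${}^H_H\mathcal{YD}$ on
which the operators $\partial_f$, $f\in W^*$, are $H$-linear, $H$-colinear and satisfy a twisted
Leibniz rule.

Multiplicativity of $\Psi$. Colinearity of $\partial_f$ gives $(f\xi)b=f(\xi b)$
(`exchangeAux_braidedMul`). The Leibniz rule moves a generator $f\in W^*$ past an element of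
$\mathcal B(W)$ (`smashMul_ι_rTensor`). Together they make the product on $\mathcal B(W)\#\mathcal
B(W^*)$ associative (`smashMul_assoc`), with no appeal to injectivity of $\Psi$. The map
$\mathrm{id}\otimes\varepsilon$ carries left multiplication by $a$ to $\Psi(a)$
(`smashCounit_smashMul`), so $\mathcal B(W)$ is a quotient of the left regular module and $\Psi$ is
its representation.

The canonical family. Unwinding $c^{-1}$ gives $d_f(x)=f_{(-1)}\cdot r_{f_{(0)}}(x)$ with
$r_f(x)=x^{(1)}\langle f,\mathrm{pr}_1 x^{(2)}\rangle$ (`canonicalFamily_eq`), and the product rule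
for $r_f$ turns into the braided derivation rule. Uniqueness holds because $W^*$ generates $\mathcal
B(W^*)$.

The derivations of $\mathcal B(W)\#\mathcal B(W^*)$. They are inner: for $f=\phi_W(w)$ one has
$d_f(a)=(w_{(-1)}\cdot a)\,w_{(0)}-w\,a$ (`smashDerivation_eq`). In an associative $H$-module
algebra (`smashAct_smashMul`) such a braided commutator satisfies the derivation rule by
telescoping. The index is right because $\phi_W$ is a bijective comodule map (`coact_doubleDualMap`,
`doubleDualMap_surjective`); bijectivity also makes $d$ well defined and unique.

Sweedler notation is replaced throughout by matrices. Every comodule element belongs to a finite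
family with $\delta(v_j)=\sum_i N_{ji}\otimes v_i$ and $\Delta(N_{ij})=\sum_l N_{il}\otimes N_{lj}$
(`exists_coact_family`). Iterated coproducts become matrix products, and antipode identities become
sums equal to a Kronecker delta. -/

section Comatrix
-- Comatrices and finite families in comodules.
variable (k : Type*) {H : Type*} [Field k] [Ring H] [HopfAlgebra k H]

/-- A square matrix of matrix coefficients: `Δ(N_ij) = ∑ N_il ⊗ N_lj` and `ε(N_ij) = δ_ij`. -/
structure IsComatrix {n : ℕ} (N : Fin n → Fin n → H) : Prop where
  comul_eq : ∀ i j, comul (R := k) (N i j) = ∑ l, N i l ⊗ₜ[k] N l j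
  counit_eq : ∀ i j, counit (R := k) (N i j) = if i = j then 1 else 0

variable {k}

namespace IsComatrix
variable {n : ℕ} {N : Fin n → Fin n → H} (hN : IsComatrix k N)
include hN

theorem sum_antipode_mul (i j : Fin n) :
    ∑ l, antipode k (N i l) * N l j = if i = j then 1 else 0 := by
  have h := mul_antipode_rTensor_comul_apply (R := k) (N i j)
  rw [hN.comul_eq, hN.counit_eq] at h
  simpa [apply_ite] using h

theorem sum_mul_antipode (i j : Fin n) :
    ∑ l, N i l * antipode k (N l j) = if i = j then 1 else 0 := by
  have h := mul_antipode_lTensor_comul_apply (R := k) (N i j)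
  rw [hN.comul_eq, hN.counit_eq] at h
  simpa [apply_ite] using h

variable (hS : Function.Bijective (antipode k : H →ₗ[k] H))

/-- $S^{-1}$ reverses products, so the factors stand in the opposite order to the indices. Applying
the injective $S$ reduces this to the identity for $S$. -/
theorem sum_antipodeInv_mul (i j : Fin n) :
    ∑ l, antipodeInv hS (N l j) * N i l = if i = j then 1 else 0 := by
  apply hS.1
  simp only [map_sum, antipode_mul_antidistrib, antipode_antipodeInv, apply_ite (antipode k),
    map_zero, antipode_one]
  exact hN.sum_antipode_mul i j

theorem sum_mul_antipodeInv (i j : Fin n) :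
    ∑ l, N l j * antipodeInv hS (N i l) = if i = j then 1 else 0 := by
  apply hS.1
  simp only [map_sum, antipode_mul_antidistrib, antipode_antipodeInv, apply_ite (antipode k),
    map_zero, antipode_one]
  exact hN.sum_mul_antipode i j

/-- The transpose appears because $S^{-1}$ reverses the coproduct. Facts about the action of a
comatrix thereby apply to the action of $S^{-1}(v_{(-1)})$. -/
theorem antipodeInv : IsComatrix k (fun i j => antipodeInv hS (N j i)) where
  comul_eq i j := by
    rw [comul_antipodeInv, hN.comul_eq]; simp
  counit_eq i j := by
    rw [counit_antipodeInv, hN.counit_eq]; simp only [eq_comm]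

end IsComatrix

section Families
variable {V : Type*} [AddCommGroup V] [Module k V]

theorem exists_dual_family {n : ℕ} {U : Submodule k V} (v : Module.Basis (Fin n) k U) (i : Fin n) :
    ∃ φ : Module.Dual k V, ∀ j, φ (v j) = if j = i then 1 else 0 := by
  obtain ⟨φ, hφ⟩ := LinearMap.exists_extend (v.coord i)
  refine ⟨φ, fun j => ?_⟩
  have := congrArg (fun g => g (v j)) hφ
  simpa [Finsupp.single_apply] using this

theorem exists_basis_eq [FiniteDimensional k V] {x : V} (hx : x ≠ 0) :
    ∃ (n : ℕ) (v : Module.Basis (Fin n) k V) (j : Fin n), v j = x := by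
  have hs : LinearIndepOn k id {x} := LinearIndepOn.singleton hx
  let b := Module.Basis.extend hs
  have : Fintype (hs.extend (Set.subset_univ {x})) := FiniteDimensional.fintypeBasisIndex b
  have hmem : x ∈ hs.extend (Set.subset_univ {x}) := hs.subset_extend _ rfl
  refine ⟨_, b.reindex (Fintype.equivFin _), Fintype.equivFin _ ⟨x, hmem⟩, ?_⟩
  simp [b]

/-- The fundamental theorem of comodules: an element of a comodule lies in a finite-dimensional
subcomodule, so that it is a member of a finite family on which the coaction is given by a matrix
of matrix coefficients. -/
theorem exists_coact_family (δ : V →ₗ[k] H ⊗[k] V)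
    (counit_coact : ∀ x, TensorProduct.lid k V ((counit (R := k)).rTensor V (δ x)) = x)
    (coassoc : ∀ x, TensorProduct.assoc k H H V ((comul (R := k)).rTensor V (δ x)) =
      δ.lTensor H (δ x)) (x : V) :
    ∃ (n : ℕ) (N : Fin n → Fin n → H) (v : Fin n → V) (j : Fin n), IsComatrix k N ∧
      (∀ j, δ (v j) = ∑ i, N j i ⊗ₜ[k] v i) ∧ v j = x := by
  -- The zero vector lies in no basis, so it gets the family consisting of $0$ alone with
  -- coefficient $1$.
  by_cases hx : x = 0
  · refine ⟨1, fun _ _ => 1, fun _ => 0, 0, ⟨?_, ?_⟩, by simp, hx.symm⟩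
    · simp [Algebra.TensorProduct.one_def]
    · intro i j; simp [Subsingleton.elim i j]
  -- Writing $\delta(x)=\sum_i b_i\otimes s_i$ over a basis of $H$, the span $U$ of the finitely
  -- many $s_i$ is the required subcomodule; the counit axiom puts $x$ in it.
  let b := Module.Basis.ofVectorSpace k H
  obtain ⟨s, hs⟩ := TensorProduct.eq_repr_basis_left b (δ x)
  let U : Submodule k V := Submodule.span k (s '' s.support)
  have hsU : ∀ i ∈ s.support, s i ∈ U := fun i hi => Submodule.subset_span ⟨i, hi, rfl⟩
  have hfin : FiniteDimensional k U :=
    FiniteDimensional.span_of_finite k (s.support.finite_toSet.image _)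
  have hxU : x ∈ U := by
    have h := counit_coact x
    rw [← hs] at h
    rw [← h, Finsupp.sum, map_sum, map_sum]
    refine sum_mem fun i hi => ?_
    simpa using U.smul_mem _ (hsU i hi)
  have hδ : ∀ u ∈ U, δ u ∈ (U.subtype.lTensor H).range := by
    intro u hu
    induction hu using Submodule.span_induction with
    | zero => simp
    | add a b _ _ ha hb => rw [map_add]; exact add_mem ha hb
    | smul c a _ ha => rw [map_smul]; exact Submodule.smul_mem _ _ ha
    | mem u hu =>
      obtain ⟨i, hi, rfl⟩ := hu
      -- A coordinate functional on the outer factor $H$ isolates $\delta(s_i)$ on one side of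
      -- coassociativity; the other side visibly lies in $H\otimes U$.
      let T : H ⊗[k] (H ⊗[k] V) →ₗ[k] H ⊗[k] V :=
        (TensorProduct.lid k _).toLinearMap ∘ₗ (b.coord i).rTensor _
      have h := congrArg T (coassoc x)
      rw [← hs] at h
      have h1 : T (δ.lTensor H (s.sum fun i n => b i ⊗ₜ[k] n)) = δ (s i) := by
        simp only [T, Finsupp.sum, map_sum, LinearMap.lTensor_tmul, LinearMap.comp_apply,
          LinearMap.rTensor_tmul, LinearEquiv.coe_coe, TensorProduct.lid_tmul,
          Module.Basis.coord_apply, Module.Basis.repr_self]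
        rw [Finset.sum_eq_single i]
        · simp
        · intro j _ hj; simp [hj]
        · intro hi'; exact absurd hi hi'
      rw [h1] at h
      rw [← h, Finsupp.sum, map_sum, map_sum, map_sum]
      refine sum_mem fun m hm => ?_
      rw [LinearMap.rTensor_tmul]
      generalize comul (R := k) (b m) = d
      induction d with
      | zero => simp
      | add p q hp hq => rw [TensorProduct.add_tmul, map_add, map_add]; exact add_mem hp hq
      | tmul p q =>
        exact ⟨b.coord i p • q ⊗ₜ ⟨s m, hsU m hm⟩, by simp [T]⟩
  obtain ⟨n, v, j, hj⟩ := exists_basis_eq (k := k) (V := U) (x := ⟨x, hxU⟩)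
    (fun h => hx (congrArg Subtype.val h))
  choose t ht using fun j => hδ (v j) (v j).2
  let N : Fin n → Fin n → H := fun j i => TensorProduct.equivFinsuppOfBasisRight v (t j) i
  have hN : ∀ j, δ (v j) = ∑ i, N j i ⊗ₜ[k] (v i : V) := by
    intro j
    have h := (TensorProduct.equivFinsuppOfBasisRight (M := H) v).symm_apply_apply (t j)
    rw [TensorProduct.equivFinsuppOfBasisRight_symm_apply,
      Finsupp.sum_fintype _ _ (by simp)] at h
    rw [← ht, ← h]
    simp [N]
  -- The members $v_i$ form a basis of $U$, so functionals dual to them read off $\Delta(N_{ij})$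
  -- and $\varepsilon(N_{ij})$ from the comodule axioms.
  choose φ hφ using exists_dual_family v
  have hc : ∀ i j, comul (R := k) (N i j) = ∑ l, N i l ⊗ₜ[k] N l j := by
    intro i j
    have h := congrArg (fun u => contract (H ⊗[k] H) (φ j) ((TensorProduct.assoc k H H V).symm u))
      (coassoc (v i))
    simp only [LinearEquiv.symm_apply_apply, hN, map_sum, LinearMap.rTensor_tmul, contract_tmul,
      LinearMap.lTensor_tmul, TensorProduct.tmul_sum, TensorProduct.assoc_symm_tmul, hφ] at h
    simpa using h
  have he : ∀ i j, counit (R := k) (N i j) = if i = j then 1 else 0 := by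
    intro i j
    have h := congrArg (φ j) (counit_coact (v i))
    simp only [hN, map_sum, LinearMap.rTensor_tmul, TensorProduct.lid_tmul, map_smul, hφ] at h
    simpa using h
  exact ⟨n, N, fun i => v i, j, ⟨hc, he⟩, hN, congrArg Subtype.val hj⟩

end Families
end Comatrix

/-! ### Families and induction in Nichols algebras. -/

namespace YetterDrinfeld
section
variable {k H V : Type*} [Field k] [Ring H] [HopfAlgebra k H] [AddCommGroup V] [Module k V]
  (Y : YetterDrinfeld k H V)

theorem exists_family (x : V) : ∃ (n : ℕ) (N : Fin n → Fin n → H) (v : Fin n → V) (j : Fin n),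
    IsComatrix k N ∧ (∀ j, Y.coact (v j) = ∑ i, N j i ⊗ₜ[k] v i) ∧ v j = x :=
  exists_coact_family Y.coact Y.counit_coact Y.coassoc x

theorem nichols_exists_family (x : Y.Nichols) :
    ∃ (n : ℕ) (N : Fin n → Fin n → H) (v : Fin n → Y.Nichols) (j : Fin n),
    IsComatrix k N ∧ (∀ j, Y.nicholsCoact (v j) = ∑ i, N j i ⊗ₜ[k] v i) ∧ v j = x :=
  exists_coact_family Y.nicholsCoact.toLinearMap Y.nichols_isBraidedAlgebra.counit_coact
    Y.nichols_isBraidedAlgebra.coassoc x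

theorem nichols_left_induction {p : Y.Nichols → Prop} (one : p 1)
    (ι_mul : ∀ w x, p x → p (Y.nicholsι w * x)) (smul : ∀ (c : k) x, p x → p (c • x))
    (add : ∀ x y, p x → p y → p (x + y)) (x : Y.Nichols) : p x := by
  obtain ⟨x, rfl⟩ := Y.nicholsMk_surjective x
  induction x using tensorAlgebra_left_induction (k := k) with
  | one => rwa [map_one]
  | ι_mul w x hx => rw [map_mul]; exact ι_mul w _ hx
  | smul c x hx => rw [map_smul]; exact smul c _ hx
  | add x y hx hy => rw [map_add]; exact add _ _ hx hy

end
end YetterDrinfeld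

theorem sum_comm_reverse {ι κ τ M : Type*} [Fintype ι] [Fintype κ] [Fintype τ]
    [AddCommMonoid M] (f : ι → κ → τ → M) :
    ∑ a, ∑ b, ∑ c, f a b c = ∑ c, ∑ b, ∑ a, f a b c := by
  rw [Finset.sum_comm, Finset.sum_comm (f := fun c b => ∑ a, f a b c)]
  exact Finset.sum_congr rfl fun _ _ => Finset.sum_comm

/-! ### Nichols algebras as algebras and coalgebras in the Yetter–Drinfeld category. -/

namespace YetterDrinfeld
section Compatibility
variable {k H V : Type*} [Field k] [Ring H] [HopfAlgebra k H] [AddCommGroup V] [Module k V]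
  (Y : YetterDrinfeld k H V)

theorem nicholsAct_ι (h : H) (v : V) : Y.nicholsAct h (Y.nicholsι v) = Y.nicholsι (Y.act h v) := by
  simp [nicholsι]

theorem nicholsCounit_act (h : H) (x : Y.Nichols) :
    Y.nicholsCounit (Y.nicholsAct h x) = counit (R := k) h * Y.nicholsCounit x := by
  obtain ⟨x, rfl⟩ := Y.nicholsMk_surjective x
  exact Y.algebraMapInv_tensorAct h x

theorem nicholsProjOne_coact (x : Y.Nichols) :
    Y.nicholsProjOne.lTensor H (Y.nicholsCoact x) = Y.coact (Y.nicholsProjOne x) := by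
  obtain ⟨x, rfl⟩ := Y.nicholsMk_surjective x
  rw [nicholsProjOne_mk, ← ιInv_tensorCoact, nicholsCoact_mk, ← LinearMap.comp_apply,
    ← LinearMap.lTensor_comp]
  rfl

theorem nicholsCounit_coact (x : Y.Nichols) :
    contract H Y.nicholsCounit.toLinearMap (Y.nicholsCoact x) = Y.nicholsCounit x • (1 : H) := by
  obtain ⟨x, rfl⟩ := Y.nicholsMk_surjective x
  rw [nicholsCounit_mk, ← Y.algebraMapInv_tensorCoact, nicholsCoact_mk, contract, contract,
    LinearMap.comp_apply, LinearMap.comp_apply, ← LinearMap.comp_apply (LinearMap.lTensor H _),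
    ← LinearMap.lTensor_comp]
  rfl

theorem nicholsComul_counit_right (x : Y.Nichols) :
    contract _ Y.nicholsCounit.toLinearMap (Y.nicholsComul x) = x := by
  obtain ⟨x, rfl⟩ := Y.nicholsMk_surjective x
  have h := congrArg Y.nicholsMk (Y.tensorComul_counit_right x)
  rw [nicholsComul_mk]
  refine Eq.trans ?_ h
  generalize Y.tensorComul x = u
  induction u with
  | zero => simp
  | add a b ha hb => simp only [map_add, ha, hb]
  | tmul a b => simp

variable {n : ℕ} {N : Fin n → Fin n → H} (hN : IsComatrix k N)
include hN

theorem act_compat (i j : Fin n) (w : V) :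
    ∑ l, TensorProduct.map (LinearMap.mulLeft k (N i l)) (Y.act (N l j)) (Y.coact w) =
      ∑ l, (LinearMap.mulRight k (N l j)).rTensor V (Y.coact (Y.act (N i l) w)) := by
  have h := Y.compat (N i j) w
  rw [hN.comul_eq] at h
  simp only [map_sum, LinearMap.sum_apply, TensorProduct.lift.tmul, LinearMap.compl₁₂_apply,
    TensorProduct.mapBilinear_apply, AlgHom.toLinearMap_apply, LinearMap.mk₂_apply] at h
  exact h

theorem nicholsAct_mul (i j : Fin n) (x y : Y.Nichols) :
    Y.nicholsAct (N i j) (x * y) =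
      ∑ l, Y.nicholsAct (N i l) x * Y.nicholsAct (N l j) y := by
  rw [Y.nichols_isBraidedAlgebra.act_mul, hN.comul_eq]
  simp

theorem lTensor_nicholsAct_mul (i j : Fin n) (u v : H ⊗[k] Y.Nichols) :
    (Y.nicholsAct (N i j)).lTensor H (u * v) =
      ∑ l, (Y.nicholsAct (N i l)).lTensor H u * (Y.nicholsAct (N l j)).lTensor H v := by
  induction u with
  | zero => simp
  | add a b ha hb => simp only [add_mul, map_add, ha, hb, Finset.sum_add_distrib]
  | tmul a x =>
    induction v with
    | zero => simp
    | add a b ha hb => simp only [mul_add, map_add, ha, hb, Finset.sum_add_distrib]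
    | tmul b y => simp [Y.nicholsAct_mul hN, TensorProduct.tmul_sum]

/-- The Yetter-Drinfeld compatibility of the action and the coaction on `B(V)`. -/
theorem nichols_compat (i j : Fin n) (x : Y.Nichols) :
    ∑ l, (N i l ⊗ₜ[k] (1 : Y.Nichols)) * (Y.nicholsAct (N l j)).lTensor H (Y.nicholsCoact x) =
      ∑ l, Y.nicholsCoact (Y.nicholsAct (N i l) x) * (N l j ⊗ₜ[k] (1 : Y.Nichols)) := by
  induction x using Y.nichols_left_induction generalizing i j with
  | one =>
    simp [Y.nichols_isBraidedAlgebra.act_one, hN.counit_eq, Algebra.TensorProduct.one_def,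
      ite_smul, TensorProduct.tmul_ite]
  | ι_mul w x hx =>
    have hw : ∀ i j, ∑ l, (N i l ⊗ₜ[k] (1 : Y.Nichols)) *
        (Y.nicholsAct (N l j)).lTensor H (Y.nicholsCoact (Y.nicholsι w)) =
        ∑ l, Y.nicholsCoact (Y.nicholsAct (N i l) (Y.nicholsι w)) *
          (N l j ⊗ₜ[k] (1 : Y.Nichols)) := by
      intro i j
      have h := congrArg (Y.nicholsι.lTensor H) (Y.act_compat hN i j w)
      have h1 : ∀ (a b : H) (u : H ⊗[k] V), Y.nicholsι.lTensor H
          (TensorProduct.map (LinearMap.mulLeft k a) (Y.act b) u) =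
          (a ⊗ₜ[k] (1 : Y.Nichols)) * (Y.nicholsAct b).lTensor H (Y.nicholsι.lTensor H u) := by
        intro a b u
        induction u with
        | zero => simp
        | add a b ha hb => simp only [map_add, ha, hb, mul_add]
        | tmul c v => simp [nicholsAct_ι]
      have h2 : ∀ (a : H) (u : H ⊗[k] V), Y.nicholsι.lTensor H
          ((LinearMap.mulRight k a).rTensor V u) =
          Y.nicholsι.lTensor H u * (a ⊗ₜ[k] (1 : Y.Nichols)) := by
        intro a u
        induction u with
        | zero => simp
        | add a b ha hb => simp only [map_add, ha, hb, add_mul]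
        | tmul c v => simp
      simp only [map_sum, h1, h2] at h
      simpa only [nicholsCoact_ι, nicholsAct_ι] using h
    -- With $h$ split into three, the coefficient on the left is carried past the coaction of $w$ by
    -- `hw` and then past that of $x$ by the induction hypothesis; the sum exchanges expose the
    -- index being contracted.
    simp only [map_mul, Y.lTensor_nicholsAct_mul hN, Y.nicholsAct_mul hN, Finset.mul_sum, map_sum,
      Finset.sum_mul]
    rw [Finset.sum_comm]
    simp only [← mul_assoc, ← Finset.sum_mul, hw]
    simp only [Finset.sum_mul]
    rw [Finset.sum_comm]
    simp only [mul_assoc, ← Finset.mul_sum, hx]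
    simp only [Finset.mul_sum]
    rw [Finset.sum_comm]
  | smul c x hx => simp only [map_smul, mul_smul_comm, smul_mul_assoc, ← Finset.smul_sum, hx]
  | add x y hx hy => simp only [map_add, mul_add, add_mul, Finset.sum_add_distrib, hx, hy]

/-- This is $\delta(h\cdot x)=h_1x_{(-1)}S(h_3)\otimes h_2\cdot x_{(0)}$: multiply the compatibility
on the right by an antipode and cancel. -/
theorem nicholsCoact_act (i j : Fin n) (x : Y.Nichols) :
    Y.nicholsCoact (Y.nicholsAct (N i j) x) =
      ∑ l, ∑ m, (N i l ⊗ₜ[k] (1 : Y.Nichols)) *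
        (Y.nicholsAct (N l m)).lTensor H (Y.nicholsCoact x) *
          (antipode k (N m j) ⊗ₜ[k] (1 : Y.Nichols)) := by
  rw [Finset.sum_comm]
  simp only [← Finset.sum_mul, Y.nichols_compat hN]
  simp only [Finset.sum_mul]
  rw [Finset.sum_comm]
  simp only [mul_assoc, ← Finset.mul_sum, Algebra.TensorProduct.tmul_mul_tmul, mul_one,
    ← TensorProduct.sum_tmul, hN.sum_mul_antipode]
  simp [← Algebra.TensorProduct.one_def, TensorProduct.ite_tmul]

omit hN in
theorem braidedMul_tmul_map {A : Type*} [Ring A] [Algebra k A] (ρ : H →ₐ[k] Module.End k A)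
    (δ : A →ₐ[k] H ⊗[k] A) (p q r s : A) :
    braidedMul ρ δ (p ⊗ₜ q) (r ⊗ₜ s) =
      TensorProduct.map (LinearMap.mulLeft k p ∘ₗ ρ.toLinearMap.flip r)
        (LinearMap.mulRight k s) (δ q) := by
  obtain ⟨t, ht⟩ := TensorProduct.exists_finset (δ q)
  rw [braidedMul_tmul p q r s t ht, ht]
  simp

/-- The braided tensor square is an $H$-module algebra. This is where Yetter–Drinfeld compatibility
is indispensable: the product involves the coaction of a middle factor on which $H$ also acts. -/
theorem map_nicholsAct_braidedMul (i j : Fin n) (u v : Y.Nichols ⊗[k] Y.Nichols) :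
    ∑ l, TensorProduct.map (Y.nicholsAct (N i l)) (Y.nicholsAct (N l j))
        (braidedMul Y.nicholsAct Y.nicholsCoact u v) =
      ∑ l, ∑ m, ∑ o, braidedMul Y.nicholsAct Y.nicholsCoact
        (TensorProduct.map (Y.nicholsAct (N i l)) (Y.nicholsAct (N l m)) u)
        (TensorProduct.map (Y.nicholsAct (N m o)) (Y.nicholsAct (N o j)) v) := by
  induction u with
  | zero => simp
  | add a b ha hb => simp only [map_add, LinearMap.add_apply, ha, hb, Finset.sum_add_distrib]
  | tmul p q =>
    induction v with
    | zero => simp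
    | add a b ha hb => simp only [map_add, ha, hb, Finset.sum_add_distrib]
    | tmul r s =>
      simp only [TensorProduct.map_tmul, braidedMul_tmul_map]
      -- With the outer factors $p$ and $s$ already acted upon, both sides are values of the same
      -- maps `Θ a b`, evaluated at the two sides of `nichols_compat` for $q$.
      let Θ : Fin n → Fin n → H ⊗[k] Y.Nichols →ₗ[k] Y.Nichols ⊗[k] Y.Nichols := fun a b =>
        TensorProduct.map (LinearMap.mulLeft k (Y.nicholsAct (N i a) p) ∘ₗ
          Y.nicholsAct.toLinearMap.flip r) (LinearMap.mulRight k (Y.nicholsAct (N b j) s))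
      have h1 : ∀ a b c d (u : H ⊗[k] Y.Nichols),
          TensorProduct.map (LinearMap.mulLeft k (Y.nicholsAct (N i a) p) ∘ₗ
            Y.nicholsAct.toLinearMap.flip (Y.nicholsAct (N c d) r))
              (LinearMap.mulRight k (Y.nicholsAct (N b j) s)) u =
          Θ a b (u * N c d ⊗ₜ 1) := by
        intro a b c d u
        induction u with
        | zero => simp
        | add x y hx hy => simp only [map_add, hx, hy, add_mul]
        | tmul x y => simp [Θ]
      have h2 : ∀ u : H ⊗[k] Y.Nichols,
          ∑ l, TensorProduct.map (Y.nicholsAct (N i l)) (Y.nicholsAct (N l j))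
            (TensorProduct.map (LinearMap.mulLeft k p ∘ₗ Y.nicholsAct.toLinearMap.flip r)
              (LinearMap.mulRight k s) u) =
          ∑ a, ∑ b, ∑ l, Θ a b ((N a l ⊗ₜ[k] (1 : Y.Nichols)) *
            (Y.nicholsAct (N l b)).lTensor H u) := by
        intro u
        induction u with
        | zero => simp
        | add x y hx hy => simp only [map_add, hx, hy, mul_add, Finset.sum_add_distrib]
        | tmul x y =>
          simp only [Θ, TensorProduct.map_tmul, LinearMap.comp_apply, LinearMap.flip_apply,
            LinearMap.mulLeft_apply, LinearMap.mulRight_apply, AlgHom.toLinearMap_apply,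
            Y.nicholsAct_mul hN, TensorProduct.sum_tmul, TensorProduct.tmul_sum,
            LinearMap.lTensor_tmul, Algebra.TensorProduct.tmul_mul_tmul, one_mul, map_mul,
            Module.End.mul_apply]
          rw [sum_comm_reverse]
      rw [h2]
      simp only [← map_sum, Y.nichols_compat hN]
      simp only [h1, map_sum]
      refine Finset.sum_congr rfl fun a _ => ?_
      rw [Finset.sum_comm]

/-- The comultiplication of `B(V)` is `H`-linear. -/
theorem nicholsComul_act (i j : Fin n) (x : Y.Nichols) :
    Y.nicholsComul (Y.nicholsAct (N i j) x) =
      ∑ l, TensorProduct.map (Y.nicholsAct (N i l)) (Y.nicholsAct (N l j)) (Y.nicholsComul x) := by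
  induction x using Y.nichols_left_induction generalizing i j with
  | one =>
    simp [Y.nichols_isBraidedAlgebra.act_one, hN.counit_eq, nicholsComul_one, ite_smul,
      TensorProduct.ite_tmul, TensorProduct.tmul_ite, apply_ite Y.nicholsComul]
  | ι_mul w x hx =>
    have hw : ∀ i j, Y.nicholsComul (Y.nicholsAct (N i j) (Y.nicholsι w)) =
        ∑ l, TensorProduct.map (Y.nicholsAct (N i l)) (Y.nicholsAct (N l j))
          (Y.nicholsComul (Y.nicholsι w)) := by
      intro i j
      simp [nicholsComul_ι, nicholsAct_ι, Y.nichols_isBraidedAlgebra.act_one, hN.counit_eq,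
        ite_smul, TensorProduct.ite_tmul, TensorProduct.tmul_ite, Finset.sum_add_distrib]
    rw [Y.nicholsAct_mul hN, nicholsComul_mul, Y.map_nicholsAct_braidedMul hN]
    simp only [map_sum, nicholsComul_mul, hx, hw, LinearMap.sum_apply]
    rw [sum_comm_reverse]
    exact Finset.sum_congr rfl fun _ _ => Finset.sum_comm
  | smul c x hx => simp only [map_smul, ← Finset.smul_sum, hx]
  | add x y hx hy => simp only [map_add, Finset.sum_add_distrib, hx, hy]

end Compatibility
end YetterDrinfeld

/-! ### Quantum derivations: linearity, Leibniz rule, colinearity. -/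

namespace YetterDrinfeld
section QuantumDerivation
variable {k H V : Type*} [Field k] [Ring H] [HopfAlgebra k H] [AddCommGroup V] [Module k V]
  (Y : YetterDrinfeld k H V)

/-- The operators `∂_f` for `f ∈ V^*`. -/
noncomputable def quantumDerivation : Module.Dual k V →ₗ[k] Module.End k Y.Nichols :=
  Y.leftQDO ∘ₗ Y.nicholsProjOne.dualMap

theorem quantumDerivation_apply (f : Module.Dual k V) (b : Y.Nichols) :
    Y.quantumDerivation f b = TensorProduct.lid k _
      ((f ∘ₗ Y.nicholsProjOne).rTensor Y.Nichols (Y.nicholsComul b)) := rfl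

theorem quantumDerivation_one (f : Module.Dual k V) : Y.quantumDerivation f 1 = 0 :=
  Y.leftQDO_projOne_one f

theorem coact_act {n : ℕ} {N : Fin n → Fin n → H} (hN : IsComatrix k N) (i j : Fin n) (w : V) :
    Y.coact (Y.act (N i j) w) = ∑ l, ∑ m,
      TensorProduct.map (LinearMap.mulLeft k (N i l) ∘ₗ LinearMap.mulRight k (antipode k (N m j)))
        (Y.act (N l m)) (Y.coact w) := by
  have h1 : ∀ l m, TensorProduct.map
      (LinearMap.mulLeft k (N i l) ∘ₗ LinearMap.mulRight k (antipode k (N m j)))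
        (Y.act (N l m)) (Y.coact w) = (LinearMap.mulRight k (antipode k (N m j))).rTensor V
      (TensorProduct.map (LinearMap.mulLeft k (N i l)) (Y.act (N l m)) (Y.coact w)) := by
    intro l m
    generalize Y.coact w = u
    induction u with
    | zero => simp
    | add a b ha hb => simp only [map_add, ha, hb]
    | tmul a b => simp [mul_assoc]
  have h2 : ∀ l (u : H ⊗[k] V), ∑ m, (LinearMap.mulRight k (antipode k (N m j))).rTensor V
      ((LinearMap.mulRight k (N l m)).rTensor V u) = if l = j then u else 0 := by
    intro l u
    induction u with
    | zero => simp
    | add a b ha hb =>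
      simp only [map_add, Finset.sum_add_distrib, ha, hb]
      split_ifs <;> simp
    | tmul a b =>
      simp only [LinearMap.rTensor_tmul, LinearMap.mulRight_apply, mul_assoc,
        ← TensorProduct.sum_tmul, ← Finset.mul_sum, hN.sum_mul_antipode]
      split_ifs <;> simp
  simp only [h1]
  rw [Finset.sum_comm]
  simp only [← map_sum, Y.act_compat hN]
  simp only [map_sum]
  rw [Finset.sum_comm]
  simp only [h2]
  simp

variable {n : ℕ} {N : Fin n → Fin n → H} (hN : IsComatrix k N)

include hN in
-- Since $\Delta$ and $\mathrm{pr}_1$ are $H$-linear, it remains to see that evaluation is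
-- invariant, $\langle h_1\cdot f,h_2\cdot v\rangle=\varepsilon(h)\langle f,v\rangle$, which is the
-- antipode axiom.
theorem nicholsAct_quantumDerivation (f : Module.Dual k V) (i j : Fin n) (b : Y.Nichols) :
    Y.nicholsAct (N i j) (Y.quantumDerivation f b) =
      ∑ l, Y.quantumDerivation (Y.dualAct (N i l) f) (Y.nicholsAct (N l j) b) := by
  simp only [quantumDerivation_apply, Y.nicholsComul_act hN, map_sum]
  generalize Y.nicholsComul b = u
  induction u with
  | zero => simp
  | add x y hx hy => simp only [map_add, hx, hy, Finset.sum_add_distrib]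
  | tmul x y =>
    simp only [TensorProduct.map_tmul, LinearMap.rTensor_tmul, TensorProduct.lid_tmul,
      LinearMap.comp_apply, dualAct_apply, nicholsProjOne_act, map_smul]
    rw [Finset.sum_comm]
    have h1 : ∀ m, ∑ l, Y.act (antipode k (N i l)) (Y.act (N l m) (Y.nicholsProjOne x)) =
        if i = m then Y.nicholsProjOne x else 0 := by
      intro m
      have h2 := congrArg (fun h => Y.act h (Y.nicholsProjOne x)) (hN.sum_antipode_mul i m)
      simp only [map_sum, LinearMap.sum_apply, map_mul, Module.End.mul_apply] at h2
      rw [h2]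
      split_ifs <;> simp
    simp only [← Finset.sum_smul, ← map_sum, h1]
    simp [apply_ite f, ite_smul]

variable (hS : Function.Bijective (antipode k : H →ₗ[k] H))

include hN in
-- The previous identity solved for the other side: $\partial_f(h\cdot
-- b)=h_2\cdot\partial_{S^{-1}(h_1)\cdot f}(b)$.
theorem quantumDerivation_nicholsAct (f : Module.Dual k V) (m j : Fin n) (b : Y.Nichols) :
    Y.quantumDerivation f (Y.nicholsAct (N m j) b) =
      ∑ i, Y.nicholsAct (N i j)
        (Y.quantumDerivation (Y.dualAct (antipodeInv hS (N m i)) f) b) := by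
  simp only [Y.nicholsAct_quantumDerivation hN]
  rw [Finset.sum_comm]
  have h1 : ∀ l, ∑ i, Y.dualAct (N i l) (Y.dualAct (antipodeInv hS (N m i)) f) =
      if m = l then f else 0 := by
    intro l
    have h2 := congrArg (fun h => Y.dualAct h f) (hN.sum_mul_antipodeInv hS m l)
    simp only [map_sum, LinearMap.sum_apply, map_mul, Module.End.mul_apply] at h2
    rw [h2]
    split_ifs <;> simp
  simp only [← LinearMap.sum_apply, ← map_sum, h1]
  simp [apply_ite Y.quantumDerivation, ite_apply, LinearMap.zero_apply, apply_ite DFunLike.coe]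

/-- The right side of `leftQDO_ι_mul` is a linear function of the tensor $\delta(v_m)$, so any
expansion of that tensor may be used. -/
theorem quantumDerivation_ι_mul {v : Fin n → V} (hv : ∀ j, Y.coact (v j) = ∑ i, N j i ⊗ₜ[k] v i)
    (f : Module.Dual k V) (m : Fin n) (b : Y.Nichols) :
    Y.quantumDerivation f (Y.nicholsι (v m) * b) = f (v m) • b +
      ∑ i, Y.nicholsι (v i) *
        Y.quantumDerivation (Y.dualAct (antipodeInv hS (N m i)) f) b := by
  obtain ⟨t, ht⟩ := TensorProduct.exists_finset (Y.coact (v m))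
  refine (Y.leftQDO_ι_mul hS f (v m) b t ht).trans ?_
  rw [hv] at ht
  congr 1
  have h := congrArg (LinearMap.mul' k _ ∘ₗ (TensorProduct.comm k _ _).toLinearMap ∘ₗ
    TensorProduct.map (Y.quantumDerivation.flip b ∘ₗ Y.dualAct.toLinearMap.flip f ∘ₗ
      antipodeInv hS) Y.nicholsι) ht
  simp only [map_sum, LinearMap.comp_apply, TensorProduct.map_tmul, LinearEquiv.coe_coe,
    TensorProduct.comm_tmul, LinearMap.mul'_apply, LinearMap.flip_apply,
    AlgHom.toLinearMap_apply] at h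
  exact h.symm

/-- The linear map `h ⊗ x ↦ x ∂_{S⁻¹(h) · f}(y)`. -/
noncomputable def twistedDerivation (f : Module.Dual k V) (y : Y.Nichols) :
    H ⊗[k] Y.Nichols →ₗ[k] Y.Nichols :=
  LinearMap.mul' k _ ∘ₗ (TensorProduct.comm k _ _).toLinearMap ∘ₗ
    (Y.quantumDerivation.flip y ∘ₗ Y.dualAct.toLinearMap.flip f ∘ₗ
      antipodeInv hS).rTensor Y.Nichols

@[simp] theorem twistedDerivation_tmul (f : Module.Dual k V) (y : Y.Nichols) (h : H)
    (x : Y.Nichols) : Y.twistedDerivation hS f y (h ⊗ₜ x) =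
      x * Y.quantumDerivation (Y.dualAct (antipodeInv hS h) f) y := by
  simp [twistedDerivation]

/-- The Leibniz rule `∂_f(x y) = ∂_f(x) y + x₀ ∂_{S⁻¹(x₋₁) · f}(y)`. -/
theorem quantumDerivation_mul (f : Module.Dual k V) (x y : Y.Nichols) :
    Y.quantumDerivation f (x * y) =
      Y.quantumDerivation f x * y + Y.twistedDerivation hS f y (Y.nicholsCoact x) := by
  induction x using Y.nichols_left_induction generalizing f with
  | one =>
    simp [quantumDerivation_one, Algebra.TensorProduct.one_def, antipodeInv_one]
  | ι_mul w x hx =>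
    obtain ⟨n, N, v, m, hN, hv, rfl⟩ := Y.exists_family w
    -- Removing the generator from $\delta(v_m x)$ twists $f$ by $S^{-1}(N_{mi})$, because $S^{-1}$
    -- reverses products and the later coefficient acts last. This twisted $f$ is why the induction
    -- keeps $f$ general.
    have h1 : ∀ (i : Fin n) (u : H ⊗[k] Y.Nichols),
        Y.twistedDerivation hS f y (N m i ⊗ₜ Y.nicholsι (v i) * u) =
        Y.nicholsι (v i) *
          Y.twistedDerivation hS (Y.dualAct (antipodeInv hS (N m i)) f) y u := by
      intro i u
      induction u with
      | zero => simp
      | add a b ha hb => simp only [map_add, ha, hb, mul_add]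
      | tmul a b => simp [antipodeInv_mul, mul_assoc]
    rw [mul_assoc, Y.quantumDerivation_ι_mul hS hv, Y.quantumDerivation_ι_mul hS hv, map_mul,
      nicholsCoact_ι, hv]
    simp only [map_sum, LinearMap.lTensor_tmul, Finset.sum_mul, h1, hx, mul_add, add_mul,
      Finset.sum_add_distrib, smul_mul_assoc, mul_assoc, add_assoc]
  | smul c x hx => simp only [map_smul, smul_mul_assoc, hx, smul_add]
  | add x z hx hz => simp only [map_add, add_mul, hx, hz]; abel

include hS in
-- This is coassociativity of $\Delta$ with its first leg contracted against $f$. It is obtained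
-- directly by induction: the Leibniz rule for $\partial_f$ matches multiplication by $\Delta(w)$ in
-- the braided tensor square.
theorem nicholsComul_quantumDerivation (f : Module.Dual k V) (b : Y.Nichols) :
    Y.nicholsComul (Y.quantumDerivation f b) =
      (Y.quantumDerivation f).rTensor Y.Nichols (Y.nicholsComul b) := by
  induction b using Y.nichols_left_induction generalizing f with
  | one => simp [quantumDerivation_one, nicholsComul_one]
  | ι_mul w x hx =>
    obtain ⟨n, N, v, m, hN, hv, rfl⟩ := Y.exists_family w
    have hι : ∀ (m : Fin n) (r s : Y.Nichols), braidedMul Y.nicholsAct Y.nicholsCoact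
        (Y.nicholsComul (Y.nicholsι (v m))) (r ⊗ₜ s) =
        (Y.nicholsι (v m) * r) ⊗ₜ s +
          ∑ i, Y.nicholsAct (N m i) r ⊗ₜ (Y.nicholsι (v i) * s) := by
      intro m r s
      rw [nicholsComul_ι, map_add, LinearMap.add_apply, braidedMul_ι_left,
        braidedMul_tmul_map, nicholsCoact_ι, hv]
      simp
    rw [Y.quantumDerivation_ι_mul hS hv, map_add, map_smul, map_sum]
    simp only [nicholsComul_mul, hx]
    generalize Y.nicholsComul x = u
    induction u with
    | zero => simp
    | add a b ha hb =>
      simp only [map_add, smul_add, Finset.sum_add_distrib, ← ha, ← hb]; abel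
    | tmul r s =>
      simp only [LinearMap.rTensor_tmul, hι, map_add, map_sum, Y.quantumDerivation_ι_mul hS hv,
        Y.quantumDerivation_nicholsAct hN hS, TensorProduct.add_tmul, TensorProduct.sum_tmul,
        Finset.sum_add_distrib, TensorProduct.smul_tmul', add_assoc]
      rw [Finset.sum_comm]
  | smul c x hx => simp only [map_smul, hx]
  | add x z hx hz => simp only [map_add, hx, hz]

include hS in
theorem nicholsComul_tensorQDO (ξ : TensorAlgebra k (Module.Dual k V)) (b : Y.Nichols) :
    Y.nicholsComul (Y.tensorQDO ξ b) = (Y.tensorQDO ξ).rTensor Y.Nichols (Y.nicholsComul b) := by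
  induction ξ using tensorAlgebra_left_induction (k := k) (W := Module.Dual k V)
    generalizing b with
  | one => simp [Module.End.one_eq_id]
  | ι_mul f ξ hξ =>
    rw [map_mul, Module.End.mul_apply, tensorQDO_ι]
    refine (Y.nicholsComul_quantumDerivation hS f _).trans ?_
    rw [hξ, ← LinearMap.comp_apply, ← LinearMap.rTensor_comp]
    rfl
  | smul c x hx => simp only [map_smul, LinearMap.smul_apply, hx, LinearMap.rTensor_smul]
  | add x z hx hz => simp only [map_add, LinearMap.add_apply, hx, hz, LinearMap.rTensor_add]

include hS in
-- The operator of the functional $\langle\xi,\cdot\rangle$ agrees with the composite of the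
-- $\partial_{f_i}$: the composite acts on the first leg of $\Delta$, and $\varepsilon$ on that leg
-- gives the functional. Hence $\xi\mapsto\partial_\xi$ is multiplicative.
theorem leftQDO_tensorPairing (ξ : TensorAlgebra k (Module.Dual k V)) :
    Y.leftQDO (Y.tensorPairing ξ) = Y.tensorQDO ξ := by
  ext b
  rw [← Y.nicholsCounit_comul_left (Y.tensorQDO ξ b), leftQDO_apply, leftQDO_apply,
    Y.nicholsComul_tensorQDO hS, ← LinearMap.comp_apply
    (LinearMap.rTensor _ Y.nicholsCounit.toLinearMap), ← LinearMap.rTensor_comp]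
  rfl

variable [FiniteDimensional k V]

theorem nicholsQDO_mk (ξ : TensorAlgebra k (Module.Dual k V)) :
    Y.nicholsQDO hS ((Y.dual hS).nicholsMk ξ) = Y.tensorQDO ξ :=
  Y.leftQDO_tensorPairing hS ξ

theorem nicholsQDO_ι (f : Module.Dual k V) :
    Y.nicholsQDO hS ((Y.dual hS).nicholsι f) = Y.quantumDerivation f := by
  refine (Y.nicholsQDO_mk hS _).trans (Y.tensorQDO_ι f)

theorem nicholsQDO_one : Y.nicholsQDO hS 1 = 1 := by
  rw [← map_one (Y.dual hS).nicholsMk, nicholsQDO_mk, map_one]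

theorem nicholsQDO_mul (ξ ζ : (Y.dual hS).Nichols) :
    Y.nicholsQDO hS (ξ * ζ) = Y.nicholsQDO hS ξ * Y.nicholsQDO hS ζ := by
  obtain ⟨ξ, rfl⟩ := (Y.dual hS).nicholsMk_surjective ξ
  obtain ⟨ζ, rfl⟩ := (Y.dual hS).nicholsMk_surjective ζ
  rw [← map_mul, nicholsQDO_mk, nicholsQDO_mk, nicholsQDO_mk, map_mul]

theorem nicholsQDO_apply_ι (ξ : (Y.dual hS).Nichols) (w : V) :
    Y.nicholsQDO hS ξ (Y.nicholsι w) = (Y.dual hS).nicholsCounit ξ • Y.nicholsι w +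
      ((Y.dual hS).nicholsProjOne ξ) w • (1 : Y.Nichols) := by
  obtain ⟨ξ, rfl⟩ := (Y.dual hS).nicholsMk_surjective ξ
  rw [nicholsQDO_mk]
  exact Y.tensorQDO_ι_right ξ w

/-- The linear map `h ⊗ f ↦ (a ⊗ b ↦ h a ⊗ ∂_f(b))`. -/
noncomputable def mulQuantumDerivation :
    H ⊗[k] Module.Dual k V →ₗ[k] Module.End k (H ⊗[k] Y.Nichols) :=
  TensorProduct.homTensorHomMap (RingHom.id k) H Y.Nichols H Y.Nichols ∘ₗ
    TensorProduct.map (LinearMap.mul k H) Y.quantumDerivation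

omit [FiniteDimensional k V] in
@[simp] theorem mulQuantumDerivation_tmul (h a : H) (f : Module.Dual k V) (b : Y.Nichols) :
    Y.mulQuantumDerivation (h ⊗ₜ f) (a ⊗ₜ b) = (h * a) ⊗ₜ Y.quantumDerivation f b := by
  simp [mulQuantumDerivation]

/-- The operators `∂_f` are colinear: `δ(∂_f(b)) = f₋₁ b₋₁ ⊗ ∂_{f₀}(b₀)`. -/
theorem nicholsCoact_quantumDerivation (f : Module.Dual k V) (b : Y.Nichols) :
    Y.nicholsCoact (Y.quantumDerivation f b) =
      Y.mulQuantumDerivation ((Y.dual hS).coact f) (Y.nicholsCoact b) := by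
  induction b using Y.nichols_left_induction generalizing f with
  | one =>
    rw [quantumDerivation_one, map_zero, map_one, Algebra.TensorProduct.one_def]
    generalize (Y.dual hS).coact f = u
    induction u with
    | zero => simp
    | add x y hx hy => rw [map_add, LinearMap.add_apply, ← hx, ← hy, add_zero]
    | tmul x y => simp [quantumDerivation_one]
  | ι_mul w x hx =>
    obtain ⟨n, N, v, m, hN, hv, rfl⟩ := Y.exists_family w
    obtain ⟨p, P, g, j, hP, hg, rfl⟩ := (Y.dual hS).exists_family f
    -- This is the Yetter–Drinfeld condition in $V^*$, applied to the transposed comatrix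
    -- $S^{-1}(N)$; its antipode turns one $S^{-1}(N)$ back into $N$.
    have h1 : ∀ o, (Y.dual hS).coact (Y.dualAct (antipodeInv hS (N m o)) (g j)) =
        ∑ l, ∑ q, ∑ i, (antipodeInv hS (N l o) * (P j i * N m q)) ⊗ₜ[k]
          Y.dualAct (antipodeInv hS (N q l)) (g i) := by
      intro o
      refine ((Y.dual hS).coact_act (hN.antipodeInv hS) o m (g j)).trans ?_
      rw [hg]
      simp only [map_sum, TensorProduct.map_tmul, LinearMap.comp_apply, LinearMap.mulLeft_apply,
        LinearMap.mulRight_apply, antipode_antipodeInv]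
      rfl
    -- Evaluation is colinear: $f_{(-1)}v_{(-1)}\langle f_{(0)},v_{(0)}\rangle=\langle f,v\rangle
    -- 1$. It accounts for the scalar term of the Leibniz rule.
    have h2 : ∑ q, ∑ i, g i (v q) • (P j i * N m q) = g j (v m) • (1 : H) := by
      have h3 : ∀ q, ∑ i, g i (v q) • P j i = ∑ o, g j (v o) • antipodeInv hS (N q o) := by
        intro q
        have h4 := Y.dualCoact_eval hS (g j) (v q)
        rw [hv] at h4
        have h5 : Y.dualCoact hS (g j) = ∑ i, P j i ⊗ₜ[k] g i := hg j
        rw [h5] at h4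
        simpa using h4
      simp only [← smul_mul_assoc, ← Finset.sum_mul, h3]
      simp only [Finset.sum_mul, smul_mul_assoc]
      rw [Finset.sum_comm]
      simp only [← Finset.smul_sum, hN.sum_antipodeInv_mul]
      simp
    rw [Y.quantumDerivation_ι_mul hS hv, map_add, map_smul, map_sum, map_mul, nicholsCoact_ι, hv,
      hg]
    simp only [map_mul, hx, nicholsCoact_ι, hv, h1]
    generalize Y.nicholsCoact x = u
    induction u with
    | zero => simp
    | add a b ha hb =>
      simp only [map_add, smul_add, mul_add, Finset.sum_add_distrib, ← ha, ← hb]; abel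
    | tmul a b =>
      simp only [map_sum, LinearMap.sum_apply, LinearMap.lTensor_tmul, Finset.sum_mul,
        Algebra.TensorProduct.tmul_mul_tmul, mulQuantumDerivation_tmul,
        Y.quantumDerivation_ι_mul hS hv, TensorProduct.tmul_add, TensorProduct.tmul_smul,
        TensorProduct.tmul_sum, Finset.sum_add_distrib, Finset.mul_sum]
      congr 1
      · have h3 := congrArg (fun h => (h * a) ⊗ₜ[k] b) h2
        simp only [Finset.sum_mul, TensorProduct.sum_tmul, smul_mul_assoc, one_mul, mul_assoc,
          ← TensorProduct.smul_tmul'] at h3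
        exact h3.symm
      -- In the twisted term, the coefficient of $v_c$ cancels against the leftmost coefficient from
      -- `h1`, leaving $l=o$.
      · have h3 : ∀ (l q : Fin n) (i : Fin p) (o : Fin n) (z : Y.Nichols),
            ∑ c, (N c o * (antipodeInv hS (N l c) * (P j i * N m q) * a)) ⊗ₜ[k] z =
              if l = o then (P j i * (N m q * a)) ⊗ₜ[k] z else 0 := by
          intro l q i o z
          simp only [mul_assoc (antipodeInv hS _), ← mul_assoc (N _ o), ← TensorProduct.sum_tmul,
            ← Finset.sum_mul, hN.sum_mul_antipodeInv]
          split_ifs <;> simp [mul_assoc]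
        rw [Finset.sum_comm]
        have h4 : ∀ l : Fin n, ∑ c, ∑ q, ∑ i, ∑ o,
            (N c o * (antipodeInv hS (N l c) * (P j i * N m q) * a)) ⊗ₜ[k]
              (Y.nicholsι (v o) *
                Y.quantumDerivation (Y.dualAct (antipodeInv hS (N q l)) (g i)) b) =
            ∑ q, ∑ i, (P j i * (N m q * a)) ⊗ₜ[k] (Y.nicholsι (v l) *
                Y.quantumDerivation (Y.dualAct (antipodeInv hS (N q l)) (g i)) b) := by
          intro l
          rw [Finset.sum_comm]
          refine Finset.sum_congr rfl fun q _ => ?_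
          rw [Finset.sum_comm]
          refine Finset.sum_congr rfl fun i _ => ?_
          rw [Finset.sum_comm]
          simp only [h3]
          simp
        simp only [h4]
        rw [Finset.sum_comm]
        exact Finset.sum_congr rfl fun _ _ => Finset.sum_comm
  | smul c x hx => simp only [map_smul, hx]
  | add x z hx hz => simp only [map_add, hx, hz]

end QuantumDerivation
end YetterDrinfeld

/-! ### The canonical family of braided derivations. -/

namespace YetterDrinfeld
section CanonicalDerivations
variable {k H V : Type*} [Field k] [Ring H] [HopfAlgebra k H] [AddCommGroup V] [Module k V]
  (Y : YetterDrinfeld k H V) (hS : Function.Bijective (antipode k : H →ₗ[k] H))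

/-- The operators `x ↦ x⁽¹⁾ ⟨f, pr₁(x⁽²⁾)⟩` for `f ∈ V^*`. -/
noncomputable def rightQuantumDerivation : Module.Dual k V →ₗ[k] Module.End k Y.Nichols :=
  LinearMap.mk₂ k (fun f x => contract Y.Nichols (f ∘ₗ Y.nicholsProjOne) (Y.nicholsComul x))
    (by intros; simp [LinearMap.add_comp, contract_add])
    (by intros; simp [LinearMap.smul_comp, contract_smul])
    (by intros; simp) (by intros; simp)

theorem rightQuantumDerivation_apply (f : Module.Dual k V) (x : Y.Nichols) :
    Y.rightQuantumDerivation f x =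
      contract Y.Nichols (f ∘ₗ Y.nicholsProjOne) (Y.nicholsComul x) := rfl

theorem rightQuantumDerivation_ι (f : Module.Dual k V) (v : V) :
    Y.rightQuantumDerivation f (Y.nicholsι v) = f v • 1 := by
  simp [rightQuantumDerivation_apply, nicholsComul_ι, nicholsProjOne_one]

theorem coact_nicholsProjOne {n : ℕ} {N : Fin n → Fin n → H} {v : Fin n → Y.Nichols}
    (hv : ∀ j, Y.nicholsCoact (v j) = ∑ i, N j i ⊗ₜ[k] v i) (m : Fin n) :
    Y.coact (Y.nicholsProjOne (v m)) = ∑ a, N m a ⊗ₜ[k] Y.nicholsProjOne (v a) := by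
  rw [← nicholsProjOne_coact, hv]
  simp

variable [FiniteDimensional k V]

/-- The defining property of the dual coaction in matrix form. Independence of the $v_j$ plays no
role, so it applies to the degree-one parts of a family in $\mathcal B(V)$. -/
theorem dual_coact_family {n : ℕ} {N : Fin n → Fin n → H} {v : Fin n → V}
    (hv : ∀ j, Y.coact (v j) = ∑ i, N j i ⊗ₜ[k] v i)
    {p : ℕ} {P : Fin p → Fin p → H} {g : Fin p → Module.Dual k V}
    (hg : ∀ j, (Y.dual hS).coact (g j) = ∑ i, P j i ⊗ₜ[k] g i) (j : Fin p) (m : Fin n) :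
    ∑ i, g i (v m) • P j i = ∑ a, g j (v a) • antipodeInv hS (N m a) := by
  have h1 := Y.dualCoact_eval hS (g j) (v m)
  have h2 : Y.dualCoact hS (g j) = ∑ i, P j i ⊗ₜ[k] g i := hg j
  rw [hv, h2] at h1
  simpa using h1

variable {p : ℕ} {P : Fin p → Fin p → H} {g : Fin p → Module.Dual k V}
  (hg : ∀ j, (Y.dual hS).coact (g j) = ∑ i, P j i ⊗ₜ[k] g i)
include hg

/-- In $c^{-1}(x^{(1)}\otimes x^{(2)})$ the coefficient $S^{-1}$ of $x^{(2)}$, paired with $f$, is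
exactly the coaction of $f$. The operator is therefore a right derivative followed by the action of
$f_{(-1)}$. -/
theorem canonicalFamily_eq (j : Fin p) (x : Y.Nichols) :
    Y.canonicalFamily hS (g j) x =
      ∑ i, Y.nicholsAct (P j i) (Y.rightQuantumDerivation (g i) x) := by
  simp only [canonicalFamily, LinearMap.mk₂_apply, rightQuantumDerivation_apply]
  generalize Y.nicholsComul x = u
  induction u with
  | zero => simp
  | add a b ha hb => simp only [map_add, Finset.sum_add_distrib, ha, hb]
  | tmul r s =>
    obtain ⟨n, N, v, m, hN, hv, rfl⟩ := Y.nichols_exists_family s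
    have h := congrArg (fun h => Y.nicholsAct h r)
      (Y.dual_coact_family hS (Y.coact_nicholsProjOne hv) hg j m)
    simp only [map_sum, map_smul, LinearMap.sum_apply, LinearMap.smul_apply] at h
    simp [invBraiding, hv, h]

/-- $\mathrm{pr}_1$ vanishes on products of two elements of the augmentation ideal, so only two
terms of $\Delta(x)\Delta(y)$ survive. In the second, the coaction of $x^{(2)}$ acts on $y$ and is
rewritten as $S(f_{(-1)})$. -/
theorem rightQuantumDerivation_mul (j : Fin p) (x y : Y.Nichols) :
    Y.rightQuantumDerivation (g j) (x * y) = x * Y.rightQuantumDerivation (g j) y +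
      ∑ i, Y.rightQuantumDerivation (g i) x * Y.nicholsAct (antipode k (P j i)) y := by
  have key : ∀ u v : Y.Nichols ⊗[k] Y.Nichols,
      contract Y.Nichols (g j ∘ₗ Y.nicholsProjOne) (braidedMul Y.nicholsAct Y.nicholsCoact u v) =
        contract _ Y.nicholsCounit.toLinearMap u * contract _ (g j ∘ₗ Y.nicholsProjOne) v +
        ∑ i, contract _ (g i ∘ₗ Y.nicholsProjOne) u *
          Y.nicholsAct (antipode k (P j i)) (contract _ Y.nicholsCounit.toLinearMap v) := by
    intro u v
    induction u with
    | zero => simp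
    | add a b ha hb =>
      simp only [map_add, LinearMap.add_apply, add_mul, Finset.sum_add_distrib, ha, hb]; abel
    | tmul a q =>
      induction v with
      | zero => simp
      | add a b ha hb => simp only [map_add, mul_add, Finset.sum_add_distrib, ha, hb]; abel
      | tmul r s =>
        obtain ⟨n, N, v, m, hN, hv, rfl⟩ := Y.nichols_exists_family q
        have h1 := congrArg (fun h => a * Y.nicholsAct (antipode k h) r)
          (Y.dual_coact_family hS (Y.coact_nicholsProjOne hv) hg j m)
        -- In the term where $\mathrm{pr}_1$ falls on the second factor, $\varepsilon$ is applied to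
        -- $q_{(0)}$; colinearity of $\varepsilon$ then makes the braiding trivial.
        have h2 := Y.nicholsCounit_coact (v m)
        rw [hv] at h2
        replace h2 := congrArg (fun h => a * Y.nicholsAct h r) h2
        simp only [map_sum, contract_tmul, AlgHom.toLinearMap_apply, map_smul, LinearMap.sum_apply,
          LinearMap.smul_apply, Finset.mul_sum, mul_smul_comm, antipode_antipodeInv, map_one,
          Module.End.one_apply] at h1 h2
        rw [braidedMul_tmul_map, hv]
        simp only [map_sum, TensorProduct.map_tmul, contract_tmul, LinearMap.comp_apply,
          LinearMap.mulLeft_apply, LinearMap.mulRight_apply, LinearMap.flip_apply,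
          AlgHom.toLinearMap_apply, nicholsProjOne_mul, map_add, map_smul, add_smul,
          Finset.sum_add_distrib, smul_mul_assoc, mul_smul_comm, smul_eq_mul]
        simp only [mul_comm (Y.nicholsCounit (v _)), mul_smul, ← Finset.smul_sum, h1, h2]
  rw [rightQuantumDerivation_apply, nicholsComul_mul, key]
  simp only [nicholsComul_counit_right]
  rfl

omit hg

/-- The canonical family is a family of braided derivations. -/
theorem canonicalFamily_isBraidedDerivationFamily :
    IsBraidedDerivationFamily (LinearMap.mul k Y.Nichols) Y.nicholsAct (Y.dual hS).coact
      (Y.canonicalFamily hS) := by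
  intro f x y
  obtain ⟨p, P, g, j, hP, hg, rfl⟩ := (Y.dual hS).exists_family f
  rw [hg]
  simp only [LinearMap.mul_apply', map_sum, TensorProduct.lift.tmul, LinearMap.compl₁₂_apply,
    LinearMap.flip_apply, AlgHom.toLinearMap_apply, Y.canonicalFamily_eq hS hg,
    Y.rightQuantumDerivation_mul hS hg, map_add, Y.nicholsAct_mul hP, Finset.sum_add_distrib]
  congr 1
  · rw [Finset.sum_comm]
  -- Acting by $f_{(-1)}$ cancels the antipode on $y$, leaving $d_f(x)\,y$ untwisted.
  · have h1 : ∀ l n, ∑ i, Y.nicholsAct (P l i) (Y.nicholsAct (antipode k (P i n)) y) =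
        if l = n then y else 0 := by
      intro l n
      have h2 := congrArg (fun h => Y.nicholsAct h y) (hP.sum_mul_antipode l n)
      simp only [map_sum, LinearMap.sum_apply, map_mul, Module.End.mul_apply] at h2
      rw [h2]
      split_ifs <;> simp
    rw [sum_comm_reverse]
    simp only [← Finset.mul_sum, h1]
    simp

theorem canonicalFamily_ι (f : Module.Dual k V) (v : V) :
    Y.canonicalFamily hS f (Y.nicholsι v) = f v • 1 := by
  obtain ⟨p, P, g, j, hP, hg, rfl⟩ := (Y.dual hS).exists_family f
  rw [Y.canonicalFamily_eq hS hg]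
  have h := congrArg (fun f : Module.Dual k V => f v) ((Y.dual hS).counit_coact (g j))
  rw [hg] at h
  simp only [map_sum, LinearMap.rTensor_tmul, TensorProduct.lid_tmul, LinearMap.sum_apply,
    LinearMap.smul_apply, smul_eq_mul] at h
  simp [rightQuantumDerivation_ι, Y.nichols_isBraidedAlgebra.act_one, smul_smul, ← h,
    Finset.sum_smul, mul_comm]

/-- A family of braided derivations of `B(V)` is determined by its values on `V`. -/
theorem eq_canonicalFamily {D : Module.Dual k V →ₗ[k] Module.End k Y.Nichols}
    (hD : IsBraidedDerivationFamily (LinearMap.mul k Y.Nichols) Y.nicholsAct (Y.dual hS).coact D)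
    (hι : ∀ f v, D f (Y.nicholsι v) = f v • 1) : D = Y.canonicalFamily hS := by
  -- The rule at $1\cdot1$ reads $D_f(1)=D_f(1)+D_f(1)$, after the counit axiom.
  have key : ∀ (D : Module.Dual k V →ₗ[k] Module.End k Y.Nichols), IsBraidedDerivationFamily
      (LinearMap.mul k Y.Nichols) Y.nicholsAct (Y.dual hS).coact D → ∀ f, D f 1 = 0 := by
    intro D hD f
    have h := hD f 1 1
    obtain ⟨p, P, g, j, hP, hg, rfl⟩ := (Y.dual hS).exists_family f
    rw [hg] at h
    simpa [Y.nichols_isBraidedAlgebra.act_one, hP.counit_eq, ite_smul] using h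
  have hC := Y.canonicalFamily_isBraidedDerivationFamily hS
  -- The derivation rule involves $D_{f_{(0)}}$, so the induction on $x$ must treat all $f$ at once.
  suffices h : ∀ x, D.flip x = (Y.canonicalFamily hS).flip x by
    ext f x
    exact congrArg (fun g => g f) (h x)
  intro x
  induction x using Y.nichols_left_induction with
  | one => ext f; simp only [LinearMap.flip_apply, key D hD, key _ hC]
  | ι_mul v x hx =>
    ext f
    have h1 := hD f (Y.nicholsι v) x
    have h2 := hC f (Y.nicholsι v) x
    rw [hx, hι] at h1
    rw [canonicalFamily_ι] at h2
    exact h1.trans h2.symm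
  | smul c x hx => simp only [map_smul, hx]
  | add x y hx hy => simp only [map_add, hx, hy]

end CanonicalDerivations
end YetterDrinfeld

/-! ### The inverse braiding with one argument fixed. -/

section InvBraiding
variable {k H V W : Type*} [Field k] [Ring H] [HopfAlgebra k H] [AddCommGroup V] [Module k V]
  [AddCommGroup W] [Module k W] (hS : Function.Bijective (antipode k : H →ₗ[k] H))

/-- The linear map `h ⊗ v ↦ v ⊗ S⁻¹(h) · w`. -/
noncomputable def invBraidingAux (ρ : H →ₐ[k] Module.End k W) (w : W) :
    H ⊗[k] V →ₗ[k] V ⊗[k] W :=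
  (TensorProduct.comm k W V).toLinearMap ∘ₗ
    (ρ.toLinearMap.flip w ∘ₗ antipodeInv hS).rTensor V

@[simp] theorem invBraidingAux_tmul (ρ : H →ₐ[k] Module.End k W) (w : W) (h : H) (v : V) :
    invBraidingAux hS ρ w (h ⊗ₜ v) = v ⊗ₜ ρ (antipodeInv hS h) w := by
  simp [invBraidingAux]

theorem invBraiding_apply (δ : V →ₗ[k] H ⊗[k] V) (ρ : H →ₐ[k] Module.End k W) (w : W) (v : V) :
    invBraiding hS δ ρ (w ⊗ₜ v) = invBraidingAux hS ρ w (δ v) := rfl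

end InvBraiding

/-! ### Associativity of the algebra on $\mathcal B(W)\otimes\mathcal B(W^*)$. -/

namespace YetterDrinfeld
section SmashAlgebra
variable {k H W : Type*} [Field k] [Ring H] [HopfAlgebra k H] [AddCommGroup W] [Module k W]
  [FiniteDimensional k W]
  (Y : YetterDrinfeld k H W) (hS : Function.Bijective (antipode k : H →ₗ[k] H))

omit [FiniteDimensional k W] in
theorem invBraiding_of_act_one {A : Type*} [Ring A] [Algebra k A] {ρ : H →ₐ[k] Module.End k A}
    (hρ : ∀ h, ρ h 1 = counit (R := k) h • (1 : A)) (b : Y.Nichols) :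
    invBraiding hS Y.nicholsCoact.toLinearMap ρ (1 ⊗ₜ b) = b ⊗ₜ 1 := by
  rw [invBraiding_apply]
  conv_rhs => rw [← Y.nichols_isBraidedAlgebra.counit_coact b]
  rw [AlgHom.toLinearMap_apply]
  generalize Y.nicholsCoact b = u
  induction u using TensorProduct.induction_on with
  | zero => simp
  | add x y hx hy => simp only [map_add, TensorProduct.add_tmul, hx, hy]
  | tmul h x => simp [hρ, counit_antipodeInv, TensorProduct.smul_tmul']

/-- The map `p ⊗ q ↦ c⁻¹(p ⊗ ∂_q(b))`. -/
noncomputable def exchangeAux (b : Y.Nichols) :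
    (Y.dual hS).Nichols ⊗[k] (Y.dual hS).Nichols →ₗ[k] Y.Smash hS :=
  invBraiding hS Y.nicholsCoact.toLinearMap (Y.dual hS).nicholsAct ∘ₗ
    ((Y.nicholsQDO hS).flip b).lTensor (Y.dual hS).Nichols

theorem exchangeAux_tmul (b : Y.Nichols) (p q : (Y.dual hS).Nichols) :
    Y.exchangeAux hS b (p ⊗ₜ q) = invBraidingAux hS (Y.dual hS).nicholsAct p
      (Y.nicholsCoact (Y.nicholsQDO hS q b)) := rfl

theorem smashExchange_tmul (ξ : (Y.dual hS).Nichols) (b : Y.Nichols) :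
    Y.smashExchange hS (ξ ⊗ₜ b) = Y.exchangeAux hS b ((Y.dual hS).nicholsComul ξ) := by
  simp only [smashExchange, exchangeAux, LinearMap.comp_apply, LinearMap.rTensor_tmul]
  generalize (Y.dual hS).nicholsComul ξ = u
  induction u using TensorProduct.induction_on with
  | zero => simp
  | add x y hx hy => simp only [map_add, TensorProduct.add_tmul, hx, hy]
  | tmul p q => simp

theorem smashExchange_one (b : Y.Nichols) : Y.smashExchange hS (1 ⊗ₜ b) = b ⊗ₜ 1 := by
  rw [smashExchange_tmul, nicholsComul_one, exchangeAux_tmul, nicholsQDO_one]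
  exact Y.invBraiding_of_act_one hS (Y.dual hS).nichols_isBraidedAlgebra.act_one b

theorem smashExchange_ι (f : Module.Dual k W) (b : Y.Nichols) :
    Y.smashExchange hS ((Y.dual hS).nicholsι f ⊗ₜ b) =
      invBraidingAux hS (Y.dual hS).nicholsAct ((Y.dual hS).nicholsι f) (Y.nicholsCoact b) +
        Y.quantumDerivation f b ⊗ₜ 1 := by
  rw [smashExchange_tmul, nicholsComul_ι, map_add, exchangeAux_tmul, exchangeAux_tmul,
    nicholsQDO_one, nicholsQDO_ι]
  congr 1
  exact Y.invBraiding_of_act_one hS (Y.dual hS).nichols_isBraidedAlgebra.act_one _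

theorem smashMul_ι_tmul (f : Module.Dual k W) (b : Y.Nichols) (ζ : (Y.dual hS).Nichols) :
    Y.smashMul hS (1 ⊗ₜ (Y.dual hS).nicholsι f) (b ⊗ₜ ζ) =
      (LinearMap.mulRight k ζ).lTensor Y.Nichols (invBraidingAux hS (Y.dual hS).nicholsAct
        ((Y.dual hS).nicholsι f) (Y.nicholsCoact b)) + Y.quantumDerivation f b ⊗ₜ ζ := by
  rw [smashMul_tmul, smashExchange_ι, LinearMap.mulLeft_one, map_add]
  simp [LinearMap.lTensor]

theorem smashMul_one_tmul (ξ ζ : (Y.dual hS).Nichols) (b : Y.Nichols) :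
    Y.smashMul hS (1 ⊗ₜ ξ) (b ⊗ₜ ζ) =
      (LinearMap.mulRight k ζ).lTensor Y.Nichols (Y.smashExchange hS (ξ ⊗ₜ b)) := by
  rw [smashMul_tmul, LinearMap.mulLeft_one, LinearMap.lTensor]

/-- Outer factors, from $\mathcal B(W)$ on the left and, in `smashMul_lTensor`, from $\mathcal
B(W^*)$ on the right, pass through the product. Only products beginning with $1\otimes\xi$ then need
study. -/
theorem smashMul_rTensor (x : Y.Nichols) (a b : Y.Smash hS) :
    Y.smashMul hS ((LinearMap.mulLeft k x).rTensor _ a) b =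
      (LinearMap.mulLeft k x).rTensor _ (Y.smashMul hS a b) := by
  induction a using TensorProduct.induction_on with
  | zero => simp
  | add p q hp hq => simp only [map_add, LinearMap.add_apply, hp, hq]
  | tmul p ξ =>
    induction b using TensorProduct.induction_on with
    | zero => simp
    | add p q hp hq => simp only [map_add, hp, hq]
    | tmul q ζ =>
      rw [LinearMap.rTensor_tmul, smashMul_tmul, smashMul_tmul, LinearMap.mulLeft_apply,
        LinearMap.rTensor_map, LinearMap.mulLeft_mul]

theorem smashMul_lTensor (ζ : (Y.dual hS).Nichols) (a b : Y.Smash hS) :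
    Y.smashMul hS a ((LinearMap.mulRight k ζ).lTensor _ b) =
      (LinearMap.mulRight k ζ).lTensor _ (Y.smashMul hS a b) := by
  induction a using TensorProduct.induction_on with
  | zero => simp
  | add p q hp hq => simp only [map_add, LinearMap.add_apply, hp, hq]
  | tmul p ξ =>
    induction b using TensorProduct.induction_on with
    | zero => simp
    | add p q hp hq => simp only [map_add, hp, hq]
    | tmul q η =>
      rw [LinearMap.lTensor_tmul, smashMul_tmul, smashMul_tmul, LinearMap.mulRight_apply,
        LinearMap.lTensor_map, LinearMap.mulRight_mul]

theorem smashMul_tmul_eq (x : Y.Nichols) (ξ : (Y.dual hS).Nichols) (b : Y.Smash hS) :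
    Y.smashMul hS (x ⊗ₜ ξ) b =
      (LinearMap.mulLeft k x).rTensor _ (Y.smashMul hS (1 ⊗ₜ ξ) b) := by
  rw [← smashMul_rTensor]; simp

theorem smashMul_one_one (b : Y.Smash hS) : Y.smashMul hS (1 ⊗ₜ 1) b = b := by
  induction b using TensorProduct.induction_on with
  | zero => simp
  | add p q hp hq => rw [map_add, hp, hq]
  | tmul q η => rw [smashMul_one_tmul, smashExchange_one]; simp

theorem smashMul_tmul_one (x : Y.Nichols) (b : Y.Smash hS) :
    Y.smashMul hS (x ⊗ₜ 1) b = (LinearMap.mulLeft k x).rTensor _ b := by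
  rw [smashMul_tmul_eq, smashMul_one_one]

/-- This is the source of $(f\xi)b=f(\xi b)$. With $y=\partial_q(b)$, the two terms of $\Delta(f)$
give the two terms of $f$ times $y_{(0)}\otimes S^{-1}(y_{(-1)})\cdot p$; the second match uses
colinearity of $\partial_f$. -/
theorem exchangeAux_braidedMul (f : Module.Dual k W) (b : Y.Nichols)
    (u : (Y.dual hS).Nichols ⊗[k] (Y.dual hS).Nichols) :
    Y.exchangeAux hS b (braidedMul (Y.dual hS).nicholsAct (Y.dual hS).nicholsCoact
      ((Y.dual hS).nicholsComul ((Y.dual hS).nicholsι f)) u) =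
      Y.smashMul hS (1 ⊗ₜ (Y.dual hS).nicholsι f) (Y.exchangeAux hS b u) := by
  induction u using TensorProduct.induction_on with
  | zero => simp
  | add x y hx hy => simp only [map_add, hx, hy]
  | tmul p q =>
    obtain ⟨n, P, g, j, hP, hg, rfl⟩ := (Y.dual hS).exists_family f
    obtain ⟨n, N, x, m, hN, hx, hb⟩ := Y.nichols_exists_family (Y.nicholsQDO hS q b)
    rw [nicholsComul_ι, map_add, LinearMap.add_apply, braidedMul_ι_left, braidedMul_tmul_map,
      nicholsCoact_ι, hg, map_add]
    simp only [map_sum, LinearMap.lTensor_tmul, TensorProduct.map_tmul, LinearMap.comp_apply,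
      LinearMap.mulLeft_apply, one_mul, LinearMap.mulRight_apply, LinearMap.flip_apply,
      AlgHom.toLinearMap_apply, exchangeAux_tmul, nicholsQDO_mul, Module.End.mul_apply,
      nicholsQDO_ι, ← hb, Y.nicholsCoact_quantumDerivation hS, hg, hx, invBraidingAux_tmul,
      mulQuantumDerivation_tmul, LinearMap.sum_apply, smashMul_ι_tmul, Finset.sum_add_distrib,
      LinearMap.lTensor_tmul]
    congr 1
    · simp only [(Y.dual hS).nicholsAct_mul (hN.antipodeInv hS), TensorProduct.tmul_sum]
      rw [Finset.sum_comm]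
    -- The coefficient $f_{(-1)}$ acting on $p$ is cancelled by the $S^{-1}$ of the coefficient that
    -- colinearity of $\partial_f$ contributes.
    · have h1 : ∀ (c : Fin n) l, ∑ i, (Y.dual hS).nicholsAct (antipodeInv hS (P i l * N m c))
          ((Y.dual hS).nicholsAct (P j i) p) =
          if j = l then (Y.dual hS).nicholsAct (antipodeInv hS (N m c)) p else 0 := by
        intro c l
        have h2 := congrArg (fun h => (Y.dual hS).nicholsAct (antipodeInv hS (N m c) * h) p)
          (hP.sum_antipodeInv_mul hS j l)
        simp only [Finset.mul_sum, map_sum, LinearMap.sum_apply, ← mul_assoc,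
          ← antipodeInv_mul] at h2
        simp only [map_mul _ (antipodeInv _ _), Module.End.mul_apply] at h2
        rw [h2]
        split_ifs <;> simp
      rw [sum_comm_reverse]
      have h2 : ∀ (c : Fin n) l, ∑ i, Y.quantumDerivation (g l) (x c) ⊗ₜ[k]
          (Y.dual hS).nicholsAct (antipodeInv hS (P i l * N m c))
            ((Y.dual hS).nicholsAct (P j i) p) =
          if j = l then Y.quantumDerivation (g l) (x c) ⊗ₜ[k]
            (Y.dual hS).nicholsAct (antipodeInv hS (N m c)) p else 0 := by
        intro c l
        rw [← TensorProduct.tmul_sum, h1]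
        split_ifs <;> simp
      simp only [h2]
      rw [Finset.sum_comm]
      simp

theorem smashMul_ι_mul (f : Module.Dual k W) (ξ : (Y.dual hS).Nichols) (b : Y.Smash hS) :
    Y.smashMul hS (1 ⊗ₜ ((Y.dual hS).nicholsι f * ξ)) b =
      Y.smashMul hS (1 ⊗ₜ (Y.dual hS).nicholsι f) (Y.smashMul hS (1 ⊗ₜ ξ) b) := by
  induction b using TensorProduct.induction_on with
  | zero => simp
  | add x y hx hy => simp only [map_add, hx, hy]
  | tmul b ζ =>
    rw [smashMul_one_tmul, smashMul_one_tmul, smashMul_lTensor, smashExchange_tmul,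
      smashExchange_tmul, nicholsComul_mul, exchangeAux_braidedMul]

/-- The commutation $f\,x=x_{(0)}\,(S^{-1}(x_{(-1)})\cdot f)+\partial_f(x)$ persists in front of any
$u$. Its content is the Leibniz rule for $\partial_f$ together with multiplicativity of the
coaction. -/
theorem smashMul_ι_rTensor {n : ℕ} {N : Fin n → Fin n → H} {x : Fin n → Y.Nichols}
    (hx : ∀ j, Y.nicholsCoact (x j) = ∑ i, N j i ⊗ₜ[k] x i) (m : Fin n)
    (f : Module.Dual k W) (u : Y.Smash hS) :
    Y.smashMul hS (1 ⊗ₜ (Y.dual hS).nicholsι f) ((LinearMap.mulLeft k (x m)).rTensor _ u) =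
      ∑ c, (LinearMap.mulLeft k (x c)).rTensor _ (Y.smashMul hS (1 ⊗ₜ
        (Y.dual hS).nicholsι (Y.dualAct (antipodeInv hS (N m c)) f)) u) +
      (LinearMap.mulLeft k (Y.quantumDerivation f (x m))).rTensor _ u := by
  induction u using TensorProduct.induction_on with
  | zero => simp
  | add x y hx hy => simp only [map_add, hx, hy, Finset.sum_add_distrib]; abel
  | tmul y ζ =>
    have hd : (Y.dual hS).act = Y.dualAct := rfl
    simp only [LinearMap.rTensor_tmul, smashMul_ι_tmul, LinearMap.mulLeft_apply, map_mul, hx,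
      Y.quantumDerivation_mul hS, map_add, map_sum, Finset.sum_add_distrib,
      twistedDerivation_tmul, TensorProduct.add_tmul, TensorProduct.sum_tmul, Finset.sum_mul]
    have h1 : ∀ c (v : H ⊗[k] Y.Nichols),
        (LinearMap.mulRight k ζ).lTensor Y.Nichols (invBraidingAux hS (Y.dual hS).nicholsAct
          ((Y.dual hS).nicholsι f) (N m c ⊗ₜ x c * v)) =
        (LinearMap.mulLeft k (x c)).rTensor _ ((LinearMap.mulRight k ζ).lTensor Y.Nichols
          (invBraidingAux hS (Y.dual hS).nicholsAct
            ((Y.dual hS).nicholsι (Y.dualAct (antipodeInv hS (N m c)) f)) v)) := by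
      intro c v
      induction v using TensorProduct.induction_on with
      | zero => simp
      | add a b ha hb => simp only [mul_add, map_add, ha, hb]
      | tmul a b => simp [antipodeInv_mul, nicholsAct_ι, hd]
    simp only [h1]
    abel

/-- The multiplication of `B(W) # B(W^*)` is associative. -/
theorem smashMul_assoc (a b c : Y.Smash hS) :
    Y.smashMul hS (Y.smashMul hS a b) c = Y.smashMul hS a (Y.smashMul hS b c) := by
  -- For a generator on the left, both sides expand by the commutation rule; the remaining
  -- discrepancy $(f'\zeta)c=f'(\zeta c)$ is `smashMul_ι_mul`.
  have h1 : ∀ (f : Module.Dual k W) (b c : Y.Smash hS),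
      Y.smashMul hS (Y.smashMul hS (1 ⊗ₜ (Y.dual hS).nicholsι f) b) c =
        Y.smashMul hS (1 ⊗ₜ (Y.dual hS).nicholsι f) (Y.smashMul hS b c) := by
    intro f b c
    induction b using TensorProduct.induction_on with
    | zero => simp
    | add x y hx hy => simp only [map_add, LinearMap.add_apply, hx, hy]
    | tmul b ζ =>
      obtain ⟨n, N, x, m, hN, hx, rfl⟩ := Y.nichols_exists_family b
      have hd : (Y.dual hS).act = Y.dualAct := rfl
      rw [Y.smashMul_tmul_eq hS (x m), Y.smashMul_ι_rTensor hS hx, smashMul_ι_tmul, hx]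
      simp only [map_sum, map_add, LinearMap.add_apply, LinearMap.sum_apply, invBraidingAux_tmul,
        LinearMap.lTensor_tmul, LinearMap.mulRight_apply, nicholsAct_ι, hd]
      rw [Y.smashMul_tmul_eq hS (Y.quantumDerivation f (x m))]
      congr 1
      refine Finset.sum_congr rfl fun i _ => ?_
      rw [smashMul_tmul_eq, smashMul_ι_mul]
  have h2 : ∀ (ξ : (Y.dual hS).Nichols) (b c : Y.Smash hS),
      Y.smashMul hS (Y.smashMul hS (1 ⊗ₜ ξ) b) c =
        Y.smashMul hS (1 ⊗ₜ ξ) (Y.smashMul hS b c) := by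
    intro ξ
    induction ξ using (Y.dual hS).nichols_left_induction with
    | one => intro b c; simp only [smashMul_one_one]
    | ι_mul f ξ hξ => intro b c; simp only [smashMul_ι_mul, h1, hξ]
    | smul c x hx =>
      intro b d
      simp only [TensorProduct.tmul_smul, map_smul, LinearMap.smul_apply, hx]
    | add x y hx hy =>
      intro b d
      simp only [TensorProduct.tmul_add, map_add, LinearMap.add_apply, hx, hy]
  induction a using TensorProduct.induction_on with
  | zero => simp
  | add x y hx hy => simp only [map_add, LinearMap.add_apply, hx, hy]
  | tmul x ξ => rw [smashMul_tmul_eq, smashMul_rTensor, h2, ← smashMul_tmul_eq]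

/-! ### The representation by quantum differential operators. -/

/-- The projection `id ⊗ ε` from `B(W) # B(W^*)` to `B(W)`. -/
noncomputable def smashCounit : Y.Smash hS →ₗ[k] Y.Nichols :=
  contract Y.Nichols (Y.dual hS).nicholsCounit.toLinearMap

/-- $\varepsilon$ is $H$-linear, so it removes the action in $c^{-1}$ and leaves
$\varepsilon(\xi^{(1)})\,\partial_{\xi^{(2)}}(b)$. -/
theorem smashCounit_smashExchange (ξ : (Y.dual hS).Nichols) (b : Y.Nichols) :
    Y.smashCounit hS (Y.smashExchange hS (ξ ⊗ₜ b)) = Y.nicholsQDO hS ξ b := by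
  rw [smashExchange_tmul]
  conv_rhs => rw [← (Y.dual hS).nicholsCounit_comul_left ξ, leftQDO_apply]
  generalize (Y.dual hS).nicholsComul ξ = u
  induction u using TensorProduct.induction_on with
  | zero => simp
  | add x y hx hy => simp only [map_add, LinearMap.add_apply, hx, hy]
  | tmul p q =>
    rw [exchangeAux_tmul, LinearMap.rTensor_tmul, TensorProduct.lid_tmul, map_smul,
      LinearMap.smul_apply]
    generalize Y.nicholsQDO hS q b = x
    conv_rhs => rw [← Y.nichols_isBraidedAlgebra.counit_coact x]
    generalize Y.nicholsCoact x = v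
    induction v using TensorProduct.induction_on with
    | zero => simp
    | add x y hx hy => simp only [map_add, smul_add, hx, hy]
    | tmul h x =>
      simp [smashCounit, nicholsCounit_act, counit_antipodeInv, smul_smul, mul_comm]

/-- $\Psi$ is thus the action induced on a quotient of the left regular module, so its
multiplicativity is associativity read through this projection. -/
theorem smashCounit_smashMul (a u : Y.Smash hS) :
    Y.smashCounit hS (Y.smashMul hS a u) = Y.smashRep hS a (Y.smashCounit hS u) := by
  induction a using TensorProduct.induction_on with
  | zero => simp
  | add x y hx hy => simp only [map_add, LinearMap.add_apply, hx, hy]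
  | tmul x ξ =>
    induction u using TensorProduct.induction_on with
    | zero => simp
    | add x y hx hy => simp only [map_add, hx, hy]
    | tmul y ζ =>
      have h1 : ∀ v : Y.Smash hS, Y.smashCounit hS
          (TensorProduct.map (LinearMap.mulLeft k x) (LinearMap.mulRight k ζ) v) =
          (Y.dual hS).nicholsCounit ζ • (x * Y.smashCounit hS v) := by
        intro v
        induction v using TensorProduct.induction_on with
        | zero => simp
        | add p q hp hq => simp only [map_add, mul_add, smul_add, hp, hq]
        | tmul p q => simp [smashCounit, smul_smul, mul_comm]
      rw [smashMul_tmul, h1, smashCounit_smashExchange]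
      simp [smashRep, smashCounit]

theorem smashRep_smashMul (a b : Y.Smash hS) :
    Y.smashRep hS (Y.smashMul hS a b) = Y.smashRep hS a * Y.smashRep hS b := by
  ext y
  have hy : y = Y.smashCounit hS (y ⊗ₜ 1) := by simp [smashCounit]
  rw [hy, Module.End.mul_apply]
  simp only [← smashCounit_smashMul, smashMul_assoc]

/-! ### The diagonal action as a module algebra structure. -/

section Action
variable {n : ℕ} {N : Fin n → Fin n → H} (hN : IsComatrix k N)
include hN

theorem smashAct_tmul (i j : Fin n) (x : Y.Nichols) (ξ : (Y.dual hS).Nichols) :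
    Y.smashAct hS (N i j) (x ⊗ₜ ξ) =
      ∑ l, Y.nicholsAct (N i l) x ⊗ₜ (Y.dual hS).nicholsAct (N l j) ξ := by
  simp [smashAct, hN.comul_eq, Module.endTensorEndAlgHom_apply]

/-- $c^{-1}$ is $H$-linear: in the coaction of $h_2\cdot b$, the left coefficient cancels against
$h_1$ acting on $p$, and $S^{-1}$ of the antipode restores the right coefficient. -/
theorem smashAct_invBraidingAux (p : (Y.dual hS).Nichols) (i j : Fin n) (b : Y.Nichols) :
    Y.smashAct hS (N i j) (invBraidingAux hS (Y.dual hS).nicholsAct p (Y.nicholsCoact b)) =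
      ∑ l, invBraidingAux hS (Y.dual hS).nicholsAct ((Y.dual hS).nicholsAct (N i l) p)
        (Y.nicholsCoact (Y.nicholsAct (N l j) b)) := by
  simp only [Y.nicholsCoact_act hN]
  generalize Y.nicholsCoact b = u
  induction u using TensorProduct.induction_on with
  | zero => simp
  | add x y hx hy =>
    simp only [map_add, mul_add, add_mul, Finset.sum_add_distrib, hx, hy]
  | tmul h x =>
    have h1 : ∀ (a c : Fin n), ∑ l, (Y.dual hS).nicholsAct
        (antipodeInv hS (N l a * h * antipode k (N c j))) ((Y.dual hS).nicholsAct (N i l) p) =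
        if i = a then (Y.dual hS).nicholsAct (N c j)
          ((Y.dual hS).nicholsAct (antipodeInv hS h) p) else 0 := by
      intro a c
      have h2 := congrArg (fun z => (Y.dual hS).nicholsAct (N c j * antipodeInv hS h * z) p)
        (hN.sum_antipodeInv_mul hS i a)
      simp only [Finset.mul_sum, map_sum, LinearMap.sum_apply] at h2
      simp only [antipodeInv_mul, antipodeInv_antipode, map_mul, Module.End.mul_apply] at h2 ⊢
      rw [h2]
      split_ifs <;> simp
    simp only [invBraidingAux_tmul, Y.smashAct_tmul hS hN, LinearMap.lTensor_tmul,
      Algebra.TensorProduct.tmul_mul_tmul, one_mul, mul_one, map_sum]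
    rw [Finset.sum_comm]
    have h3 : ∀ a, ∑ l, ∑ c, Y.nicholsAct (N a c) x ⊗ₜ[k] (Y.dual hS).nicholsAct
        (antipodeInv hS (N l a * h * antipode k (N c j))) ((Y.dual hS).nicholsAct (N i l) p) =
        if i = a then ∑ c, Y.nicholsAct (N a c) x ⊗ₜ[k] (Y.dual hS).nicholsAct (N c j)
          ((Y.dual hS).nicholsAct (antipodeInv hS h) p) else 0 := by
      intro a
      rw [Finset.sum_comm]
      simp only [← TensorProduct.tmul_sum, h1]
      split_ifs <;> simp
    simp only [h3]
    simp

/-- `B(W) # B(W^*)` is an `H`-module algebra. -/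
theorem smashAct_smashMul (a b : Y.Smash hS) (i j : Fin n) :
    Y.smashAct hS (N i j) (Y.smashMul hS a b) =
      ∑ l, Y.smashMul hS (Y.smashAct hS (N i l) a) (Y.smashAct hS (N l j) b) := by
  have hone : ∀ i j (x : Y.Nichols), Y.smashAct hS (N i j) (x ⊗ₜ 1) =
      Y.nicholsAct (N i j) x ⊗ₜ 1 := by
    intro i j x
    simp [Y.smashAct_tmul hS hN, (Y.dual hS).nichols_isBraidedAlgebra.act_one, hN.counit_eq,
      ite_smul, TensorProduct.tmul_ite]
  have hone' : ∀ i j (ξ : (Y.dual hS).Nichols), Y.smashAct hS (N i j) (1 ⊗ₜ ξ) =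
      1 ⊗ₜ (Y.dual hS).nicholsAct (N i j) ξ := by
    intro i j x
    simp [Y.smashAct_tmul hS hN, Y.nichols_isBraidedAlgebra.act_one, hN.counit_eq,
      ite_smul, TensorProduct.ite_tmul]
  have hmulL : ∀ (x : Y.Nichols) (b : Y.Smash hS) i j,
      Y.smashAct hS (N i j) (Y.smashMul hS (x ⊗ₜ 1) b) =
      ∑ l, Y.smashMul hS (Y.smashAct hS (N i l) (x ⊗ₜ 1)) (Y.smashAct hS (N l j) b) := by
    intro x b i j
    simp only [hone, smashMul_tmul_one]
    induction b using TensorProduct.induction_on with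
    | zero => simp
    | add x y hx hy => simp only [map_add, Finset.sum_add_distrib, hx, hy]
    | tmul y ζ =>
      simp only [LinearMap.rTensor_tmul, Y.smashAct_tmul hS hN, LinearMap.mulLeft_apply,
        Y.nicholsAct_mul hN, map_sum, TensorProduct.sum_tmul]
      rw [Finset.sum_comm]
  have hmulR : ∀ (ζ : (Y.dual hS).Nichols) (u : Y.Smash hS) i j,
      Y.smashAct hS (N i j) ((LinearMap.mulRight k ζ).lTensor _ u) =
      ∑ l, (LinearMap.mulRight k ((Y.dual hS).nicholsAct (N l j) ζ)).lTensor _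
        (Y.smashAct hS (N i l) u) := by
    intro ζ u i j
    induction u using TensorProduct.induction_on with
    | zero => simp
    | add x y hx hy => simp only [map_add, Finset.sum_add_distrib, hx, hy]
    | tmul y η =>
      simp only [LinearMap.lTensor_tmul, Y.smashAct_tmul hS hN, LinearMap.mulRight_apply,
        (Y.dual hS).nicholsAct_mul hN, map_sum, TensorProduct.tmul_sum]
      rw [Finset.sum_comm]
  -- By associativity, compatibility for left factors $a$ and $a'$ passes to $aa'$. It then suffices
  -- to treat $x\otimes1$ and $1\otimes f$ with $f\in W^*$.
  have hcomp : ∀ a a' : Y.Smash hS,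
      (∀ b i j, Y.smashAct hS (N i j) (Y.smashMul hS a b) =
        ∑ l, Y.smashMul hS (Y.smashAct hS (N i l) a) (Y.smashAct hS (N l j) b)) →
      (∀ b i j, Y.smashAct hS (N i j) (Y.smashMul hS a' b) =
        ∑ l, Y.smashMul hS (Y.smashAct hS (N i l) a') (Y.smashAct hS (N l j) b)) →
      ∀ b i j, Y.smashAct hS (N i j) (Y.smashMul hS (Y.smashMul hS a a') b) =
        ∑ l, Y.smashMul hS (Y.smashAct hS (N i l) (Y.smashMul hS a a'))
          (Y.smashAct hS (N l j) b) := by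
    intro a a' ha ha' b i j
    simp only [smashMul_assoc, ha, ha', map_sum, LinearMap.sum_apply]
    rw [Finset.sum_comm]
  have hgen : ∀ (f : Module.Dual k W) (b : Y.Smash hS) i j,
      Y.smashAct hS (N i j) (Y.smashMul hS (1 ⊗ₜ (Y.dual hS).nicholsι f) b) =
      ∑ l, Y.smashMul hS (Y.smashAct hS (N i l) (1 ⊗ₜ (Y.dual hS).nicholsι f))
        (Y.smashAct hS (N l j) b) := by
    intro f b i j
    have hd : (Y.dual hS).act = Y.dualAct := rfl
    simp only [hone']
    induction b using TensorProduct.induction_on with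
    | zero => simp
    | add x y hx hy => simp only [map_add, Finset.sum_add_distrib, hx, hy]
    | tmul y ζ =>
      rw [smashMul_ι_tmul, map_add, hmulR]
      simp only [Y.smashAct_invBraidingAux hS hN, Y.smashAct_tmul hS hN, map_sum, nicholsAct_ι,
        smashMul_ι_tmul, Finset.sum_add_distrib, Y.nicholsAct_quantumDerivation hN, hd,
        TensorProduct.sum_tmul]
      exact congrArg₂ (· + ·) Finset.sum_comm Finset.sum_comm
  have hξ : ∀ (ξ : (Y.dual hS).Nichols) (b : Y.Smash hS) i j,
      Y.smashAct hS (N i j) (Y.smashMul hS (1 ⊗ₜ ξ) b) =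
      ∑ l, Y.smashMul hS (Y.smashAct hS (N i l) (1 ⊗ₜ ξ)) (Y.smashAct hS (N l j) b) := by
    intro ξ
    induction ξ using (Y.dual hS).nichols_left_induction with
    | one => exact hmulL 1
    | ι_mul f ξ hξ =>
      -- $\partial_f(1)=0$ and $1$ is coinvariant, so the exchange adds no further term.
      have h1 : Y.smashMul hS (1 ⊗ₜ (Y.dual hS).nicholsι f) (1 ⊗ₜ ξ) =
          1 ⊗ₜ ((Y.dual hS).nicholsι f * ξ) := by
        simp [smashMul_ι_tmul, quantumDerivation_one, Algebra.TensorProduct.one_def,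
          antipodeInv_one]
      rw [← h1]
      exact hcomp _ _ (hgen f) hξ
    | smul c x hx =>
      intro b i j
      simp only [TensorProduct.tmul_smul, map_smul, LinearMap.smul_apply, hx, Finset.smul_sum]
    | add x y hx hy =>
      intro b i j
      simp only [TensorProduct.tmul_add, map_add, LinearMap.add_apply, hx, hy,
        Finset.sum_add_distrib]
  induction a using TensorProduct.induction_on with
  | zero => simp
  | add x y hx hy => simp only [map_add, LinearMap.add_apply, hx, hy, Finset.sum_add_distrib]
  | tmul x ξ =>
    have h1 : Y.smashMul hS (x ⊗ₜ 1) (1 ⊗ₜ ξ) = x ⊗ₜ ξ := by simp [smashMul_tmul_one]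
    rw [← h1]
    exact hcomp _ _ (hmulL x) (hξ ξ) b i j

end Action
end SmashAlgebra
end YetterDrinfeld

/-! ### The map $\phi_W$ from $W$ to its double dual. -/

theorem IsComatrix.antipode {k H : Type*} [Field k] [Ring H] [HopfAlgebra k H] {n : ℕ}
    {N : Fin n → Fin n → H} (hN : IsComatrix k N) :
    IsComatrix k (fun i j => antipode k (N j i)) where
  comul_eq i j := by
    rw [comul_antipode', hN.comul_eq]; simp
  counit_eq i j := by
    rw [counit_antipode, hN.counit_eq]; simp only [eq_comm]

namespace YetterDrinfeld
section DoubleDual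
variable {k H W : Type*} [Field k] [Ring H] [HopfAlgebra k H] [AddCommGroup W] [Module k W]
  (Y : YetterDrinfeld k H W) (hS : Function.Bijective (antipode k : H →ₗ[k] H))

variable {n : ℕ} {N : Fin n → Fin n → H} {v : Fin n → W}

/-- The family `S(w₋₁) · w₀`. -/
theorem coact_sum_antipode (hN : IsComatrix k N)
    (hv : ∀ j, Y.coact (v j) = ∑ i, N j i ⊗ₜ[k] v i) (j : Fin n) :
    Y.coact (∑ i, Y.act (antipode k (N j i)) (v i)) =
      ∑ m, antipode k (antipode k (N j m)) ⊗ₜ[k] ∑ l, Y.act (antipode k (N m l)) (v l) := by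
  have h1 := fun i => Y.coact_act hN.antipode i j (v i)
  simp only [map_sum]
  simp only [h1, hv, map_sum, TensorProduct.map_tmul, LinearMap.comp_apply,
    LinearMap.mulLeft_apply, LinearMap.mulRight_apply]
  -- The coefficient of $v_i$ cancels against the left coefficient coming from the action; only the
  -- $S^2$ coefficient survives.
  have h2 : ∀ (l m o : Fin n), ∑ i, (antipode k (N l i) *
      (N i o * antipode k (antipode k (N j m)))) ⊗ₜ[k] Y.act (antipode k (N m l)) (v o) =
      if l = o then antipode k (antipode k (N j m)) ⊗ₜ[k] Y.act (antipode k (N m l)) (v o)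
        else 0 := by
    intro l m o
    simp only [← mul_assoc, ← TensorProduct.sum_tmul, ← Finset.sum_mul, hN.sum_antipode_mul]
    split_ifs <;> simp
  have h3 : ∀ l, ∑ i, ∑ m, ∑ o, (antipode k (N l i) *
      (N i o * antipode k (antipode k (N j m)))) ⊗ₜ[k] Y.act (antipode k (N m l)) (v o) =
      ∑ m, antipode k (antipode k (N j m)) ⊗ₜ[k] Y.act (antipode k (N m l)) (v l) := by
    intro l
    rw [Finset.sum_comm]
    refine Finset.sum_congr rfl fun m _ => ?_
    rw [Finset.sum_comm]
    simp only [h2]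
    simp
  rw [Finset.sum_comm]
  simp only [h3, TensorProduct.tmul_sum]
  rw [Finset.sum_comm]

/-- The family `S⁻²(w₋₁) · w₀`. -/
theorem coact_sum_antipodeInv (hN : IsComatrix k N)
    (hv : ∀ j, Y.coact (v j) = ∑ i, N j i ⊗ₜ[k] v i) (j : Fin n) :
    Y.coact (∑ i, Y.act (antipodeInv hS (antipodeInv hS (N j i))) (v i)) =
      ∑ l, antipodeInv hS (antipodeInv hS (N j l)) ⊗ₜ[k]
        ∑ m, Y.act (antipodeInv hS (antipodeInv hS (N l m))) (v m) := by
  have h1 := fun i => Y.coact_act ((hN.antipodeInv hS).antipodeInv hS) j i (v i)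
  simp only [map_sum]
  simp only [h1, hv, map_sum, TensorProduct.map_tmul, LinearMap.comp_apply,
    LinearMap.mulLeft_apply, LinearMap.mulRight_apply, antipode_antipodeInv]
  have h2 : ∀ (l m o : Fin n), ∑ i, (antipodeInv hS (antipodeInv hS (N j l)) *
      (N i o * antipodeInv hS (N m i))) ⊗ₜ[k]
        Y.act (antipodeInv hS (antipodeInv hS (N l m))) (v o) =
      if m = o then antipodeInv hS (antipodeInv hS (N j l)) ⊗ₜ[k]
        Y.act (antipodeInv hS (antipodeInv hS (N l m))) (v o) else 0 := by
    intro l m o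
    simp only [← TensorProduct.sum_tmul, ← Finset.mul_sum, hN.sum_mul_antipodeInv]
    split_ifs <;> simp
  have h3 : ∀ l, ∑ i, ∑ m, ∑ o, (antipodeInv hS (antipodeInv hS (N j l)) *
      (N i o * antipodeInv hS (N m i))) ⊗ₜ[k]
        Y.act (antipodeInv hS (antipodeInv hS (N l m))) (v o) =
      ∑ m, antipodeInv hS (antipodeInv hS (N j l)) ⊗ₜ[k]
        Y.act (antipodeInv hS (antipodeInv hS (N l m))) (v m) := by
    intro l
    rw [Finset.sum_comm]
    refine Finset.sum_congr rfl fun m _ => ?_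
    rw [Finset.sum_comm]
    simp only [h2]
    simp
  rw [Finset.sum_comm]
  simp only [h3, TensorProduct.tmul_sum]

variable [FiniteDimensional k W]

theorem coact_eval (hv : ∀ j, Y.coact (v j) = ∑ i, N j i ⊗ₜ[k] v i) (j : Fin n) :
    ((Y.dual hS).dual hS).coact (Module.Dual.eval k W (v j)) =
      ∑ i, antipodeInv hS (antipodeInv hS (N j i)) ⊗ₜ[k] Module.Dual.eval k W (v i) := by
  apply dual_tensor_ext
  intro f
  refine ((Y.dual hS).dualCoact_eval hS _ f).trans ?_
  have h : contract H (Module.Dual.eval k W (v j)) ((Y.dual hS).coact f) =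
      antipodeInv hS (contract H f (Y.coact (v j))) := Y.dualCoact_eval hS f (v j)
  rw [h, hv]
  simp

/-- The coaction on evaluations carries $S^{-2}$ and the action carries $S^2$. With the $S$ in the
definition of $\phi_W$, the net effect is one $S$. -/
theorem doubleDualMap_eq (hv : ∀ j, Y.coact (v j) = ∑ i, N j i ⊗ₜ[k] v i) (j : Fin n) :
    Y.doubleDualMap hS (v j) =
      Module.Dual.eval k W (∑ i, Y.act (antipode k (N j i)) (v i)) := by
  have h : ∀ (h : H) (x : W), ((Y.dual hS).dual hS).act (antipodeInv hS h)
      (Module.Dual.eval k W x) = Module.Dual.eval k W (Y.act (antipode k h) x) := by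
    intro h x
    ext f
    have h1 : ((Y.dual hS).dual hS).act (antipodeInv hS h) (Module.Dual.eval k W x) f =
      f (Y.act (antipode k (antipode k (antipodeInv hS h))) x) := rfl
    rw [h1, antipode_antipodeInv]
    rfl
  simp only [doubleDualMap, LinearMap.comp_apply, Y.coact_eval hS hv, map_sum,
    TensorProduct.lift.tmul, antipode_antipodeInv, AlgHom.toLinearMap_apply, h]

/-- $\phi_W$ is a comodule map: the coaction of $S(w_{(-1)})\cdot w_{(0)}$ carries $S^2$, which
cancels the $S^{-2}$ of the double dual. Plain evaluation is not colinear in general, hence the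
twist. -/
theorem coact_doubleDualMap (hN : IsComatrix k N)
    (hv : ∀ j, Y.coact (v j) = ∑ i, N j i ⊗ₜ[k] v i) (j : Fin n) :
    ((Y.dual hS).dual hS).coact (Y.doubleDualMap hS (v j)) =
      ∑ i, N j i ⊗ₜ[k] Y.doubleDualMap hS (v i) := by
  simp only [Y.doubleDualMap_eq hS hv]
  rw [Y.coact_eval hS (v := fun j => ∑ i, Y.act (antipode k (N j i)) (v i))
    (Y.coact_sum_antipode hN hv)]
  simp only [antipodeInv_antipode]

/-- By finite dimension every functional is evaluation at some $w$; a preimage is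
$S^{-2}(w_{(-1)})\cdot w_{(0)}$, whose coaction is known from `coact_sum_antipodeInv`. -/
theorem doubleDualMap_surjective : Function.Surjective (Y.doubleDualMap hS) := by
  intro F
  obtain ⟨w, rfl⟩ := (Module.evalEquiv k W).surjective F
  obtain ⟨n, N, v, j, hN, hv, rfl⟩ := Y.exists_family w
  refine ⟨∑ i, Y.act (antipodeInv hS (antipodeInv hS (N j i))) (v i), ?_⟩
  rw [Y.doubleDualMap_eq hS (v := fun j =>
    ∑ i, Y.act (antipodeInv hS (antipodeInv hS (N j i))) (v i)) (Y.coact_sum_antipodeInv hS hN hv)]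
  have h1 : ∀ m, ∑ l, Y.act (antipodeInv hS (N j l))
      (Y.act (antipodeInv hS (antipodeInv hS (N l m))) (v m)) = if j = m then v m else 0 := by
    intro m
    have h2 := congrArg (fun h => Y.act (antipodeInv hS h) (v m)) (hN.sum_antipodeInv_mul hS j m)
    simp only [map_sum, LinearMap.sum_apply, antipodeInv_mul, map_mul, Module.End.mul_apply] at h2
    rw [h2]
    split_ifs <;> simp [antipodeInv_one]
  have h2 : ∑ l, Y.act (antipode k (antipodeInv hS (antipodeInv hS (N j l))))
      (∑ m, Y.act (antipodeInv hS (antipodeInv hS (N l m))) (v m)) = v j := by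
    simp only [antipode_antipodeInv, map_sum]
    rw [Finset.sum_comm]
    simp only [h1]
    simp
  rw [h2]
  rfl

/-- `φ_W` as a linear equivalence. -/
noncomputable def doubleDualEquiv : W ≃ₗ[k] Module.Dual k (Module.Dual k W) :=
  LinearEquiv.ofBijective (Y.doubleDualMap hS)
    ⟨(LinearMap.injective_iff_surjective_of_finrank_eq_finrank
      (by rw [Subspace.dual_finrank_eq, Subspace.dual_finrank_eq])).2
        (Y.doubleDualMap_surjective hS), Y.doubleDualMap_surjective hS⟩

theorem doubleDualEquiv_symm_apply (w : W) :
    (Y.doubleDualEquiv hS).symm (Y.doubleDualMap hS w) = w :=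
  (Y.doubleDualEquiv hS).symm_apply_apply w

end DoubleDual

/-! ### Derivations of $\mathcal B(W)\#\mathcal B(W^*)$ as inner braided derivations. -/

section SmashDerivation
variable {k H W : Type*} [Field k] [Ring H] [HopfAlgebra k H] [AddCommGroup W] [Module k W]
  [FiniteDimensional k W]
  (Y : YetterDrinfeld k H W) (hS : Function.Bijective (antipode k : H →ₗ[k] H))

/-- The family of braided derivations of `B(W) # B(W^*)` indexed by `W^**`. -/
noncomputable def smashDerivation :
    Module.Dual k (Module.Dual k W) →ₗ[k] Module.End k (Y.Smash hS) :=
  -(LinearMap.rTensorHom (Y.dual hS).Nichols ∘ₗ Y.braidedAd ∘ₗ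
      (Y.doubleDualEquiv hS).symm.toLinearMap) +
    TensorProduct.homTensorHomMap (RingHom.id k) Y.Nichols (Y.dual hS).Nichols Y.Nichols
        (Y.dual hS).Nichols ∘ₗ
      TensorProduct.map Y.nicholsAct.toLinearMap ((Y.dual hS).canonicalFamily hS) ∘ₗ
        ((Y.dual hS).dual hS).coact

theorem smashDerivation_tmul (w : W) (x : Y.Nichols) (g : (Y.dual hS).Nichols) :
    Y.smashDerivation hS (Y.doubleDualMap hS w) (x ⊗ₜ[k] g) =
      -(Y.braidedAd w x ⊗ₜ[k] g) +
        TensorProduct.map (Y.nicholsAct.toLinearMap.flip x)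
          (((Y.dual hS).canonicalFamily hS).flip g)
          (((Y.dual hS).dual hS).coact (Y.doubleDualMap hS w)) := by
  simp only [smashDerivation, LinearMap.add_apply, LinearMap.neg_apply, LinearMap.comp_apply,
    LinearEquiv.coe_coe, doubleDualEquiv_symm_apply, LinearMap.coe_rTensorHom,
    LinearMap.rTensor_tmul]
  congr 1
  generalize ((Y.dual hS).dual hS).coact (Y.doubleDualMap hS w) = u
  induction u using TensorProduct.induction_on with
  | zero => simp
  | add a b ha hb => simp only [map_add, LinearMap.add_apply, ha, hb]
  | tmul a b => simp

variable {n : ℕ} {N : Fin n → Fin n → H} {v : Fin n → W}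
  (hv : ∀ j, Y.coact (v j) = ∑ i, N j i ⊗ₜ[k] v i)
include hv

/-- For primitive $w$ only $\varepsilon(\xi)w+\langle\mathrm{pr}_1\xi,w\rangle 1$ remains of
$\partial_\xi(w)$, so moving $g$ past $w$ leaves a single right derivative of $g$ as correction. -/
theorem smashExchange_ι_right (g : (Y.dual hS).Nichols) (m : Fin n) :
    Y.smashExchange hS (g ⊗ₜ Y.nicholsι (v m)) =
      ∑ i, Y.nicholsι (v i) ⊗ₜ (Y.dual hS).nicholsAct (antipodeInv hS (N m i)) g +
        1 ⊗ₜ (Y.dual hS).rightQuantumDerivation (Module.Dual.eval k W (v m)) g := by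
  rw [smashExchange_tmul, rightQuantumDerivation_apply]
  have key : ∀ u, Y.exchangeAux hS (Y.nicholsι (v m)) u =
      ∑ i, Y.nicholsι (v i) ⊗ₜ (Y.dual hS).nicholsAct (antipodeInv hS (N m i))
        (contract _ (Y.dual hS).nicholsCounit.toLinearMap u) +
        1 ⊗ₜ contract _ (Module.Dual.eval k W (v m) ∘ₗ (Y.dual hS).nicholsProjOne) u := by
    intro u
    induction u using TensorProduct.induction_on with
    | zero => simp
    | add a b ha hb =>
      simp only [map_add, TensorProduct.tmul_add, Finset.sum_add_distrib, ha, hb]; abel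
    | tmul p q =>
      simp [exchangeAux_tmul, nicholsQDO_apply_ι, nicholsCoact_ι, hv,
        Algebra.TensorProduct.one_def, antipodeInv_one, Finset.smul_sum]
  rw [key, nicholsComul_counit_right]

variable (hN : IsComatrix k N)
include hN

/-- This selects $\phi_W$ as index: moving $w_{(-1)}$ from $g^{(2)}$ onto the evaluation point
produces $S(w_{(-1)})\cdot w_{(0)}$, the vector representing $\phi_W(w)$. -/
theorem sum_rightQuantumDerivation_eval (g : (Y.dual hS).Nichols) (l : Fin n) :
    ∑ i, (Y.dual hS).rightQuantumDerivation (Module.Dual.eval k W (v i))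
      ((Y.dual hS).nicholsAct (N l i) g) =
      (Y.dual hS).canonicalFamily hS (Y.doubleDualMap hS (v l)) g := by
  rw [(Y.dual hS).canonicalFamily_eq hS (g := fun j => Y.doubleDualMap hS (v j))
    (Y.coact_doubleDualMap hS hN hv)]
  simp only [rightQuantumDerivation_apply, (Y.dual hS).nicholsComul_act hN]
  generalize (Y.dual hS).nicholsComul g = u
  induction u using TensorProduct.induction_on with
  | zero => simp
  | add a b ha hb => simp only [map_add, Finset.sum_add_distrib, ha, hb]
  | tmul p q =>
    have hd : (Y.dual hS).act = Y.dualAct := rfl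
    simp only [map_sum, TensorProduct.map_tmul, contract_tmul, LinearMap.comp_apply,
      nicholsProjOne_act, Module.Dual.eval_apply, hd, dualAct_apply, map_smul,
      Y.doubleDualMap_eq hS hv, LinearMap.sum_apply, Finset.sum_smul]
    rw [Finset.sum_comm]

/-- On $\mathcal B(W^*)$ the braided commutator with $w$ is the canonical derivation:
$(w_{(-1)}\cdot g)\,w_{(0)}-w\,g=d_{\phi_W(w)}(g)$. -/
theorem sum_smashExchange (g : (Y.dual hS).Nichols) (l : Fin n) :
    ∑ i, Y.smashExchange hS ((Y.dual hS).nicholsAct (N l i) g ⊗ₜ Y.nicholsι (v i)) =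
      Y.nicholsι (v l) ⊗ₜ g +
        1 ⊗ₜ (Y.dual hS).canonicalFamily hS (Y.doubleDualMap hS (v l)) g := by
  simp only [Y.smashExchange_ι_right hS hv, Finset.sum_add_distrib]
  rw [← Y.sum_rightQuantumDerivation_eval hS hv hN, TensorProduct.tmul_sum]
  congr 1
  have h1 : ∀ m, ∑ i, Y.nicholsι (v m) ⊗ₜ[k] (Y.dual hS).nicholsAct (antipodeInv hS (N i m))
      ((Y.dual hS).nicholsAct (N l i) g) = if l = m then Y.nicholsι (v m) ⊗ₜ g else 0 := by
    intro m
    have h2 := congrArg (fun h => (Y.dual hS).nicholsAct h g) (hN.sum_antipodeInv_mul hS l m)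
    simp only [map_sum, LinearMap.sum_apply, map_mul, Module.End.mul_apply] at h2
    rw [← TensorProduct.tmul_sum, h2]
    split_ifs <;> simp
  rw [Finset.sum_comm]
  simp only [h1]
  simp

/-- The derivations of `B(W) # B(W^*)` are braided commutators with elements of `W`. -/
theorem smashDerivation_eq (j : Fin n) (a : Y.Smash hS) :
    Y.smashDerivation hS (Y.doubleDualMap hS (v j)) a =
      -Y.smashMul hS (Y.nicholsι (v j) ⊗ₜ 1) a +
        ∑ i, Y.smashMul hS (Y.smashAct hS (N j i) a) (Y.nicholsι (v i) ⊗ₜ 1) := by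
  induction a using TensorProduct.induction_on with
  | zero => simp
  | add a b ha hb =>
    simp only [map_add, LinearMap.add_apply, Finset.sum_add_distrib, ha, hb]; abel
  | tmul x g =>
    -- The term with $\nu_l$ in $\mathcal B(W)$, where $\nu_l$ is the image of $v_l$, completes $-w
    -- x$ to $-\operatorname{ad}_c w(x)$; the other is the second summand of the prescribed formula.
    have h1 : ∀ l, ∑ i, Y.smashMul hS (Y.nicholsAct (N j l) x ⊗ₜ
        (Y.dual hS).nicholsAct (N l i) g) (Y.nicholsι (v i) ⊗ₜ 1) =
        (Y.nicholsAct (N j l) x * Y.nicholsι (v l)) ⊗ₜ g +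
          Y.nicholsAct (N j l) x ⊗ₜ
            (Y.dual hS).canonicalFamily hS (Y.doubleDualMap hS (v l)) g := by
      intro l
      simp only [smashMul_tmul, ← map_sum, Y.sum_smashExchange hS hv hN]
      simp
    rw [smashDerivation_tmul, Y.coact_doubleDualMap hS hN hv]
    simp only [Y.smashAct_tmul hS hN, map_sum, LinearMap.sum_apply]
    rw [Finset.sum_comm]
    simp only [h1]
    simp [smashMul_tmul_one, braidedAd, braiding, nicholsCoact_ι, hv, TensorProduct.sub_tmul,
      TensorProduct.sum_tmul, Finset.sum_add_distrib]
    abel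

omit hv hN

theorem smashDerivation_isBraidedDerivationFamily :
    IsBraidedDerivationFamily (Y.smashMul hS) (Y.smashAct hS) ((Y.dual hS).dual hS).coact
      (Y.smashDerivation hS) := by
  intro f a b
  obtain ⟨w, rfl⟩ := Y.doubleDualMap_surjective hS f
  obtain ⟨n, N, v, j, hN, hv, rfl⟩ := Y.exists_family w
  rw [Y.coact_doubleDualMap hS hN hv]
  -- The module algebra property splits $w_{(-1)}\cdot(ab)$. The two terms $\pm(w_{(-1)}\cdot
  -- a)\,w_{(0)}\,b$ on the other side then cancel by associativity.
  have h1 : ∀ i, ∑ l, Y.smashMul hS (Y.smashMul hS (Y.smashAct hS (N j l) a)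
      (Y.smashAct hS (N l i) b)) (Y.nicholsι (v i) ⊗ₜ 1) =
      Y.smashMul hS (Y.smashAct hS (N j i) (Y.smashMul hS a b)) (Y.nicholsι (v i) ⊗ₜ 1) := by
    intro i
    rw [Y.smashAct_smashMul hS hN, map_sum, LinearMap.sum_apply]
  simp only [map_sum, TensorProduct.lift.tmul, LinearMap.compl₁₂_apply, LinearMap.flip_apply,
    AlgHom.toLinearMap_apply, Y.smashDerivation_eq hS hv hN, map_add, map_neg,
    LinearMap.add_apply, LinearMap.neg_apply, LinearMap.sum_apply, Finset.sum_add_distrib,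
    Finset.sum_neg_distrib, ← h1, smashMul_assoc]
  rw [Finset.sum_comm]
  abel

end SmashDerivation
end YetterDrinfeld

/-! ### The theorem. -/

theorem theorem2p14 {k H W : Type*} [Field k] [Ring H] [HopfAlgebra k H]
    [AddCommGroup W] [Module k W] [FiniteDimensional k W]
    (hS : Function.Bijective (antipode k : H →ₗ[k] H)) (Y : YetterDrinfeld k H W) :
    -- the product on `B(W) # B(W^*)` is the one transported from the algebra of quantum
    -- differential operators along `b # ξ ↦ L_b ∘ ∂_ξ`
    (∀ a b : Y.Smash hS,
      Y.smashRep hS (Y.smashMul hS a b) = Y.smashRep hS a * Y.smashRep hS b) ∧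
    -- `canonicalFamily` is the unique family `D` of braided derivations of `B(W^*)` indexed by
    -- `W^**` with `D_f(ξ) = ⟨f, ξ⟩` for `ξ ∈ W^*`
    (∀ D : Module.Dual k (Module.Dual k W) →ₗ[k] Module.End k (Y.dual hS).Nichols,
      (IsBraidedDerivationFamily (LinearMap.mul k (Y.dual hS).Nichols) (Y.dual hS).nicholsAct
          ((Y.dual hS).dual hS).coact D ∧
        ∀ (f : Module.Dual k (Module.Dual k W)) (ξ : Module.Dual k W),
          D f ((Y.dual hS).nicholsι ξ) = f ξ • 1) ↔
      D = (Y.dual hS).canonicalFamily hS) ∧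
    -- the formula defines a unique linear map on `W^**`, and it is a family of braided derivations
    ∃ d : Module.Dual k (Module.Dual k W) →ₗ[k] Module.End k (Y.Smash hS),
      (∀ d' : Module.Dual k (Module.Dual k W) →ₗ[k] Module.End k (Y.Smash hS),
        (∀ (w : W) (x : Y.Nichols) (g : (Y.dual hS).Nichols),
          d' (Y.doubleDualMap hS w) (x ⊗ₜ[k] g) =
            -(Y.braidedAd w x ⊗ₜ[k] g) +
              TensorProduct.map (Y.nicholsAct.toLinearMap.flip x)
                (((Y.dual hS).canonicalFamily hS).flip g)
                (((Y.dual hS).dual hS).coact (Y.doubleDualMap hS w))) ↔ d' = d) ∧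
      IsBraidedDerivationFamily (Y.smashMul hS) (Y.smashAct hS) ((Y.dual hS).dual hS).coact d := by
  refine ⟨Y.smashRep_smashMul hS, fun D => ⟨fun h => ?_, ?_⟩, Y.smashDerivation hS, fun d' =>
    ⟨fun h => ?_, ?_⟩, Y.smashDerivation_isBraidedDerivationFamily hS⟩
  · exact (Y.dual hS).eq_canonicalFamily hS h.1 h.2
  · rintro rfl
    exact ⟨(Y.dual hS).canonicalFamily_isBraidedDerivationFamily hS,
      (Y.dual hS).canonicalFamily_ι hS⟩
  · ext1 f
    -- The formula speaks only of indices $\phi_W(w)$; surjectivity of $\phi_W$ makes these all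
    -- indices.
    obtain ⟨w, rfl⟩ := Y.doubleDualMap_surjective hS f
    refine TensorProduct.ext' fun x g => ?_
    rw [h, Y.smashDerivation_tmul]
  · rintro rfl
    exact Y.smashDerivation_tmul hS
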